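/- Let $\theta_1\in\mathbb R\setminus\{0\}$, $\theta_2\in\mathbb R$, and let $C\in\mathbb R^{3\times 2}$ be the matrix with columns $(1,0,0)$ and $(0,\theta_1,\theta_2)$, so that $C^{\mathsf T}\nabla=(\partial_x,\ \theta_1\partial_{z_1}+\theta_2\partial_{z_2})$. Let $I_x,I_1\subset\mathbb R$ be nonempty open intervals, bounded or not, with $0\in\overline{I_x}$, and put $$\Omega=I_x\times I_1\times\mathbb R,\quad \Omega_{per}=I_x\times I_1\times(0,1),\quad \Sigma_{per}=\{0\}\times I_1\times(0,1),$$ $$Q_\theta=\{(x,z)\in\mathbb R^2:\ x\in I_x,\ \theta_1z\in I_1\},\qquad S_\theta=\{(0,z):\ \theta_1z\in I_1\}.$$ Functions are complex-valued. For $V\in L^2(\Omega_{per})$ let $EV$ be its $1$-periodic extension in $z_2$, and let the shear map be $$\mathcal S_\theta V(\mathbf x,s)=(EV)(x,\ \theta_1z,\ \theta_2z+s),\qquad \mathbf x=(x,z)\in Q_\theta,\ s\in(0,1);$$ for $\Phi\in L^2(\Sigma_{per})$ define $\mathcal S_\theta\Phi(\mathbf x,s)$, $\mathbf x=(0,z)\in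 S_\theta$, by the same formula with $x=0$. Define $$H^1_{C,per}(\Omega_{per})=\{V\in L^2(\Omega_{per}):\ \mathcal S_\theta V\in L^2(0,1;H^1(Q_\theta))\},$$ $$H^{1/2}_{C,per}(\Sigma_{per})=\{\Phi\in L^2(\Sigma_{per}):\ \mathcal S_\theta\Phi\in L^2(0,1;H^{1/2}(S_\theta))\},$$ the first with the norm $\big(\|V\|_{L^2(\Omega_{per})}^2+\|C^{\mathsf T}\nabla V\|_{L^2(\Omega_{per})}^2\big)^{1/2}$ (distributional derivatives, which are in $L^2(\Omega_{per})$ for every $V$ in the space), the second with the norm $\|\mathcal S_\theta\Phi\|_{L^2(0,1;H^{1/2}(S_\theta))}$. Let $C^\infty_{0,per}(\overline{\Omega_{per}})$ be the set of functions $v$ on $\overline{\Omega_{per}}$ that are restrictions of functions in $C^\infty_c(\mathbb R^3)$ and satisfy $Ev\in C^\infty(\Omega)$. Proposition. The functions in $C^\infty_{0,per}(\overline{\Omega_{per}})$ belong to $H^1_{C,per}(\Omega_{per})$, and the restriction map $v\mapsto v|_{\Sigma_{per}}$ on them extends in exactly one way to a continuous linear map $\gamma_{0,per}:H^1_{C,per}(\Omega_{per})\to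 L^2(\Sigma_{per})$. This map, also written $V\mapsto V|_{\Sigma_{per}}$, takes its values in $H^{1/2}_{C,per}(\Sigma_{per})$, and it is continuous and surjective from $H^1_{C,per}(\Omega_{per})$ to $H^{1/2}_{C,per}(\Sigma_{per})$. It commutes with the shear map: for every $V\in H^1_{C,per}(\Omega_{per})$ and almost every $s\in(0,1)$, $$\mathcal S_\theta(V|_{\Sigma_{per}})(\cdot,s)=\big(\mathcal S_\theta V(\cdot,s)\big)\big|_{S_\theta},$$ where the right-hand side is the usual trace on $S_\theta$ of a function in $H^1(Q_\theta)$, that is, the continuous extension to $H^1(Q_\theta)$ of the restriction $w\mapsto w|_{S_\theta}$ of functions $w\in C^\infty_c(\mathbb R^2)$. -/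

import Mathlib

open MeasureTheory Set Filter Topology
open scoped ContDiff ENNReal

namespace AnisoTrace

/-- Complex-valued `L²` functions (modulo a.e. equality) on a set `S`, for Lebesgue measure. -/
abbrev L2 {E : Type*} [MeasureSpace E] (S : Set E) : Type _ :=
  Lp ℂ 2 (volume.restrict S)

section Weak

variable {E : Type*} [NormedAddCommGroup E] [NormedSpace ℝ E]

theorem continuous_dir {φ : E → ℝ} (hφ : ContDiff ℝ ∞ φ) (v : E) :
    Continuous (fun x => fderiv ℝ φ x v) :=
  (hφ.continuous_fderiv (by simp)).clm_apply continuous_const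

theorem compact_dir {φ : E → ℝ} (hφ : HasCompactSupport φ) (v : E) :
    HasCompactSupport (fun x => fderiv ℝ φ x v) :=
  (hφ.fderiv (𝕜 := ℝ)).comp_left (g := fun L : E →L[ℝ] ℝ => L v) (by simp)

variable [MeasureSpace E]

/-- `g` is the derivative of `u` in the direction `v`, in the sense of distributions on `O`. -/
def IsWeakDeriv (O : Set E) (v : E) (u g : E → ℂ) : Prop :=
  ∀ φ : E → ℝ, ContDiff ℝ ∞ φ → HasCompactSupport φ → tsupport φ ⊆ O →
    ∫ x in O, (fderiv ℝ φ x v) • u x = - ∫ x in O, φ x • g x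

variable [BorelSpace E] [IsFiniteMeasureOnCompacts (volume : Measure E)]

theorem integrable_smul_L2 {O : Set E} {φ : E → ℝ} (hc : Continuous φ)
    (hs : HasCompactSupport φ) (u : L2 O) :
    Integrable (fun x => φ x • u x) (volume.restrict O) := by
  have h1 : MemLp φ 2 (volume.restrict O) := (hc.memLp_of_hasCompactSupport (μ := volume) hs).restrict O
  exact memLp_one_iff_integrable.1 (MemLp.smul (r := 1) (Lp.memLp u) h1)

/-- For two direction vectors `v 0, v 1`, the Sobolev space
`{u ∈ L²(O) : ∂_{v 0} u ∈ L²(O), ∂_{v 1} u ∈ L²(O)}`. An element is the triple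
`(u, ∂_{v 0} u, ∂_{v 1} u)`, so that the norm is
`(‖u‖² + ‖∂_{v 0} u‖² + ‖∂_{v 1} u‖²)^{1/2}`. -/
noncomputable def dirSobolev (O : Set E) (v : Fin 2 → E) :
    Submodule ℂ (PiLp 2 (fun _ : Fin 3 => L2 O)) where
  carrier := {U | ∀ i : Fin 2, IsWeakDeriv O (v i) (U 0) (U i.succ)}
  zero_mem' := by
    intro i φ _ _ _
    have h0 : ((0 : L2 O) : E → ℂ) =ᵐ[volume.restrict O] 0 := Lp.coeFn_zero _ _ _
    have e1 : ∫ x in O, (fderiv ℝ φ x (v i)) • (0 : L2 O) x = 0 := by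
      rw [integral_congr_ae (g := fun _ => (0 : ℂ))]
      · simp
      · filter_upwards [h0] with x hx
        rw [hx]; simp
    have e2 : ∫ x in O, φ x • (0 : L2 O) x = 0 := by
      rw [integral_congr_ae (g := fun _ => (0 : ℂ))]
      · simp
      · filter_upwards [h0] with x hx
        rw [hx]; simp
    simp only [PiLp.zero_apply]
    rw [e1, e2, neg_zero]
  add_mem' := by
    intro U W hU hW i φ h1 h2 h3
    have key : ∀ (ψ : E → ℝ) (_ : Continuous ψ) (_ : HasCompactSupport ψ) (a b : L2 O),
        ∫ x in O, ψ x • (a + b : L2 O) x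
          = (∫ x in O, ψ x • a x) + ∫ x in O, ψ x • b x := by
      intro ψ c s a b
      rw [← integral_add (integrable_smul_L2 c s a) (integrable_smul_L2 c s b)]
      refine integral_congr_ae ?_
      filter_upwards [Lp.coeFn_add a b] with x hx
      rw [hx, Pi.add_apply, smul_add]
    simp only [PiLp.add_apply]
    rw [key _ (continuous_dir h1 (v i)) (compact_dir h2 (v i)), key φ h1.continuous h2,
      hU i φ h1 h2 h3, hW i φ h1 h2 h3]
    ring
  smul_mem' := by
    intro k U hU i φ h1 h2 h3
    have key : ∀ (ψ : E → ℝ) (a : L2 O),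
        ∫ x in O, ψ x • (k • a : L2 O) x = k * ∫ x in O, ψ x • a x := by
      intro ψ a
      rw [← integral_const_mul]
      refine integral_congr_ae ?_
      filter_upwards [Lp.coeFn_smul k a] with x hx
      rw [hx, Pi.smul_apply, smul_eq_mul, Complex.real_smul, Complex.real_smul]
      ring
    simp only [PiLp.smul_apply]
    rw [key, key, hU i φ h1 h2 h3]
    ring

end Weak

/-- The two nontrivial entries `θ₁ ≠ 0`, `θ₂` of the cut matrix
`C = ((1, 0), (0, θ₁), (0, θ₂)) ∈ ℝ^{3 × 2}`. -/
structure Cut where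
  θ₁ : ℝ
  θ₂ : ℝ
  ne : θ₁ ≠ 0

/-- The columns of `C`: the components of `Cᵀ ∇` are the derivatives in these directions. -/
noncomputable def Cut.col (c : Cut) : Fin 2 → ℝ × ℝ × ℝ := ![(1, 0, 0), (0, c.θ₁, c.θ₂)]

/-- `H¹_C(O) = {U ∈ L²(O) : Cᵀ ∇ U ∈ L²(O)²}` for `O ⊆ ℝ³`, with its graph norm. -/
noncomputable abbrev H1C (c : Cut) (O : Set (ℝ × ℝ × ℝ)) := dirSobolev O c.col

/-- The classical space `H¹(O)` for `O ⊆ ℝ²`, with its usual norm. -/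
noncomputable abbrev H1 (O : Set (ℝ × ℝ)) := dirSobolev O ![((1 : ℝ), (0 : ℝ)), (0, 1)]

/-- The fractional Sobolev space `H^{1/2}(J)` of a set `J ⊆ ℝ` (Sobolev-Slobodeckij definition).
An element is a pair `(g, h)`, where `h(z, z') = (g(z) - g(z')) / (z - z')` is in `L²(J × J)`,
so that the norm squared is `∫_J |g|² + ∫_J ∫_J |g(z) - g(z')|² / |z - z'|² dz dz'`. -/
noncomputable def H12 (J : Set ℝ) : Submodule ℂ (WithLp 2 (L2 J × L2 (J ×ˢ J))) where
  carrier := {U | U.snd =ᵐ[volume.restrict (J ×ˢ J)]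
    fun p => (U.fst p.1 - U.fst p.2) / ((p.1 - p.2 : ℝ) : ℂ)}
  zero_mem' := by
    have hp : (volume.restrict (J ×ˢ J) : Measure (ℝ × ℝ))
        = (volume.restrict J).prod (volume.restrict J) := by
      rw [Measure.prod_restrict]; rfl
    have h0 : ((0 : L2 J) : ℝ → ℂ) =ᵐ[volume.restrict J] 0 := Lp.coeFn_zero _ _ _
    have h1 := Measure.quasiMeasurePreserving_fst
      (μ := volume.restrict J) (ν := volume.restrict J) |>.ae_eq_comp h0
    have h2 := Measure.quasiMeasurePreserving_snd
      (μ := volume.restrict J) (ν := volume.restrict J) |>.ae_eq_comp h0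
    rw [← hp] at h1 h2
    have h3 : ((0 : L2 (J ×ˢ J)) : ℝ × ℝ → ℂ) =ᵐ[volume.restrict (J ×ˢ J)] 0 :=
      Lp.coeFn_zero _ _ _
    change ((0 : L2 (J ×ˢ J)) : ℝ × ℝ → ℂ) =ᵐ[volume.restrict (J ×ˢ J)] fun p =>
      ((0 : L2 J) p.1 - (0 : L2 J) p.2) / ((p.1 - p.2 : ℝ) : ℂ)
    filter_upwards [h1, h2, h3] with p a b d
    simp only [Function.comp, Pi.zero_apply] at a b d
    rw [a, b, d]; simp
  add_mem' := by
    intro U W hU hW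
    have hp : (volume.restrict (J ×ˢ J) : Measure (ℝ × ℝ))
        = (volume.restrict J).prod (volume.restrict J) := by
      rw [Measure.prod_restrict]; rfl
    have h0 := Lp.coeFn_add U.fst W.fst
    have h1 := Measure.quasiMeasurePreserving_fst
      (μ := volume.restrict J) (ν := volume.restrict J) |>.ae_eq_comp h0
    have h2 := Measure.quasiMeasurePreserving_snd
      (μ := volume.restrict J) (ν := volume.restrict J) |>.ae_eq_comp h0
    rw [← hp] at h1 h2
    change ((U.snd + W.snd : L2 (J ×ˢ J)) : ℝ × ℝ → ℂ) =ᵐ[volume.restrict (J ×ˢ J)] fun p =>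
      ((U.fst + W.fst : L2 J) p.1 - (U.fst + W.fst : L2 J) p.2) / ((p.1 - p.2 : ℝ) : ℂ)
    filter_upwards [h1, h2, Lp.coeFn_add U.snd W.snd, hU, hW] with p a b d e f
    simp only [Function.comp, Pi.add_apply] at a b d
    rw [a, b, d, e, f]; ring
  smul_mem' := by
    intro k U hU
    have hp : (volume.restrict (J ×ˢ J) : Measure (ℝ × ℝ))
        = (volume.restrict J).prod (volume.restrict J) := by
      rw [Measure.prod_restrict]; rfl
    have h0 := Lp.coeFn_smul k U.fst
    have h1 := Measure.quasiMeasurePreserving_fst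
      (μ := volume.restrict J) (ν := volume.restrict J) |>.ae_eq_comp h0
    have h2 := Measure.quasiMeasurePreserving_snd
      (μ := volume.restrict J) (ν := volume.restrict J) |>.ae_eq_comp h0
    rw [← hp] at h1 h2
    change ((k • U.snd : L2 (J ×ˢ J)) : ℝ × ℝ → ℂ) =ᵐ[volume.restrict (J ×ˢ J)] fun p =>
      ((k • U.fst : L2 J) p.1 - (k • U.fst : L2 J) p.2) / ((p.1 - p.2 : ℝ) : ℂ)
    filter_upwards [h1, h2, Lp.coeFn_smul k U.snd, hU] with p a b d e
    simp only [Function.comp, Pi.smul_apply, smul_eq_mul] at a b d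
    rw [a, b, d, e]; ring

/-- `Ω = I_x × I₁ × ℝ`. -/
def Omega (Ix I₁ : Set ℝ) : Set (ℝ × ℝ × ℝ) := Ix ×ˢ I₁ ×ˢ univ

/-- `Ω_per = I_x × I₁ × (0, 1)`. -/
def OmegaPer (Ix I₁ : Set ℝ) : Set (ℝ × ℝ × ℝ) := Ix ×ˢ I₁ ×ˢ Ioo 0 1

/-- `Σ_per = {0} × I₁ × (0, 1)`, written in the coordinates `(z₁, z₂)`. -/
def SigmaPer (I₁ : Set ℝ) : Set (ℝ × ℝ) := I₁ ×ˢ Ioo 0 1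

/-- The edge `S_θ = {(0, z) : θ₁ z ∈ I₁}`, written in the coordinate `z`. -/
def edge (c : Cut) (I₁ : Set ℝ) : Set ℝ := {z | c.θ₁ * z ∈ I₁}

/-- `Q_θ = {(x, z) : x ∈ I_x, θ₁ z ∈ I₁}`. -/
def Q (c : Cut) (Ix I₁ : Set ℝ) : Set (ℝ × ℝ) := Ix ×ˢ edge c I₁

/-- The `1`-periodic extension in the variable `z₂` of a function on `I_x × I₁ × [0, 1)`. -/
noncomputable def extPer (V : ℝ × ℝ × ℝ → ℂ) : ℝ × ℝ × ℝ → ℂ :=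
  fun p => V (p.1, p.2.1, Int.fract p.2.2)

/-- The same extension for functions of `(z₁, z₂)`. -/
noncomputable def extPerSigma (Φ : ℝ × ℝ → ℂ) : ℝ × ℝ → ℂ := fun p => Φ (p.1, Int.fract p.2)

/-- The shear map `(S_θ V)(x, s) = (E V)(x, θ₁ z, θ₂ z + s)`. -/
noncomputable def shear (c : Cut) (V : ℝ × ℝ × ℝ → ℂ) (s : ℝ) (x : ℝ × ℝ) : ℂ :=
  extPer V (x.1, c.θ₁ * x.2, c.θ₂ * x.2 + s)

/-- The shear map on the face, `(S_θ Φ)(z, s) = (E Φ)(θ₁ z, θ₂ z + s)`. -/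
noncomputable def shearSigma (c : Cut) (Φ : ℝ × ℝ → ℂ) (s : ℝ) (z : ℝ) : ℂ :=
  extPerSigma Φ (c.θ₁ * z, c.θ₂ * z + s)

/-- Lebesgue measure on `(0, 1)`. -/
noncomputable abbrev unitMeas : Measure ℝ := volume.restrict (Ioo (0 : ℝ) 1)

/-- The shear of `V ∈ L²(Ω_per)` is the element `F` of the Bochner space `L²(0, 1; H¹(Q_θ))`. -/
def IsShear (c : Cut) (Ix I₁ : Set ℝ) (V : L2 (OmegaPer Ix I₁))
    (F : Lp (H1 (Q c Ix I₁)) 2 unitMeas) : Prop :=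
  ∀ᵐ s ∂unitMeas, ((F s).1 0 : ℝ × ℝ → ℂ) =ᵐ[volume.restrict (Q c Ix I₁)] shear c V s

/-- The shear of `Φ ∈ L²(Σ_per)` is the element `F` of the Bochner space
`L²(0, 1; H^{1/2}(S_θ))`. -/
def IsShearSigma (c : Cut) (I₁ : Set ℝ) (Φ : L2 (SigmaPer I₁))
    (F : Lp (H12 (edge c I₁)) 2 unitMeas) : Prop :=
  ∀ᵐ s ∂unitMeas, ((F s).1.fst : ℝ → ℂ) =ᵐ[volume.restrict (edge c I₁)] shearSigma c Φ s

/-! The shear of an `L²` class does not depend on the representative. -/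


/-- The change of variables behind the shear map. -/
noncomputable def shearPt (c : Cut) (q : ℝ × ℝ × ℝ) : ℝ × ℝ × ℝ :=
  (q.2.1, c.θ₁ * q.2.2, Int.fract (c.θ₂ * q.2.2 + q.1))

noncomputable def shearPtSigma (c : Cut) (q : ℝ × ℝ) : ℝ × ℝ :=
  (c.θ₁ * q.2, Int.fract (c.θ₂ * q.2 + q.1))

theorem null_fract {α : Type*} [MeasureSpace α] [SFinite (volume : Measure α)]
    {N : Set (α × ℝ)} (hN : volume N = 0) :
    volume {p : α × ℝ | (p.1, Int.fract p.2) ∈ N} = 0 := by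
  have hsub : {p : α × ℝ | (p.1, Int.fract p.2) ∈ N} ⊆
      ⋃ n : ℤ, (Prod.map id (fun t : ℝ => t + (n : ℝ))) ⁻¹' N := by
    intro p hp
    refine mem_iUnion.2 ⟨-⌊p.2⌋, ?_⟩
    simp only [mem_preimage, Prod.map, id]
    have : p.2 + ((-⌊p.2⌋ : ℤ) : ℝ) = Int.fract p.2 := by
      rw [Int.fract]; push_cast; ring
    rw [this]; exact hp
  refine measure_mono_null hsub (measure_iUnion_null fun n => ?_)
  have mp : MeasurePreserving (Prod.map id (fun t : ℝ => t + (n : ℝ)))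
      (volume : Measure (α × ℝ)) volume :=
    (MeasurePreserving.id volume).prod (measurePreserving_add_right volume (n : ℝ))
  exact mp.quasiMeasurePreserving.preimage_null hN

theorem null_linear {E : Type*} [NormedAddCommGroup E] [NormedSpace ℝ E] [MeasureSpace E]
    [BorelSpace E] [FiniteDimensional ℝ E] [(volume : Measure E).IsAddHaarMeasure]
    (L : E →ₗ[ℝ] E) (hL : Function.Injective L) {N : Set E} (hN : volume N = 0) :
    volume (L ⁻¹' N) = 0 := by
  have hdet : LinearMap.det L ≠ 0 :=
    ((LinearMap.isUnit_iff_isUnit_det L).1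
      ((LinearMap.isUnit_iff_ker_eq_bot L).2 (LinearMap.ker_eq_bot.2 hL))).ne_zero
  exact (Measure.LinearMap.quasiMeasurePreserving volume L hdet).preimage_null hN

theorem null_shearPt (c : Cut) {N : Set (ℝ × ℝ × ℝ)} (hN : volume N = 0) :
    volume (shearPt c ⁻¹' N) = 0 := by
  let L : ℝ × ℝ × ℝ →ₗ[ℝ] ℝ × ℝ × ℝ :=
    { toFun := fun q => (q.2.1, c.θ₁ * q.2.2, c.θ₂ * q.2.2 + q.1)
      map_add' := by intro a b; ext <;> simp <;> ring
      map_smul' := by intro k a; ext <;> simp <;> ring }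
  have hL : Function.Injective L := by
    rintro ⟨a, b, d⟩ ⟨a', b', d'⟩ h
    simp only [L, LinearMap.coe_mk, AddHom.coe_mk, Prod.mk.injEq] at h
    obtain ⟨h1, h2, h3⟩ := h
    have h4 := mul_left_cancel₀ c.ne h2
    subst h4 h1
    simp only [Prod.mk.injEq, and_true]
    linarith
  have h1 : volume (MeasurableEquiv.prodAssoc (α := ℝ) (β := ℝ) (γ := ℝ) ⁻¹' N) = 0 :=
    (volume_preserving_prodAssoc (α₁ := ℝ) (β₁ := ℝ) (γ₁ := ℝ)
      ).quasiMeasurePreserving.preimage_null hN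
  have h2 := null_fract h1
  have h3 := (volume_preserving_prodAssoc (α₁ := ℝ) (β₁ := ℝ) (γ₁ := ℝ)
    ).symm.quasiMeasurePreserving.preimage_null h2
  have : (volume : Measure (ℝ × ℝ)).IsAddHaarMeasure :=
    inferInstanceAs ((volume : Measure ℝ).prod (volume : Measure ℝ)).IsAddHaarMeasure
  have : (volume : Measure (ℝ × ℝ × ℝ)).IsAddHaarMeasure :=
    inferInstanceAs ((volume : Measure ℝ).prod (volume : Measure (ℝ × ℝ))).IsAddHaarMeasure
  exact null_linear L hL h3

theorem null_shearPtSigma (c : Cut) {N : Set (ℝ × ℝ)} (hN : volume N = 0) :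
    volume (shearPtSigma c ⁻¹' N) = 0 := by
  let L : ℝ × ℝ →ₗ[ℝ] ℝ × ℝ :=
    { toFun := fun q => (c.θ₁ * q.2, c.θ₂ * q.2 + q.1)
      map_add' := by intro a b; ext <;> simp <;> ring
      map_smul' := by intro k a; ext <;> simp <;> ring }
  have hL : Function.Injective L := by
    rintro ⟨a, d⟩ ⟨a', d'⟩ h
    simp only [L, LinearMap.coe_mk, AddHom.coe_mk, Prod.mk.injEq] at h
    obtain ⟨h2, h3⟩ := h
    have h4 := mul_left_cancel₀ c.ne h2
    subst h4
    simp only [Prod.mk.injEq, and_true]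
    linarith
  exact null_linear L hL (null_fract hN)

/-- If preimages of null sets under `f` are null and `f` maps `A × B` into `O` up to a null set
of the target, then what holds a.e. on `O` holds, at `f (s, x)`, for a.e. `s ∈ A` and a.e.
`x ∈ B`. -/
theorem ae_slice {β γ : Type*} [MeasureSpace β] [SFinite (volume : Measure β)] [MeasureSpace γ]
    {A : Set ℝ} {B : Set β} {O Z : Set γ} {f : ℝ × β → γ} (hf : Measurable f)
    (hnull : ∀ N : Set γ, volume N = 0 → volume (f ⁻¹' N) = 0) (hZ : volume Z = 0)
    (hmap : ∀ s ∈ A, ∀ x ∈ B, f (s, x) ∈ O ∪ Z) {P : γ → Prop}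
    (h : ∀ᵐ p ∂volume.restrict O, P p) :
    ∀ᵐ s ∂volume.restrict A, ∀ᵐ x ∂volume.restrict B, P (f (s, x)) := by
  obtain ⟨N, hPN, hNm, hN⟩ := exists_measurable_superset_of_null (ae_iff.1 h)
  rw [Measure.restrict_apply hNm] at hN
  refine Measure.ae_ae_of_ae_prod (p := fun q : ℝ × β => P (f q)) ?_
  rw [Measure.prod_restrict]
  have hz : ∀ᵐ q ∂((volume : Measure ℝ).prod (volume : Measure β)).restrict (A ×ˢ B),
      q ∉ f ⁻¹' N := by
    rw [ae_iff]
    simp only [not_not, ofPred_mem_eq]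
    rw [Measure.restrict_apply (hf hNm)]
    refine measure_mono_null (t := f ⁻¹' (N ∩ O ∪ Z)) ?_
      (hnull _ (measure_union_null hN hZ))
    rintro ⟨s, x⟩ ⟨h1, h2, h3⟩
    rcases hmap s h2 x h3 with h | h
    · exact Or.inl ⟨h1, h⟩
    · exact Or.inr h
  filter_upwards [hz] with q hq
  by_contra hP
  exact hq (hPN hP)

theorem fract_mem (t : ℝ) : Int.fract t ∈ Ioo (0 : ℝ) 1 ∨ Int.fract t = 0 := by
  rcases (Int.fract_nonneg t).eq_or_lt with h | h
  · exact Or.inr h.symm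
  · exact Or.inl ⟨h, Int.fract_lt_one t⟩

/-- What holds a.e. on `Ω_per` holds a.e. on a.e. oblique slice. -/
theorem ae_shear (c : Cut) (Ix I₁ : Set ℝ) {P : ℝ × ℝ × ℝ → Prop}
    (h : ∀ᵐ p ∂volume.restrict (OmegaPer Ix I₁), P p) :
    ∀ᵐ s ∂unitMeas, ∀ᵐ x ∂volume.restrict (Q c Ix I₁), P (shearPt c (s, x)) := by
  have hZ : volume {p : ℝ × ℝ × ℝ | p.2.2 = 0} = 0 := by
    have h0 : volume {q : ℝ × ℝ | q.2 = 0} = 0 :=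
      Measure.quasiMeasurePreserving_snd.preimage_null
        (s := {(0 : ℝ)}) (by simp)
    exact Measure.quasiMeasurePreserving_snd.preimage_null h0
  refine ae_slice ?_ (fun N => null_shearPt c) hZ ?_ h
  · unfold shearPt; fun_prop
  · rintro s - ⟨x, z⟩ ⟨hx, hz⟩
    rcases fract_mem (c.θ₂ * z + s) with h | h
    · exact Or.inl ⟨hx, hz, h⟩
    · exact Or.inr h

/-- What holds a.e. on `Σ_per` holds a.e. on a.e. oblique line. -/
theorem ae_shearSigma (c : Cut) (I₁ : Set ℝ) {P : ℝ × ℝ → Prop}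
    (h : ∀ᵐ p ∂volume.restrict (SigmaPer I₁), P p) :
    ∀ᵐ s ∂unitMeas, ∀ᵐ z ∂volume.restrict (edge c I₁), P (shearPtSigma c (s, z)) := by
  have hZ : volume {q : ℝ × ℝ | q.2 = 0} = 0 :=
    Measure.quasiMeasurePreserving_snd.preimage_null (s := {(0 : ℝ)}) (by simp)
  refine ae_slice ?_ (fun N => null_shearPtSigma c) hZ ?_ h
  · unfold shearPtSigma; fun_prop
  · rintro s - z hz
    rcases fract_mem (c.θ₂ * z + s) with h | h
    · exact Or.inl ⟨hz, h⟩
    · exact Or.inr h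

/-- `H¹_{C,per}(Ω_per) = {V ∈ L²(Ω_per) : S_θ V ∈ L²(0, 1; H¹(Q_θ))}`. -/
def H1Cper (c : Cut) (Ix I₁ : Set ℝ) : Submodule ℂ (L2 (OmegaPer Ix I₁)) where
  carrier := {V | ∃ F, IsShear c Ix I₁ V F}
  zero_mem' := by
    refine ⟨0, ?_⟩
    filter_upwards [Lp.coeFn_zero (H1 (Q c Ix I₁)) 2 unitMeas,
      ae_shear c Ix I₁ (Lp.coeFn_zero ℂ 2 (volume.restrict (OmegaPer Ix I₁)))] with s h1 h2
    rw [h1]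
    filter_upwards [h2, Lp.coeFn_zero ℂ 2 (volume.restrict (Q c Ix I₁))] with x h3 h4
    exact h4.trans h3.symm
  add_mem' := by
    rintro V W ⟨F, hF⟩ ⟨G, hG⟩
    refine ⟨F + G, ?_⟩
    filter_upwards [Lp.coeFn_add F G, ae_shear c Ix I₁ (Lp.coeFn_add V W), hF, hG]
      with s h1 h2 h3 h4
    rw [h1]
    filter_upwards [h2, Lp.coeFn_add ((F s).1 0) ((G s).1 0), h3, h4] with x a b d e
    refine (b.trans ?_).trans a.symm
    simp only [Pi.add_apply]
    rw [d, e]; rfl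
  smul_mem' := by
    rintro k V ⟨F, hF⟩
    refine ⟨k • F, ?_⟩
    filter_upwards [Lp.coeFn_smul k F, ae_shear c Ix I₁ (Lp.coeFn_smul k V), hF]
      with s h1 h2 h3
    rw [h1]
    filter_upwards [h2, Lp.coeFn_smul k ((F s).1 0), h3] with x a b d
    refine (b.trans ?_).trans a.symm
    simp only [Pi.smul_apply]
    rw [d]; rfl

/-- `H^{1/2}_{C,per}(Σ_per) = {Φ ∈ L²(Σ_per) : S_θ Φ ∈ L²(0, 1; H^{1/2}(S_θ))}`. -/
def H12Cper (c : Cut) (I₁ : Set ℝ) : Submodule ℂ (L2 (SigmaPer I₁)) where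
  carrier := {Φ | ∃ F, IsShearSigma c I₁ Φ F}
  zero_mem' := by
    refine ⟨0, ?_⟩
    filter_upwards [Lp.coeFn_zero (H12 (edge c I₁)) 2 unitMeas,
      ae_shearSigma c I₁ (Lp.coeFn_zero ℂ 2 (volume.restrict (SigmaPer I₁)))] with s h1 h2
    rw [h1]
    filter_upwards [h2, Lp.coeFn_zero ℂ 2 (volume.restrict (edge c I₁))] with x h3 h4
    exact h4.trans h3.symm
  add_mem' := by
    rintro V W ⟨F, hF⟩ ⟨G, hG⟩
    refine ⟨F + G, ?_⟩
    filter_upwards [Lp.coeFn_add F G, ae_shearSigma c I₁ (Lp.coeFn_add V W), hF, hG]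
      with s h1 h2 h3 h4
    rw [h1]
    filter_upwards [h2, Lp.coeFn_add (F s).1.fst (G s).1.fst, h3, h4] with x a b d e
    refine (b.trans ?_).trans a.symm
    simp only [Pi.add_apply]
    rw [d, e]; rfl
  smul_mem' := by
    rintro k V ⟨F, hF⟩
    refine ⟨k • F, ?_⟩
    filter_upwards [Lp.coeFn_smul k F, ae_shearSigma c I₁ (Lp.coeFn_smul k V), hF]
      with s h1 h2 h3
    rw [h1]
    filter_upwards [h2, Lp.coeFn_smul k (F s).1.fst, h3] with x a b d
    refine (b.trans ?_).trans a.symm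
    simp only [Pi.smul_apply]
    rw [d]; rfl

/-- The values `‖V‖ = r` of the norm of `H¹_C(Ω_per)`, as a relation:
`r = (‖V‖² + ‖Cᵀ ∇ V‖²)^{1/2}`, which includes `Cᵀ ∇ V ∈ L²(Ω_per)²`. -/
def HasNormH1C (c : Cut) (Ix I₁ : Set ℝ) (V : L2 (OmegaPer Ix I₁)) (r : ℝ) : Prop :=
  ∃ U : H1C c (OmegaPer Ix I₁), U.1 0 = V ∧ ‖U‖ = r

/-- The norm of `H^{1/2}_{C,per}(Σ_per)`, as a relation:
`r = ‖S_θ Φ‖_{L²(0, 1; H^{1/2}(S_θ))}`. -/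
def HasNormH12C (c : Cut) (I₁ : Set ℝ) (Φ : L2 (SigmaPer I₁)) (r : ℝ) : Prop :=
  ∃ F, IsShearSigma c I₁ Φ F ∧ ‖F‖ = r

/-- The class `C^∞_{0,per}(closure Ω_per)`: on the closure of `Ω_per`, `v` is the restriction of a
function in `C^∞_c(ℝ³)`, and its periodic extension in `z₂` is smooth in `Ω`. -/
def IsSmoothPer (Ix I₁ : Set ℝ) (v : ℝ × ℝ × ℝ → ℂ) : Prop :=
  (∃ w : ℝ × ℝ × ℝ → ℂ, ContDiff ℝ ∞ w ∧ HasCompactSupport w ∧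
    EqOn v w (closure (OmegaPer Ix I₁))) ∧
  ContDiffOn ℝ ∞ (extPer v) (Omega Ix I₁)

/-- `T : H¹_{C,per}(Ω_per) → L²(Σ_per)` is a continuous linear extension of the restriction
`v ↦ v|_{x = 0}` of smooth functions. -/
def IsTracePer (c : Cut) (Ix I₁ : Set ℝ) (T : H1Cper c Ix I₁ →ₗ[ℂ] L2 (SigmaPer I₁)) : Prop :=
  (∃ K : ℝ, ∀ V : H1Cper c Ix I₁, ∃ r, HasNormH1C c Ix I₁ V r ∧ ‖T V‖ ≤ K * r) ∧
  ∀ v, IsSmoothPer Ix I₁ v → ∃ V : H1Cper c Ix I₁,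
    ((V : L2 (OmegaPer Ix I₁)) : ℝ × ℝ × ℝ → ℂ) =ᵐ[volume.restrict (OmegaPer Ix I₁)] v ∧
    (T V : ℝ × ℝ → ℂ) =ᵐ[volume.restrict (SigmaPer I₁)] fun p => v (0, p.1, p.2)

/-- The classical trace `u|_{x = 0} = g` of `u ∈ H¹(I_x × J)`: the pair `(u, g)` is a limit in
`H¹(I_x × J) × L²(J)` of pairs `(w, w(0, ·))` with `w ∈ C^∞_c(ℝ²)`. -/
def HasTrace {Ix J : Set ℝ} (u : H1 (Ix ×ˢ J)) (g : L2 J) : Prop :=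
  (u, g) ∈ closure {p : H1 (Ix ×ˢ J) × L2 J | ∃ w : ℝ × ℝ → ℂ,
    ContDiff ℝ ∞ w ∧ HasCompactSupport w ∧
    (p.1.1 0 : ℝ × ℝ → ℂ) =ᵐ[volume.restrict (Ix ×ˢ J)] w ∧
    (p.2 : ℝ → ℂ) =ᵐ[volume.restrict J] fun z => w (0, z)}

end AnisoTrace

open AnisoTrace

set_option linter.unusedSectionVars false

namespace AnisoTrace

/-! The shear straightens the anisotropy. The point map (s, x, z) ↦ (x, θ₁ z, fract (θ₂ z + s)) is
injective, carries Lebesgue measure on (0, 1) × Q_θ to |θ₁|⁻¹ times Lebesgue measure on Ω_per, and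
on each slice of fixed s it turns the derivatives along the columns of C into the two partial
derivatives on Q_θ. Hence, up to the constant |θ₁|^{-1/2} in the norm, H¹_{C,per} is the Bochner
space L²(0, 1; H¹(Q_θ)) (`exists_shearEquiv`, `IsShear.exists_H1C`), while H^{1/2}_{C,per} is L²(0,
1; H^{1/2}(S_θ)) (`exists_shearSigmaEquiv`). The map γ is the classical trace on Q_θ applied for
each s, conjugated by these two isomorphisms. Continuity and commutation with the shear are then
built in, and surjectivity follows by applying, for each s, a bounded linear right inverse of the
classical trace.

The classical trace on I_x × J, for intervals bounded or not, rests on three facts. Restrictions of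
C^∞_c functions are dense in H¹ of a convex open set (`denseRange_testToSobolev`): contract towards
an interior point, mollify, cut off at infinity. On smooth functions the H^{1/2} norm at x = 0 is
bounded by the H¹ norm (`exists_trace_inequality`): two boundary points at distance t are joined by
a path through height t, whose vertical sides are controlled by Hardy's inequality. The trace is
onto (`traceOp_surjective`): averages of g at scale √(x² + ε²) stay bounded in H¹ and have traces
tending to g as ε → 0, and bounded operators between Hilbert spaces map balls to closed sets.

That γ restricts smooth periodic functions correctly needs care, because their slices are only known
to be smooth inside Q_θ, not up to x = 0. They are however uniformly Lipschitz in x, with the right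
value at x = 0, and this determines the trace (`traceOp_eq_of_lipschitz`). Uniqueness holds because
the products a(s) w(x), with a ∈ C^∞_c(0, 1) and w ∈ C^∞_c(ℝ²), are shears of smooth periodic
functions and span a dense subspace of L²(0, 1; H¹(Q_θ)) (`eq_zero_of_eq_zero_on_products`). -/

instance isAddHaarMeasure_volume_prod_real :
    (volume : Measure (ℝ × ℝ)).IsAddHaarMeasure :=
  inferInstanceAs ((volume : Measure ℝ).prod (volume : Measure ℝ)).IsAddHaarMeasure

instance isAddHaarMeasure_volume_prod_prod_real :
    (volume : Measure (ℝ × ℝ × ℝ)).IsAddHaarMeasure :=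
  inferInstanceAs ((volume : Measure ℝ).prod (volume : Measure (ℝ × ℝ))).IsAddHaarMeasure

/-! ### Squared L² norms as lower integrals; Cauchy-Schwarz -/

section Lebesgue

variable {α E : Type*} [MeasurableSpace α] {μ : Measure α} [NormedAddCommGroup E]

theorem eLpNorm_two_sq (f : α → E) : eLpNorm f 2 μ ^ 2 = ∫⁻ x, ‖f x‖ₑ ^ 2 ∂μ := by
  rw [eLpNorm_eq_lintegral_rpow_enorm_toReal (by simp) (by simp), ← ENNReal.rpow_natCast,
    ← ENNReal.rpow_mul]
  simp

theorem enorm_Lp_sq (u : Lp E 2 μ) : ‖u‖ₑ ^ 2 = ∫⁻ x, ‖u x‖ₑ ^ 2 ∂μ := by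
  rw [Lp.enorm_def, eLpNorm_two_sq]

theorem memLp_two_of_lintegral {f : α → E} (hf : AEStronglyMeasurable f μ)
    (h : ∫⁻ x, ‖f x‖ₑ ^ 2 ∂μ < ⊤) : MemLp f 2 μ := by
  refine ⟨hf, ?_⟩
  rw [← eLpNorm_two_sq] at h
  by_contra hh
  rw [not_lt, top_le_iff] at hh
  simp [hh] at h

theorem lintegral_mul_sq_le {f g : α → ℝ≥0∞} (hf : AEMeasurable f μ) (hg : AEMeasurable g μ) :
    (∫⁻ x, f x * g x ∂μ) ^ 2 ≤ (∫⁻ x, f x ^ 2 ∂μ) * ∫⁻ x, g x ^ 2 ∂μ := by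
  have h := ENNReal.lintegral_mul_le_Lp_mul_Lq μ Real.HolderConjugate.two_two hf hg
  calc _ ≤ ((∫⁻ a, f a ^ (2 : ℝ) ∂μ) ^ (1 / 2 : ℝ) * (∫⁻ a, g a ^ (2 : ℝ) ∂μ) ^ (1 / 2 : ℝ)) ^ 2 := by
        gcongr; exact h
    _ = _ := by
        rw [mul_pow]
        simp only [← ENNReal.rpow_natCast, ← ENNReal.rpow_mul]
        norm_num

/-- Cauchy-Schwarz for an integral against a kernel. -/
theorem lintegral_kernel_sq_le {k f : α → ℝ≥0∞} (hk : AEMeasurable k μ) (hf : AEMeasurable f μ) :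
    (∫⁻ x, k x * f x ∂μ) ^ 2 ≤ (∫⁻ x, k x ∂μ) * ∫⁻ x, k x * f x ^ 2 ∂μ := by
  have hs : ∀ t : ℝ≥0∞, (t ^ (1 / 2 : ℝ)) ^ 2 = t := fun t => by
    rw [← ENNReal.rpow_natCast, ← ENNReal.rpow_mul]; norm_num
  -- The kernel is shared between the two factors, k f = k^{1/2} · (k^{1/2} f).
  have h := lintegral_mul_sq_le (μ := μ) (f := fun x => k x ^ (1 / 2 : ℝ))
    (g := fun x => k x ^ (1 / 2 : ℝ) * f x) (hk.pow_const _) ((hk.pow_const _).mul hf)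
  simp only [mul_pow, hs, ← mul_assoc] at h
  simpa only [← sq, hs] using h

theorem lintegral_sq_le {f : α → ℝ≥0∞} (hf : AEMeasurable f μ) :
    (∫⁻ x, f x ∂μ) ^ 2 ≤ μ univ * ∫⁻ x, f x ^ 2 ∂μ := by
  simpa using lintegral_kernel_sq_le (μ := μ) (k := fun _ => 1) aemeasurable_const hf

theorem add_sq_le_two (a b : ℝ≥0∞) : (a + b) ^ 2 ≤ 2 * a ^ 2 + 2 * b ^ 2 := by
  have := ENNReal.rpow_add_le_mul_rpow_add_rpow a b (p := 2) (by norm_num)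
  norm_num at this
  rw [← mul_add]; exact_mod_cast this

theorem enorm_add_sq_le (a b : E) : ‖a + b‖ₑ ^ 2 ≤ 2 * ‖a‖ₑ ^ 2 + 2 * ‖b‖ₑ ^ 2 :=
  (by gcongr; exact enorm_add_le a b : ‖a + b‖ₑ ^ 2 ≤ (‖a‖ₑ + ‖b‖ₑ) ^ 2).trans (add_sq_le_two _ _)

end Lebesgue

/-! ### Weak derivatives and completeness of the directional Sobolev spaces -/

section Weak

variable {E : Type*} [NormedAddCommGroup E] [NormedSpace ℝ E] [MeasureSpace E] [BorelSpace E]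
  [FiniteDimensional ℝ E] [(volume : Measure E).IsAddHaarMeasure]

theorem IsWeakDeriv.congr {O : Set E} {v : E} {u u' g g' : E → ℂ}
    (h : IsWeakDeriv O v u g) (hu : u =ᵐ[volume.restrict O] u')
    (hg : g =ᵐ[volume.restrict O] g') : IsWeakDeriv O v u' g' := by
  intro φ h1 h2 h3
  have e1 : ∫ x in O, (fderiv ℝ φ x v) • u' x = ∫ x in O, (fderiv ℝ φ x v) • u x :=
    integral_congr_ae (by filter_upwards [hu] with x hx; rw [hx])
  have e2 : ∫ x in O, φ x • g' x = ∫ x in O, φ x • g x :=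
    integral_congr_ae (by filter_upwards [hg] with x hx; rw [hx])
  rw [e1, e2, h φ h1 h2 h3]

/-- A continuously differentiable function has its classical derivatives as weak ones. -/
theorem isWeakDeriv_of_contDiffOn {O : Set E} (hO : IsOpen O) {h : E → ℂ}
    (hh : ContDiffOn ℝ 1 h O) (v : E) : IsWeakDeriv O v h (fun x => fderiv ℝ h x v) := by
  intro φ h1 h2 h3
  have hd : ContinuousOn (fun x => fderiv ℝ h x v) O :=
    (hh.continuousOn_fderiv_of_isOpen hO le_rfl).clm_apply continuousOn_const
  -- The factor k is continuous only on O, but the product is continuous everywhere because its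
  -- support lies in O. This permits integration by parts over the whole space.
  have key : ∀ (ψ : E → ℝ) (k : E → ℂ), Continuous ψ → tsupport ψ ⊆ tsupport φ →
      ContinuousOn k O → Integrable (fun x => ψ x • k x) := by
    intro ψ k hψ hs hk
    have hsub : tsupport (fun x => ψ x • k x) ⊆ tsupport ψ := tsupport_smul_subset_left ψ k
    refine Continuous.integrable_of_hasCompactSupport ?_
      (h2.isCompact.of_isClosed_subset (isClosed_tsupport _) (hsub.trans hs))
    exact (hψ.continuousOn.smul hk).continuous_of_tsupport_subset hO
      ((hsub.trans hs).trans h3)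
  have hs' : tsupport (fun x => fderiv ℝ φ x v) ⊆ tsupport φ := by
    refine (closure_minimal ?_ (isClosed_tsupport _))
    intro x hx
    by_contra hn
    exact hx (by simp [fderiv_of_notMem_tsupport (𝕜 := ℝ) hn])
  have sub : ∀ (ψ : E → ℝ) (k : E → ℂ), tsupport ψ ⊆ tsupport φ →
      ∫ x in O, ψ x • k x = ∫ x, ψ x • k x := by
    intro ψ k hs
    refine setIntegral_eq_integral_of_forall_compl_eq_zero fun x hx => ?_
    have : ψ x = 0 := by
      by_contra hn
      exact hx (h3 (hs (subset_tsupport _ hn)))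
    simp [this]
  have ib := integral_bilinear_hasLineDerivAt_right_eq_neg_left_of_integrable
    (μ := (volume : Measure E)) (f := φ) (f' := fun x => fderiv ℝ φ x v) (g := h)
    (g' := fun x => fderiv ℝ h x v) (v := v) (B := ContinuousLinearMap.lsmul ℝ ℝ)
    (key _ _ (continuous_dir h1 v) hs' hh.continuousOn)
    (key _ _ h1.continuous subset_rfl hd)
    (key _ _ h1.continuous subset_rfl hh.continuousOn)
    (fun x _ => ((h1.differentiable (by simp)) x).hasFDerivAt.hasLineDerivAt v)
    (fun x hx => (((hh x (h3 hx)).contDiffAt (hO.mem_nhds (h3 hx))).differentiableAt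
      (by simp)).hasFDerivAt.hasLineDerivAt v)
  simp only [ContinuousLinearMap.lsmul_apply] at ib
  rw [sub _ _ hs', sub _ _ subset_rfl, ib, neg_neg]

/-- The fundamental lemma of the calculus of variations, applied to the difference of the two
derivatives. -/
theorem isWeakDeriv_unique {O : Set E} (hO : IsOpen O) {v : E} {u : E → ℂ} {g g' : L2 O}
    (h : IsWeakDeriv O v u g) (h' : IsWeakDeriv O v u g') : g = g' := by
  have hae : ∀ᵐ x ∂(volume.restrict O), x ∈ O → (g - g' : L2 O) x = 0 := by
    refine hO.ae_eq_zero_of_integral_contDiff_smul_eq_zero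
      (((Lp.memLp (g - g')).locallyIntegrable (by norm_num)).locallyIntegrableOn O) ?_
    intro φ h1 h2 h3
    have e : ∫ x in O, φ x • (g - g' : L2 O) x
        = (∫ x in O, φ x • g x) - ∫ x in O, φ x • g' x := by
      rw [← integral_sub (integrable_smul_L2 h1.continuous h2 g)
        (integrable_smul_L2 h1.continuous h2 g')]
      refine integral_congr_ae ?_
      filter_upwards [Lp.coeFn_sub g g'] with x hx
      rw [hx, Pi.sub_apply, smul_sub]
    rw [e, ← neg_inj.1 ((h φ h1 h2 h3).symm.trans (h' φ h1 h2 h3)), sub_self]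
  rw [← sub_eq_zero]
  refine Lp.ext ?_
  filter_upwards [hae, ae_restrict_mem hO.measurableSet, Lp.coeFn_zero ℂ 2 (volume.restrict O)]
    with x h1 h2 h3
  rw [h1 h2, h3]; rfl

/-- The derivative components are determined by the function. Thus linearity and uniqueness of maps
into the Sobolev space need only be checked on the component 0. -/
theorem dirSobolev_ext {O : Set E} (hO : IsOpen O) {v : Fin 2 → E} {U W : dirSobolev O v}
    (h : U.1 0 = W.1 0) : U = W := by
  refine Subtype.ext (PiLp.ext fun i => ?_)
  refine Fin.cases h (fun j => ?_) i
  have h1 := U.2 j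
  rw [h] at h1
  exact isWeakDeriv_unique hO h1 (W.2 j)

theorem enorm_dirSobolev_sq {O : Set E} {v : Fin 2 → E} (U : dirSobolev O v) :
    ‖U‖ₑ ^ 2 = (∫⁻ x in O, ‖U.1 0 x‖ₑ ^ 2) + (∫⁻ x in O, ‖U.1 1 x‖ₑ ^ 2)
      + ∫⁻ x in O, ‖U.1 2 x‖ₑ ^ 2 := by
  have h : ‖U‖ ^ 2 = ‖U.1 0‖ ^ 2 + ‖U.1 1‖ ^ 2 + ‖U.1 2‖ ^ 2 := by
    rw [Submodule.coe_norm, PiLp.norm_sq_eq_of_L2, Fin.sum_univ_three]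
  simp only [← enorm_Lp_sq]
  simp only [← ofReal_norm, ← ENNReal.ofReal_pow (norm_nonneg _)]
  rw [← ENNReal.ofReal_add (by positivity) (by positivity),
    ← ENNReal.ofReal_add (by positivity) (by positivity), h]

/-- The integral is the inner product with the L² class of the real function ψ. -/
theorem continuous_integral_smul {O : Set E} {ψ : E → ℝ} (hψ : Continuous ψ)
    (hs : HasCompactSupport ψ) : Continuous fun u : L2 O => ∫ x in O, ψ x • u x := by
  have hm : MemLp (fun x => (ψ x : ℂ)) 2 (volume.restrict O) :=
    ((Complex.continuous_ofReal.comp hψ).memLp_of_hasCompactSupport (μ := volume)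
      (hs.comp_left (g := fun t : ℝ => (t : ℂ)) rfl)).restrict O
  have e : (fun u : L2 O => ∫ x in O, ψ x • u x) = fun u => inner ℂ (hm.toLp _) u := by
    ext u
    rw [L2.inner_def]
    refine integral_congr_ae ?_
    filter_upwards [hm.coeFn_toLp] with x hx
    rw [hx]
    simp [mul_comm]
  rw [e]
  fun_prop

/-- Each test function imposes an equality between two continuous functionals, so the space is
closed in a product of L² spaces. Completeness is needed for the Hilbert space arguments behind
surjectivity. -/
instance completeSpace_dirSobolev (O : Set E) (v : Fin 2 → E) :
    CompleteSpace (dirSobolev O v) := by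
  have hc : IsClosed (dirSobolev O v : Set (PiLp 2 (fun _ : Fin 3 => L2 O))) := by
    have : (dirSobolev O v : Set (PiLp 2 (fun _ : Fin 3 => L2 O))) =
        ⋂ (i : Fin 2) (φ : E → ℝ) (_ : ContDiff ℝ ∞ φ) (_ : HasCompactSupport φ)
          (_ : tsupport φ ⊆ O), {U | ∫ x in O, (fderiv ℝ φ x (v i)) • (U 0) x
            = - ∫ x in O, φ x • (U i.succ) x} := by
      ext U
      simp only [mem_iInter]
      rfl
    rw [this]
    refine isClosed_iInter fun i => isClosed_iInter fun φ => isClosed_iInter fun h1 =>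
      isClosed_iInter fun h2 => isClosed_iInter fun h3 => isClosed_eq ?_ ?_
    · exact (continuous_integral_smul (continuous_dir h1 _) (compact_dir h2 _)).comp
        (PiLp.continuous_apply 2 _ 0)
    · exact ((continuous_integral_smul h1.continuous h2).comp
        (PiLp.continuous_apply 2 _ i.succ)).neg
  exact hc.completeSpace_coe

/-- The element `(u, g 0, g 1)` of `dirSobolev O v`. -/
noncomputable def mkSobolev {O : Set E} {v : Fin 2 → E} (u : E → ℂ) (g : Fin 2 → E → ℂ)
    (hu : MemLp u 2 (volume.restrict O)) (hg : ∀ i, MemLp (g i) 2 (volume.restrict O))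
    (h : ∀ i, IsWeakDeriv O (v i) u (g i)) : dirSobolev O v :=
  ⟨WithLp.toLp 2 (Fin.cons (hu.toLp u) fun i => (hg i).toLp (g i)), fun i =>
    (h i).congr hu.coeFn_toLp.symm (hg i).coeFn_toLp.symm⟩

end Weak

/-! ### The space H^{1/2}(J): extensionality, norm, completeness -/

theorem H12_ext {J : Set ℝ} {U W : H12 J} (h : U.1.fst = W.1.fst) : U = W := by
  refine Subtype.ext (WithLp.ofLp_injective 2 (Prod.ext h (Lp.ext ?_)))
  have h1 := U.2
  have h2 := W.2
  change U.1.snd =ᵐ[_] _ at h1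
  change W.1.snd =ᵐ[_] _ at h2
  rw [h] at h1
  exact h1.trans h2.symm

theorem enorm_H12_sq {J : Set ℝ} (U : H12 J) :
    ‖U‖ₑ ^ 2 = (∫⁻ x in J, ‖U.1.fst x‖ₑ ^ 2) + ∫⁻ p in J ×ˢ J, ‖U.1.snd p‖ₑ ^ 2 := by
  have h : ‖U‖ ^ 2 = ‖U.1.fst‖ ^ 2 + ‖U.1.snd‖ ^ 2 := by
    rw [Submodule.coe_norm, WithLp.prod_norm_sq_eq_of_L2]
  simp only [← enorm_Lp_sq]
  simp only [← ofReal_norm, ← ENNReal.ofReal_pow (norm_nonneg _)]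
  rw [← ENNReal.ofReal_add (by positivity) (by positivity), h]

theorem restrict_prod_self (J : Set ℝ) : (volume.restrict (J ×ˢ J) : Measure (ℝ × ℝ))
    = (volume.restrict J).prod (volume.restrict J) := by
  rw [Measure.prod_restrict]; rfl

/-- The relation between the two components is pointwise, so it is passed to the limit along a
subsequence on which both components converge almost everywhere. -/
instance completeSpace_H12 (J : Set ℝ) : CompleteSpace (H12 J) := by
  have hc : IsClosed (H12 J : Set (WithLp 2 (L2 J × L2 (J ×ˢ J)))) := by
    refine IsSeqClosed.isClosed fun U W hU hW => ?_
    have hf : Tendsto (fun n => (U n).fst) atTop (𝓝 W.fst) :=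
      ((WithLp.prod_continuous_ofLp 2 _ _).fst.tendsto W).comp hW
    have hs : Tendsto (fun n => (U n).snd) atTop (𝓝 W.snd) :=
      ((WithLp.prod_continuous_ofLp 2 _ _).snd.tendsto W).comp hW
    obtain ⟨a, ha, h1⟩ := (tendstoInMeasure_of_tendsto_Lp hf).exists_seq_tendsto_ae
    obtain ⟨b, hb, h2⟩ := (tendstoInMeasure_of_tendsto_Lp
      (hs.comp ha.tendsto_atTop)).exists_seq_tendsto_ae
    have q1 : ∀ᵐ p ∂(volume.restrict (J ×ˢ J) : Measure (ℝ × ℝ)),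
        Tendsto (fun i => (U (a i)).fst p.1) atTop (𝓝 (W.fst p.1)) := by
      rw [restrict_prod_self]
      exact Measure.quasiMeasurePreserving_fst.ae h1
    have q2 : ∀ᵐ p ∂(volume.restrict (J ×ˢ J) : Measure (ℝ × ℝ)),
        Tendsto (fun i => (U (a i)).fst p.2) atTop (𝓝 (W.fst p.2)) := by
      rw [restrict_prod_self]
      exact Measure.quasiMeasurePreserving_snd.ae h1
    have q3 : ∀ᵐ p ∂(volume.restrict (J ×ˢ J) : Measure (ℝ × ℝ)), ∀ n,
        (U n).snd p = ((U n).fst p.1 - (U n).fst p.2) / ((p.1 - p.2 : ℝ) : ℂ) :=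
      ae_all_iff.2 fun n => hU n
    change W.snd =ᵐ[_] _
    filter_upwards [q1, q2, q3, h2] with p e1 e2 e3 e4
    refine tendsto_nhds_unique e4 ?_
    simp only [Function.comp_apply, e3]
    exact ((e1.comp hb.tendsto_atTop).sub (e2.comp hb.tendsto_atTop)).div_const _
  exact hc.completeSpace_coe

end AnisoTrace

namespace AnisoTrace

/-! ### Mollification after a contraction, and its L² convergence -/

section Density

open scoped Convolution

variable {E : Type*} [NormedAddCommGroup E] [NormedSpace ℝ E] [MeasureSpace E] [BorelSpace E]
  [FiniteDimensional ℝ E] [(volume : Measure E).IsAddHaarMeasure]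

/-- The contraction of ratio `1 - t` towards `q₀`. -/
def contraction (q₀ : E) (t : ℝ) (q : E) : E := q₀ + (1 - t) • (q - q₀)

/-- The change of variables has Jacobian (1 - t)^{-d}, at most 2^d when t ≤ 1/2. The bound does not
depend on t, which is what the density argument for L² needs. -/
theorem lintegral_contraction_sub (q₀ : E) {t : ℝ} (ht' : t ≤ 1 / 2) (s : E)
    {f : E → ℝ≥0∞} (hf : Measurable f) :
    ∫⁻ q, f (contraction q₀ t q - s) ≤
      ENNReal.ofReal (2 ^ Module.finrank ℝ E) * ∫⁻ q, f q := by
  have h1 : (1 - t) ≠ 0 := by linarith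
  have e : ∀ q, contraction q₀ t q - s = (1 - t) • q + (t • q₀ - s) := by
    intro q; unfold contraction; module
  have h2 : ∫⁻ q, f (contraction q₀ t q - s)
      = ∫⁻ q, f (q + (t • q₀ - s)) ∂(Measure.map (fun x => (1 - t) • x) volume) := by
    rw [lintegral_map (f := fun q => f (q + (t • q₀ - s))) (hf.comp (measurable_add_const _))
      (measurable_const_smul _)]
    simp only [e]
  rw [h2, Measure.map_addHaar_smul _ h1, lintegral_smul_measure, smul_eq_mul,
    lintegral_add_right_eq_self]
  refine mul_le_mul_left ?_ _
  refine ENNReal.ofReal_le_ofReal ?_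
  rw [abs_of_nonneg (by have : 0 ≤ 1 - t := by linarith
                        positivity), ← inv_pow]
  refine pow_le_pow_left₀ (inv_nonneg.2 (by linarith)) ?_ _
  rw [inv_le_comm₀ (by linarith) (by norm_num)]
  linarith

/-- The mollification of `f`, contracted towards `q₀`. -/
noncomputable def mollify (q₀ : E) (t : ℝ) (φ : ContDiffBump (0 : E)) (f : E → ℂ) (q : E) : ℂ :=
  (φ.normed volume ⋆[ContinuousLinearMap.lsmul ℝ ℝ, volume] f) (contraction q₀ t q)

theorem lintegral_normed (φ : ContDiffBump (0 : E)) :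
    ∫⁻ x, ‖φ.normed volume x‖ₑ = 1 := by
  have h := ofReal_integral_eq_lintegral_ofReal (φ.integrable_normed (μ := volume))
    (Eventually.of_forall fun x => φ.nonneg_normed x)
  rw [φ.integral_normed] at h
  simp only [Real.enorm_eq_ofReal (φ.nonneg_normed _)]
  rw [← h]; simp

/-- Cauchy-Schwarz for the probability density given by the normed bump. -/
theorem enorm_mollify_sq_le (q₀ : E) (t : ℝ) (φ : ContDiffBump (0 : E)) {f : E → ℂ}
    (hf : Measurable f) (q : E) :
    ‖mollify q₀ t φ f q‖ₑ ^ 2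
      ≤ ∫⁻ s, ‖φ.normed volume s‖ₑ * ‖f (contraction q₀ t q - s)‖ₑ ^ 2 := by
  have hm : AEMeasurable (fun s => ‖f (contraction q₀ t q - s)‖ₑ) :=
    (hf.comp (measurable_const_sub _)).enorm.aemeasurable
  have hk : AEMeasurable (fun s => ‖φ.normed volume s‖ₑ) :=
    φ.continuous_normed.measurable.enorm.aemeasurable
  calc _ ≤ (∫⁻ s, ‖φ.normed volume s‖ₑ * ‖f (contraction q₀ t q - s)‖ₑ) ^ 2 := by
        gcongr
        refine (enorm_integral_le_lintegral_enorm _).trans_eq ?_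
        simp only [ContinuousLinearMap.lsmul_apply, enorm_smul]
    _ ≤ _ := by
        refine (lintegral_kernel_sq_le hk hm).trans_eq ?_
        rw [lintegral_normed, one_mul]

theorem continuous_contraction (q₀ : E) (t : ℝ) : Continuous (contraction q₀ t) := by
  unfold contraction; fun_prop

theorem lintegral_mollify_sq_le (q₀ : E) {t : ℝ} (ht' : t ≤ 1 / 2)
    (φ : ContDiffBump (0 : E)) {f : E → ℂ} (hf : Measurable f) :
    ∫⁻ q, ‖mollify q₀ t φ f q‖ₑ ^ 2
      ≤ ENNReal.ofReal (2 ^ Module.finrank ℝ E) * ∫⁻ q, ‖f q‖ₑ ^ 2 := by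
  calc _ ≤ ∫⁻ q, ∫⁻ s, ‖φ.normed volume s‖ₑ * ‖f (contraction q₀ t q - s)‖ₑ ^ 2 :=
        lintegral_mono fun q => enorm_mollify_sq_le q₀ t φ hf q
    _ = ∫⁻ s, ∫⁻ q, ‖φ.normed volume s‖ₑ * ‖f (contraction q₀ t q - s)‖ₑ ^ 2 := by
        refine lintegral_lintegral_swap ?_
        have h1 : Measurable fun p : E × E => contraction q₀ t p.1 - p.2 :=
          (((continuous_contraction q₀ t).comp continuous_fst).sub continuous_snd).measurable
        exact ((φ.continuous_normed.measurable.comp measurable_snd).enorm.mul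
          ((hf.comp h1).enorm.pow_const 2)).aemeasurable
    _ ≤ ∫⁻ s, ‖φ.normed volume s‖ₑ *
          (ENNReal.ofReal (2 ^ Module.finrank ℝ E) * ∫⁻ q, ‖f q‖ₑ ^ 2) := by
        refine lintegral_mono fun s => ?_
        rw [lintegral_const_mul' _ _ enorm_ne_top]
        exact mul_le_mul_right (lintegral_contraction_sub q₀ ht' s (hf.enorm.pow_const 2)) _
    _ = _ := by
        rw [lintegral_mul_const _ φ.continuous_normed.measurable.enorm, lintegral_normed, one_mul]

theorem tendsto_mollify_of_continuous (q₀ : E) {t : ℕ → ℝ} {φ : ℕ → ContDiffBump (0 : E)}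
    (ht : Tendsto t atTop (𝓝 0)) (ht0 : ∀ n, 0 ≤ t n) (ht1 : ∀ n, t n ≤ 1 / 2)
    (hφ : Tendsto (fun n => (φ n).rOut) atTop (𝓝 0)) (hφ1 : ∀ n, (φ n).rOut ≤ 1)
    {g : E → ℂ} (hg : Continuous g) (hgs : HasCompactSupport g) :
    Tendsto (fun n => ∫⁻ q, ‖mollify q₀ (t n) (φ n) g q - g q‖ₑ ^ 2) atTop (𝓝 0) := by
  obtain ⟨B, hB⟩ := hgs.exists_bound_of_continuous hg
  obtain ⟨R, hR⟩ := hgs.isCompact.isBounded.subset_closedBall 0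
  have hB0 : 0 ≤ B := (norm_nonneg _).trans (hB 0)
  have hgz : ∀ x, R < ‖x‖ → g x = 0 := by
    intro x hx
    by_contra hn
    have := hR (subset_tsupport _ hn)
    rw [mem_closedBall_zero_iff] at this
    linarith
  -- For ‖q‖ > 2R' the contracted point has norm at least ‖q‖/2 - ‖q₀‖ > max R 0 + 1, so a mollifier
  -- of radius at most 1 does not reach the support of g. All the differences therefore vanish
  -- outside one ball, which provides the dominating function.
  set R' : ℝ := max R 0 + ‖q₀‖ + 1
  have hz : ∀ n q, 2 * R' < ‖q‖ → mollify q₀ (t n) (φ n) g q - g q = 0 := by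
    intro n q hq
    have h0 : g q = 0 := hgz q (by have := le_max_left R 0; have := le_max_right R 0
                                   have := norm_nonneg q₀; simp only [R'] at hq; linarith)
    have hc : max R 0 + 1 < ‖contraction q₀ (t n) q‖ := by
      have e : contraction q₀ (t n) q = (1 - t n) • q + t n • q₀ := by
        unfold contraction; module
      have h1 : ‖(1 - t n) • q‖ - ‖t n • q₀‖ ≤ ‖contraction q₀ (t n) q‖ := by
        rw [e]
        have := norm_sub_le ((1 - t n) • q + t n • q₀) (t n • q₀)
        rw [add_sub_cancel_right] at this
        linarith
      rw [norm_smul, norm_smul, Real.norm_of_nonneg (ht0 n),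
        Real.norm_of_nonneg (by linarith [ht1 n])] at h1
      have h2 : (1 / 2) * ‖q‖ ≤ (1 - t n) * ‖q‖ := by
        gcongr; linarith [ht1 n]
      have h3 : t n * ‖q₀‖ ≤ 1 * ‖q₀‖ := by
        gcongr; linarith [ht1 n]
      simp only [R'] at hq
      linarith
    have h2 : dist (mollify q₀ (t n) (φ n) g q) (g (contraction q₀ (t n) q)) ≤ 0 := by
      refine ContDiffBump.dist_normed_convolution_le hg.aestronglyMeasurable fun x hx => ?_
      rw [hgz, hgz, dist_self]
      · have := le_max_left R 0; linarith
      · rw [mem_ball_iff_norm] at hx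
        have h4 := norm_sub_norm_le (contraction q₀ (t n) q) x
        rw [norm_sub_rev] at h4
        have := le_max_left R 0
        have := hφ1 n
        linarith
    rw [h0, sub_zero]
    have h3 := dist_le_zero.1 h2
    rw [h3]
    exact hgz _ (by have := le_max_left R 0; linarith)
  have hb : ∀ n q, ‖mollify q₀ (t n) (φ n) g q‖ ≤ 3 * B := by
    intro n q
    have h2 : dist (mollify q₀ (t n) (φ n) g q) (g (contraction q₀ (t n) q)) ≤ 2 * B := by
      refine ContDiffBump.dist_normed_convolution_le hg.aestronglyMeasurable fun x hx => ?_
      rw [dist_eq_norm]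
      refine (norm_sub_le _ _).trans ?_
      linarith [hB x, hB (contraction q₀ (t n) q)]
    rw [dist_eq_norm] at h2
    have h3 := norm_sub_norm_le (mollify q₀ (t n) (φ n) g q) (g (contraction q₀ (t n) q))
    linarith [hB (contraction q₀ (t n) q)]
  have hcont : ∀ n, Continuous (mollify q₀ (t n) (φ n) g) := fun n =>
    ((φ n).hasCompactSupport_normed.continuous_convolution_left _ (φ n).continuous_normed
      hg.locallyIntegrable).comp (continuous_contraction q₀ _)
  have hlim := tendsto_lintegral_of_dominated_convergence (μ := (volume : Measure E))
    (F := fun n q => ‖mollify q₀ (t n) (φ n) g q - g q‖ₑ ^ 2) (f := fun _ => 0)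
    ((Metric.closedBall (0 : E) (2 * R')).indicator fun _ => ENNReal.ofReal (4 * B) ^ 2)
    (fun n => (((hcont n).sub hg).measurable.enorm.pow_const 2)) ?_ ?_ ?_
  · simpa using hlim
  · intro n
    refine Eventually.of_forall fun q => ?_
    by_cases hq : q ∈ Metric.closedBall (0 : E) (2 * R')
    · rw [indicator_of_mem hq]
      refine pow_le_pow_left' ?_ 2
      rw [← ofReal_norm]
      refine ENNReal.ofReal_le_ofReal ((norm_sub_le _ _).trans ?_)
      linarith [hb n q, hB q]
    · rw [indicator_of_notMem hq]
      rw [mem_closedBall_zero_iff, not_le] at hq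
      change ‖mollify q₀ (t n) (φ n) g q - g q‖ₑ ^ 2 ≤ 0
      rw [hz n q hq]; simp
  · rw [lintegral_indicator Metric.isClosed_closedBall.measurableSet, setLIntegral_const]
    exact ENNReal.mul_ne_top (by finiteness) measure_closedBall_lt_top.ne
  · refine Eventually.of_forall fun q => ?_
    have h1 : Tendsto (fun n => mollify q₀ (t n) (φ n) g q) atTop (𝓝 (g q)) := by
      refine ContDiffBump.convolution_tendsto_right (g := fun _ => g) hφ
        (Eventually.of_forall fun _ => hg.aestronglyMeasurable)
        ((hg.tendsto q).comp tendsto_snd) ?_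
      have : Tendsto (fun n => q₀ + (1 - t n) • (q - q₀)) atTop
          (𝓝 (q₀ + (1 - 0 : ℝ) • (q - q₀))) :=
        tendsto_const_nhds.add ((tendsto_const_nhds.sub ht).smul_const _)
      simpa [contraction] using this
    have h2 : Tendsto (fun n => ‖mollify q₀ (t n) (φ n) g q - g q‖ₑ ^ 2) atTop
        (𝓝 (‖g q - g q‖ₑ ^ 2)) :=
      ((ENNReal.continuous_pow 2).tendsto _).comp
        ((continuous_enorm.tendsto _).comp (h1.sub_const _))
    simpa using h2

theorem measurable_mollify (q₀ : E) (t : ℝ) (φ : ContDiffBump (0 : E)) {f : E → ℂ}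
    (hf : LocallyIntegrable f) : Measurable (mollify q₀ t φ f) :=
  ((φ.hasCompactSupport_normed.continuous_convolution_left _ φ.continuous_normed hf).comp
    (continuous_contraction q₀ _)).measurable

theorem tendsto_mollify (q₀ : E) {t : ℕ → ℝ} {φ : ℕ → ContDiffBump (0 : E)}
    (ht : Tendsto t atTop (𝓝 0)) (ht0 : ∀ n, 0 ≤ t n) (ht1 : ∀ n, t n ≤ 1 / 2)
    (hφ : Tendsto (fun n => (φ n).rOut) atTop (𝓝 0)) (hφ1 : ∀ n, (φ n).rOut ≤ 1)
    {f : E → ℂ} (hf : Measurable f) (hf2 : MemLp f 2) :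
    Tendsto (fun n => ∫⁻ q, ‖mollify q₀ (t n) (φ n) f q - f q‖ₑ ^ 2) atTop (𝓝 0) := by
  set C : ℝ≥0∞ := ENNReal.ofReal (2 ^ Module.finrank ℝ E) with hC
  have hfl : LocallyIntegrable f := hf2.locallyIntegrable (by norm_num)
  rw [ENNReal.tendsto_nhds_zero]
  intro ε hε
  by_cases htop : ε = ⊤
  · exact Eventually.of_forall fun _ => by rw [htop]; exact le_top
  have hC4 : 4 * C + 4 ≠ ⊤ := by finiteness
  -- With g continuous and within δ of f, the term 4 C δ² pays for the mollification of f - g and 4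
  -- δ² for f - g itself; the mollification error of g takes the other half of ε.
  obtain ⟨δ, hδ, hδε⟩ : ∃ δ : ℝ≥0∞, δ ≠ 0 ∧ (4 * C + 4) * δ ^ 2 ≤ ε / 2 := by
    obtain ⟨a, ha, hae⟩ := ENNReal.exists_nnreal_pos_mul_lt hC4 (ENNReal.half_pos hε.ne').ne'
    refine ⟨min a 1, by simpa using ha.ne', ?_⟩
    have : (min (a : ℝ≥0∞) 1) ^ 2 ≤ a := by
      rw [sq]
      calc _ ≤ (a : ℝ≥0∞) * 1 := mul_le_mul' (min_le_left _ _) (min_le_right _ _)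
        _ = a := mul_one _
    calc _ ≤ (4 * C + 4) * (a : ℝ≥0∞) := mul_le_mul_right this _
      _ = a * (4 * C + 4) := mul_comm _ _
      _ ≤ ε / 2 := hae.le
  obtain ⟨g, hgs, hgf, hgc, hg2⟩ := hf2.exists_hasCompactSupport_eLpNorm_sub_le (by simp) hδ
  have hd : ∫⁻ q, ‖f q - g q‖ₑ ^ 2 ≤ δ ^ 2 := by
    have := eLpNorm_two_sq (μ := (volume : Measure E)) (f - g)
    simp only [Pi.sub_apply] at this
    rw [← this]
    exact pow_le_pow_left' hgf 2
  have hlim := tendsto_mollify_of_continuous q₀ ht ht0 ht1 hφ hφ1 hgc hgs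
  have hlim4 : Tendsto (fun n => 4 * ∫⁻ q, ‖mollify q₀ (t n) (φ n) g q - g q‖ₑ ^ 2) atTop (𝓝 0) := by
    simpa using ENNReal.Tendsto.const_mul hlim (Or.inr (by finiteness : (4 : ℝ≥0∞) ≠ ⊤))
  filter_upwards [(ENNReal.tendsto_nhds_zero.1 hlim4) (ε / 2) (ENNReal.half_pos hε.ne')] with n hn
  have hgl := hgc.locallyIntegrable (μ := (volume : Measure E))
  have hsub : ∀ q, mollify q₀ (t n) (φ n) f q - mollify q₀ (t n) (φ n) g q
      = mollify q₀ (t n) (φ n) (fun x => f x - g x) q := by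
    intro q
    have h1 := (φ n).hasCompactSupport_normed.convolutionExists_left
      (ContinuousLinearMap.lsmul ℝ ℝ) ((φ n).continuous_normed (μ := volume)) hfl
      (contraction q₀ (t n) q)
    have h2 := (φ n).hasCompactSupport_normed.convolutionExists_left
      (ContinuousLinearMap.lsmul ℝ ℝ) ((φ n).continuous_normed (μ := volume)) hgl
      (contraction q₀ (t n) q)
    unfold mollify convolution
    rw [← integral_sub h1 h2]
    simp only [ContinuousLinearMap.lsmul_apply, smul_sub]
  have hfg : Measurable fun x => f x - g x := hf.sub hgc.measurable
  have mg := measurable_mollify q₀ (t n) (φ n) hgl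
  have mfg := measurable_mollify q₀ (t n) (φ n) (hfl.sub hgl)
  calc ∫⁻ q, ‖mollify q₀ (t n) (φ n) f q - f q‖ₑ ^ 2
      ≤ ∫⁻ q, (4 * ‖mollify q₀ (t n) (φ n) (fun x => f x - g x) q‖ₑ ^ 2
          + 4 * ‖f q - g q‖ₑ ^ 2) + 4 * ‖mollify q₀ (t n) (φ n) g q - g q‖ₑ ^ 2 := by
        refine lintegral_mono fun q => ?_
        have e : mollify q₀ (t n) (φ n) f q - f q
            = (mollify q₀ (t n) (φ n) (fun x => f x - g x) q + (-(f q - g q)))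
              + (mollify q₀ (t n) (φ n) g q - g q) := by
          rw [← hsub q]; ring
        rw [e]
        refine (enorm_add_sq_le _ _).trans ?_
        refine add_le_add ?_ (by gcongr; norm_num)
        refine (mul_le_mul_right (enorm_add_sq_le _ _) 2).trans ?_
        rw [enorm_neg, mul_add, ← mul_assoc, ← mul_assoc]
        norm_num
    _ = 4 * (∫⁻ q, ‖mollify q₀ (t n) (φ n) (fun x => f x - g x) q‖ₑ ^ 2)
          + 4 * (∫⁻ q, ‖f q - g q‖ₑ ^ 2)
          + 4 * ∫⁻ q, ‖mollify q₀ (t n) (φ n) g q - g q‖ₑ ^ 2 := by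
        have hm1 : Measurable fun q => ‖mollify q₀ (t n) (φ n) (fun x => f x - g x) q‖ₑ ^ 2 :=
          mfg.enorm.pow_const 2
        have hm2 : Measurable fun q => ‖f q - g q‖ₑ ^ 2 := hfg.enorm.pow_const 2
        have hm3 : Measurable fun q => ‖mollify q₀ (t n) (φ n) g q - g q‖ₑ ^ 2 :=
          (mg.sub hgc.measurable).enorm.pow_const 2
        rw [lintegral_add_right _ (hm3.const_mul _), lintegral_add_right _ (hm2.const_mul _),
          lintegral_const_mul _ hm1, lintegral_const_mul _ hm2, lintegral_const_mul _ hm3]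
    _ ≤ 4 * (C * δ ^ 2) + 4 * δ ^ 2 + ε / 2 := by
        refine add_le_add (add_le_add ?_ (mul_le_mul_right hd _)) hn
        exact mul_le_mul_right ((lintegral_mollify_sq_le q₀ (ht1 n) (φ n) hfg).trans
          (mul_le_mul_right hd _)) _
    _ = (4 * C + 4) * δ ^ 2 + ε / 2 := by ring
    _ ≤ ε / 2 + ε / 2 := by gcongr
    _ = ε := ENNReal.add_halves ε

end Density

end AnisoTrace

namespace AnisoTrace

/-! ### Smooth approximation on convex open sets, and cutoff at infinity -/

section Density

open scoped Convolution

variable {E : Type*} [NormedAddCommGroup E] [NormedSpace ℝ E] [MeasureSpace E] [BorelSpace E]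
  [FiniteDimensional ℝ E] [(volume : Measure E).IsAddHaarMeasure]

/-- The reflected bump x ↦ η(y - x) is supported in the closed ball of radius `φ.rOut` about y. When
that ball lies in O it is an admissible test function, and the definition of the weak derivative
moves the derivative from the bump to u. -/
theorem fderiv_convolution_of_isWeakDeriv {O : Set E} (hO : IsOpen O) {v : E} {u g : E → ℂ}
    (h : IsWeakDeriv O v u g) (hu : LocallyIntegrable (O.indicator u))
    (φ : ContDiffBump (0 : E)) {y : E} (hy : Metric.closedBall y φ.rOut ⊆ O) :
    fderiv ℝ (φ.normed volume ⋆[ContinuousLinearMap.lsmul ℝ ℝ, volume] O.indicator u) y v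
      = (φ.normed volume ⋆[ContinuousLinearMap.lsmul ℝ ℝ, volume] O.indicator g) y := by
  set η := φ.normed (volume : Measure E) with hη
  have hc : ContDiff ℝ ∞ η := φ.contDiff_normed
  have hs : HasCompactSupport η := φ.hasCompactSupport_normed
  set ψ : E → ℝ := fun x => η (y - x) with hψ
  have hψc : ContDiff ℝ ∞ ψ := hc.comp (contDiff_const.sub contDiff_id)
  have hψt : tsupport ψ ⊆ Metric.closedBall y φ.rOut := by
    refine closure_minimal (fun x hx => ?_) Metric.isClosed_closedBall
    have : y - x ∈ tsupport η := subset_tsupport _ hx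
    rw [hη, φ.tsupport_normed_eq, mem_closedBall_zero_iff] at this
    rwa [Metric.mem_closedBall, dist_comm, dist_eq_norm]
  have hψs : HasCompactSupport ψ :=
    (isCompact_closedBall y φ.rOut).of_isClosed_subset (isClosed_tsupport _) hψt
  have hψd : ∀ x, fderiv ℝ ψ x v = - fderiv ℝ η (y - x) v := by
    intro x
    have h1 : HasFDerivAt (fun x => y - x) (-ContinuousLinearMap.id ℝ E) x :=
      (hasFDerivAt_id x).const_sub y
    have h2 := ((hc.differentiable (by simp) (y - x)).hasFDerivAt).comp x h1
    rw [HasFDerivAt.fderiv (f := ψ) h2]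
    simp
  have hd := hs.hasFDerivAt_convolution_left (ContinuousLinearMap.lsmul ℝ ℝ)
    (hc.of_le (by simp)) hu y
  have hint : Integrable (fun t => (ContinuousLinearMap.precompL E
      (ContinuousLinearMap.lsmul ℝ ℝ : ℝ →L[ℝ] ℂ →L[ℝ] ℂ)) (fderiv ℝ η t)
        (O.indicator u (y - t))) :=
    (hs.fderiv (𝕜 := ℝ)).convolutionExists_left (ContinuousLinearMap.precompL E
      (ContinuousLinearMap.lsmul ℝ ℝ : ℝ →L[ℝ] ℂ →L[ℝ] ℂ))
      (hc.continuous_fderiv (by simp)) hu y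
  rw [hd.fderiv]
  have e1 : ((fderiv ℝ η ⋆[ContinuousLinearMap.precompL E
      (ContinuousLinearMap.lsmul ℝ ℝ : ℝ →L[ℝ] ℂ →L[ℝ] ℂ), volume] O.indicator u) y) v
      = ∫ t, (fderiv ℝ η t v) • O.indicator u (y - t) := by
    unfold convolution
    rw [ContinuousLinearMap.integral_apply hint]
    simp
  have e2 : ∫ t, (fderiv ℝ η t v) • O.indicator u (y - t)
      = ∫ x, (fderiv ℝ η (y - x) v) • O.indicator u x := by
    rw [← integral_sub_left_eq_self _ volume y]
    simp
  have hm : MeasurableSet O := hO.measurableSet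
  have ind : ∀ (k : E → ℝ) (f : E → ℂ), ∫ x, k x • O.indicator f x = ∫ x in O, k x • f x := by
    intro k f
    rw [← integral_indicator hm]
    congr 1
    ext x
    by_cases hx : x ∈ O <;> simp [hx]
  have e3 := h ψ hψc hψs (hψt.trans hy)
  rw [e1, e2, ind, convolution_eq_swap]
  simp only [ContinuousLinearMap.lsmul_apply]
  rw [ind, ← neg_inj, ← e3]
  simp only [hψd, neg_smul, integral_neg]

/-- A point of the small ball is (1 - t) q + t p' with p' in the ball of radius r about q₀, hence in
Q by convexity. At contracted points the mollifier thus never sees the boundary of Q. -/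
theorem closedBall_contraction_subset {Q : Set E} (hQ : Convex ℝ Q) {q₀ : E} {r : ℝ}
    (hr : Metric.closedBall q₀ r ⊆ Q) {t : ℝ} (ht : 0 < t) (ht' : t ≤ 1) {q : E} (hq : q ∈ Q)
    {ρ : ℝ} (hρ : ρ ≤ t * r) : Metric.closedBall (contraction q₀ t q) ρ ⊆ Q := by
  intro p hp
  rw [mem_closedBall_iff_norm] at hp
  have h1 : q₀ + t⁻¹ • (p - contraction q₀ t q) ∈ Q := by
    apply hr
    rw [mem_closedBall_iff_norm, add_sub_cancel_left, norm_smul, norm_inv,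
      Real.norm_of_nonneg ht.le, inv_mul_le_iff₀ ht]
    exact hp.trans hρ
  have e : p = (1 - t) • q + t • (q₀ + t⁻¹ • (p - contraction q₀ t q)) := by
    rw [smul_add, smul_smul, mul_inv_cancel₀ ht.ne', one_smul]
    unfold contraction; module
  rw [e]
  exact hQ hq h1 (by linarith) ht.le (by ring)

/-- Smooth approximation in `H¹` of a convex open set, by functions smooth on the whole space. -/
theorem exists_contDiff_approx {Q : Set E} (hO : IsOpen Q) (hQ : Convex ℝ Q) (hne : Q.Nonempty)
    {v : Fin 2 → E} (U : dirSobolev Q v) {ε : ℝ≥0∞} (hε : 0 < ε) :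
    ∃ h : E → ℂ, ContDiff ℝ ∞ h ∧ ∫⁻ x in Q, ‖h x - U.1 0 x‖ₑ ^ 2 ≤ ε ∧
      ∀ i, ∫⁻ x in Q, ‖fderiv ℝ h x (v i) - U.1 i.succ x‖ₑ ^ 2 ≤ ε := by
  obtain ⟨q₀, hq₀⟩ := hne
  obtain ⟨r', hr', hball⟩ := Metric.isOpen_iff.1 hO q₀ hq₀
  set r : ℝ := min (r' / 2) 1 with hr
  have hr0 : 0 < r := lt_min (by linarith) one_pos
  have hrQ : Metric.closedBall q₀ r ⊆ Q :=
    (Metric.closedBall_subset_ball (by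
      have := min_le_left (r' / 2) 1; rw [← hr] at this; linarith)).trans hball
  set t : ℕ → ℝ := fun n => 1 / 2 * (1 / ((n : ℝ) + 1)) with ht
  have htpos : ∀ n, 0 < t n := fun n => by positivity
  have htlim : Tendsto t atTop (𝓝 0) := by
    simpa [ht] using tendsto_one_div_add_atTop_nhds_zero_nat.const_mul (1 / 2 : ℝ)
  have ht1 : ∀ n, t n ≤ 1 / 2 := by
    intro n
    have : 1 / ((n : ℝ) + 1) ≤ 1 := by
      rw [div_le_one (by positivity)]; linarith [n.cast_nonneg (α := ℝ)]
    simp only [ht]; linarith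
  -- The outer radius t r is exactly the margin granted by `closedBall_contraction_subset`.
  let φ : ℕ → ContDiffBump (0 : E) := fun n =>
    ⟨t n * r / 2, t n * r, by have := htpos n; positivity,
      by have := mul_pos (htpos n) hr0; linarith⟩
  have hφr : ∀ n, (φ n).rOut = t n * r := fun n => rfl
  have hφ : Tendsto (fun n => (φ n).rOut) atTop (𝓝 0) := by
    simpa [hφr] using htlim.mul_const r
  have hφ1 : ∀ n, (φ n).rOut ≤ 1 := by
    intro n
    have h1 : r ≤ 1 := min_le_right _ _
    rw [hφr]
    nlinarith [htpos n, ht1 n]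
  have hm : MeasurableSet Q := hO.measurableSet
  have hmeas : ∀ i, Measurable (Q.indicator (U.1 i)) := fun i =>
    (Lp.stronglyMeasurable (U.1 i)).measurable.indicator hm
  have hmem : ∀ i, MemLp (Q.indicator (U.1 i)) 2 := fun i =>
    (memLp_indicator_iff_restrict hm).2 (Lp.memLp (U.1 i))
  have hlim : ∀ i, Tendsto (fun n => ∫⁻ q, ‖mollify q₀ (t n) (φ n) (Q.indicator (U.1 i)) q
      - Q.indicator (U.1 i) q‖ₑ ^ 2) atTop (𝓝 0) := fun i =>
    tendsto_mollify q₀ htlim (fun n => (htpos n).le) ht1 hφ hφ1 (hmeas i) (hmem i)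
  have hloc : ∀ i, LocallyIntegrable (Q.indicator (U.1 i)) := fun i =>
    (hmem i).locallyIntegrable (by norm_num)
  have hfin : ∀ i, ∫⁻ q, ‖Q.indicator (U.1 i) q‖ₑ ^ 2 ≠ ⊤ := by
    intro i
    rw [← eLpNorm_two_sq]
    exact ENNReal.pow_ne_top (hmem i).2.ne
  set C : ℝ≥0∞ := ENNReal.ofReal (2 ^ Module.finrank ℝ E) with hC
  -- The second term is for the chain rule: differentiating through the contraction gives a factor 1
  -- - t, and the missing multiple t of the mollified derivative is small in L².
  have hlim2 : ∀ i, Tendsto (fun n => 2 * (∫⁻ q, ‖mollify q₀ (t n) (φ n) (Q.indicator (U.1 i)) q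
      - Q.indicator (U.1 i) q‖ₑ ^ 2) + 2 * (ENNReal.ofReal (t n) ^ 2 *
        (C * ∫⁻ q, ‖Q.indicator (U.1 i) q‖ₑ ^ 2))) atTop (𝓝 0) := by
    intro i
    have h1 := ENNReal.Tendsto.const_mul (hlim i) (Or.inr (by finiteness : (2 : ℝ≥0∞) ≠ ⊤))
    have h2 : Tendsto (fun n => ENNReal.ofReal (t n) ^ 2) atTop (𝓝 0) := by
      have := ((ENNReal.continuous_pow 2).tendsto _).comp (ENNReal.tendsto_ofReal htlim)
      simpa [Function.comp_def] using this
    have h3 := ENNReal.Tendsto.const_mul (ENNReal.Tendsto.mul_const h2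
      (b := C * ∫⁻ q, ‖Q.indicator (U.1 i) q‖ₑ ^ 2)
      (Or.inr (ENNReal.mul_ne_top (by finiteness) (hfin i))))
      (Or.inr (by finiteness : (2 : ℝ≥0∞) ≠ ⊤))
    simpa using h1.add h3
  have hev : ∀ᶠ n in atTop, ∀ i, 2 * (∫⁻ q, ‖mollify q₀ (t n) (φ n) (Q.indicator (U.1 i)) q
      - Q.indicator (U.1 i) q‖ₑ ^ 2) + 2 * (ENNReal.ofReal (t n) ^ 2 *
        (C * ∫⁻ q, ‖Q.indicator (U.1 i) q‖ₑ ^ 2)) ≤ ε :=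
    eventually_all.2 fun i => ENNReal.tendsto_nhds_zero.1 (hlim2 i) ε hε
  obtain ⟨n, hn⟩ := hev.exists
  have hA : ContDiff ℝ ∞ (contraction q₀ (t n)) := by unfold contraction; fun_prop
  have hconv : ∀ i, ContDiff ℝ ∞ (φ n |>.normed volume ⋆[ContinuousLinearMap.lsmul ℝ ℝ, volume]
      Q.indicator (U.1 i)) := fun i =>
    (φ n).hasCompactSupport_normed.contDiff_convolution_left _ (φ n).contDiff_normed (hloc i)
  refine ⟨mollify q₀ (t n) (φ n) (Q.indicator (U.1 0)), (hconv 0).comp hA, ?_, fun i => ?_⟩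
  · refine le_trans ?_ (hn 0)
    refine le_trans ?_ le_self_add
    refine le_trans ?_ (le_mul_of_one_le_left' (by norm_num))
    refine le_trans (le_of_eq ?_) (setLIntegral_le_lintegral Q _)
    exact setLIntegral_congr_fun hm fun x hx => by simp only [indicator_of_mem hx]
  · refine le_trans ?_ (hn i.succ)
    have hder : ∀ q ∈ Q, fderiv ℝ (mollify q₀ (t n) (φ n) (Q.indicator (U.1 0))) q (v i)
        = (1 - (t n : ℂ)) * mollify q₀ (t n) (φ n) (Q.indicator (U.1 i.succ)) q := by
      intro q hq
      have hy : Metric.closedBall (contraction q₀ (t n) q) (φ n).rOut ⊆ Q :=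
        closedBall_contraction_subset hQ hrQ (htpos n) (by linarith [ht1 n]) hq (hφr n).le
      have h1 := fderiv_convolution_of_isWeakDeriv hO (U.2 i) (hloc 0) (φ n) hy
      have h2 : HasFDerivAt (contraction q₀ (t n)) ((1 - t n) • ContinuousLinearMap.id ℝ E) q :=
        (((hasFDerivAt_id q).sub_const q₀).const_smul (1 - t n)).const_add q₀
      have h3 := (((hconv 0).differentiable (by simp) _).hasFDerivAt).comp q h2
      rw [HasFDerivAt.fderiv (f := mollify q₀ (t n) (φ n) (Q.indicator (U.1 0))) h3]
      simp only [ContinuousLinearMap.comp_apply, smul_apply,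
        ContinuousLinearMap.id_apply, map_smul]
      rw [h1, Complex.real_smul]
      simp [mollify]
    have mm : ∀ i, Measurable (mollify q₀ (t n) (φ n) (Q.indicator (U.1 i))) := fun i =>
      measurable_mollify q₀ (t n) (φ n) (hloc i)
    calc _ ≤ ∫⁻ x in Q, (2 * ‖mollify q₀ (t n) (φ n) (Q.indicator (U.1 i.succ)) x
            - Q.indicator (U.1 i.succ) x‖ₑ ^ 2 + 2 * (ENNReal.ofReal (t n) ^ 2 *
              ‖mollify q₀ (t n) (φ n) (Q.indicator (U.1 i.succ)) x‖ₑ ^ 2)) := by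
          refine setLIntegral_mono_ae' hm (Eventually.of_forall fun x hx => ?_)
          rw [hder x hx, indicator_of_mem hx]
          have e : (1 - (t n : ℂ)) * mollify q₀ (t n) (φ n) (Q.indicator (U.1 i.succ)) x
              - U.1 i.succ x = (mollify q₀ (t n) (φ n) (Q.indicator (U.1 i.succ)) x
              - U.1 i.succ x) + (-(t n : ℂ)) * mollify q₀ (t n) (φ n) (Q.indicator (U.1 i.succ)) x := by
            ring
          rw [e]
          refine (enorm_add_sq_le _ _).trans (add_le_add le_rfl (mul_le_mul_right ?_ _))
          rw [enorm_mul, mul_pow, enorm_neg]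
          refine le_of_eq ?_
          congr 2
          rw [← ofReal_norm, Complex.norm_real, Real.norm_of_nonneg (htpos n).le]
      _ ≤ ∫⁻ x, (2 * ‖mollify q₀ (t n) (φ n) (Q.indicator (U.1 i.succ)) x
            - Q.indicator (U.1 i.succ) x‖ₑ ^ 2 + 2 * (ENNReal.ofReal (t n) ^ 2 *
              ‖mollify q₀ (t n) (φ n) (Q.indicator (U.1 i.succ)) x‖ₑ ^ 2)) :=
          setLIntegral_le_lintegral _ _
      _ ≤ _ := by
          have m1 := (mm i.succ).enorm.pow_const 2
          have m2 : Measurable fun x => ‖mollify q₀ (t n) (φ n) (Q.indicator (U.1 i.succ)) x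
            - Q.indicator (U.1 i.succ) x‖ₑ ^ 2 :=
            ((mm i.succ).sub (hmeas i.succ)).enorm.pow_const 2
          have m3 := m1.const_mul (ENNReal.ofReal (t n) ^ 2)
          rw [lintegral_add_right _ (m3.const_mul 2), lintegral_const_mul _ m2,
            lintegral_const_mul _ m3, lintegral_const_mul _ m1]
          gcongr
          exact lintegral_mollify_sq_le q₀ (ht1 n) (φ n) (hmeas i.succ)

/-- The bump function used to cut off at infinity. -/
noncomputable def cutoffBump (E : Type*) [NormedAddCommGroup E] : ContDiffBump (0 : E) :=
  ⟨1, 2, one_pos, one_lt_two⟩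

/-- Multiplication by a smooth cutoff at the scale `R`. -/
noncomputable def cutoff (R : ℝ) (h : E → ℂ) (x : E) : ℂ := (cutoffBump E (R⁻¹ • x)) • h x

theorem contDiff_cutoff (R : ℝ) {h : E → ℂ} (hh : ContDiff ℝ ∞ h) : ContDiff ℝ ∞ (cutoff R h) :=
  ((cutoffBump E).contDiff.comp (contDiff_const_smul R⁻¹)).smul hh

theorem cutoff_of_le {R : ℝ} (hR : 0 < R) (h : E → ℂ) {x : E} (hx : ‖x‖ ≤ R) :
    cutoff R h x = h x := by
  have : cutoffBump E (R⁻¹ • x) = 1 := by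
    refine (cutoffBump E).one_of_mem_closedBall ?_
    rw [mem_closedBall_zero_iff, norm_smul, norm_inv, Real.norm_of_nonneg hR.le,
      inv_mul_le_iff₀ hR]
    simpa [cutoffBump] using hx
  rw [cutoff, this, one_smul]

theorem cutoff_of_ge {R : ℝ} (hR : 0 < R) (h : E → ℂ) {x : E} (hx : 2 * R ≤ ‖x‖) :
    cutoff R h x = 0 := by
  have : cutoffBump E (R⁻¹ • x) = 0 := by
    refine (cutoffBump E).zero_of_le_dist ?_
    rw [dist_zero_right, norm_smul, norm_inv, Real.norm_of_nonneg hR.le,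
      le_inv_mul_iff₀ hR]
    simp only [cutoffBump]
    linarith
  rw [cutoff, this, zero_smul]

theorem hasCompactSupport_cutoff {R : ℝ} (hR : 0 < R) (h : E → ℂ) :
    HasCompactSupport (cutoff R h) := by
  refine HasCompactSupport.intro (isCompact_closedBall (0 : E) (2 * R)) fun x hx => ?_
  rw [mem_closedBall_zero_iff, not_le] at hx
  exact cutoff_of_ge hR h hx.le

theorem tendsto_lintegral_cutoff {Q : Set E} {h : E → ℂ} (hh : Continuous h)
    (hf : ∫⁻ x in Q, ‖h x‖ₑ ^ 2 ≠ ⊤) :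
    Tendsto (fun n : ℕ => ∫⁻ x in Q, ‖cutoff ((n : ℝ) + 1) h x - h x‖ₑ ^ 2) atTop (𝓝 0) := by
  have hlim := tendsto_lintegral_of_dominated_convergence (μ := volume.restrict Q)
    (F := fun (n : ℕ) x => ‖cutoff ((n : ℝ) + 1) h x - h x‖ₑ ^ 2) (f := fun _ => 0)
    (fun x => ‖h x‖ₑ ^ 2) (fun n => ?_) (fun n => Eventually.of_forall fun x => ?_) hf
    (Eventually.of_forall fun x => ?_)
  · simpa using hlim
  · have : Continuous (cutoff ((n : ℝ) + 1) h) :=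
      ((cutoffBump E).continuous.comp (continuous_const_smul _)).smul hh
    exact (this.sub hh).measurable.enorm.pow_const 2
  · refine pow_le_pow_left' ?_ 2
    have e : cutoff ((n : ℝ) + 1) h x - h x
        = ((cutoffBump E (((n : ℝ) + 1)⁻¹ • x)) - 1) • h x := by
      rw [cutoff, sub_smul, one_smul]
    rw [e, enorm_smul]
    refine mul_le_of_le_one_left' ?_
    have h1 := (cutoffBump E).nonneg (x := ((n : ℝ) + 1)⁻¹ • x)
    have h2 := (cutoffBump E).le_one (x := ((n : ℝ) + 1)⁻¹ • x)
    rw [← ofReal_norm, ← ENNReal.ofReal_one]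
    refine ENNReal.ofReal_le_ofReal ?_
    rw [Real.norm_eq_abs, abs_le]
    constructor <;> linarith
  · refine tendsto_const_nhds.congr' ?_
    filter_upwards [eventually_ge_atTop ⌈‖x‖⌉₊] with n hn
    have h1 : ‖x‖ ≤ (n : ℝ) + 1 := by
      have := (Nat.le_ceil ‖x‖).trans (Nat.cast_le.2 hn)
      linarith
    rw [cutoff_of_le (by positivity) h h1]
    simp

theorem fderiv_cutoff (R : ℝ) {h : E → ℂ} (hh : ContDiff ℝ ∞ h) (x v : E) :
    fderiv ℝ (cutoff R h) x v
      = cutoff R (fun y => fderiv ℝ h y v) x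
        + (R⁻¹ * fderiv ℝ (cutoffBump E) (R⁻¹ • x) v) • h x := by
  have h1 : HasFDerivAt (fun y : E => R⁻¹ • y) (R⁻¹ • ContinuousLinearMap.id ℝ E) x :=
    (hasFDerivAt_id x).const_smul R⁻¹
  have h2 := (((cutoffBump E).contDiff (n := 1)).differentiable (by simp) (R⁻¹ • x)).hasFDerivAt.comp x h1
  have h3 := h2.smul (hh.differentiable (by simp) x).hasFDerivAt
  rw [HasFDerivAt.fderiv (f := cutoff R h) h3]
  simp [cutoff]

/-- By the product rule the error is the cutoff error of the derivative of h, plus h times the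
derivative of the cutoff, which is O(1/R). -/
theorem tendsto_lintegral_fderiv_cutoff {Q : Set E} {h : E → ℂ} (hh : ContDiff ℝ ∞ h) (v : E)
    (hf : ∫⁻ x in Q, ‖h x‖ₑ ^ 2 ≠ ⊤) (hf' : ∫⁻ x in Q, ‖fderiv ℝ h x v‖ₑ ^ 2 ≠ ⊤) :
    Tendsto (fun n : ℕ => ∫⁻ x in Q, ‖fderiv ℝ (cutoff ((n : ℝ) + 1) h) x v
      - fderiv ℝ h x v‖ₑ ^ 2) atTop (𝓝 0) := by
  have hc1 : Continuous fun x => fderiv ℝ h x v :=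
    (hh.continuous_fderiv (by simp)).clm_apply continuous_const
  have hd : Continuous fun x => fderiv ℝ (cutoffBump E) x v :=
    ((cutoffBump E).contDiff (n := 1)).continuous_fderiv (by simp) |>.clm_apply continuous_const
  obtain ⟨B, hB⟩ := HasCompactSupport.exists_bound_of_continuous
    (((cutoffBump E).hasCompactSupport.fderiv (𝕜 := ℝ)).comp_left
      (g := fun L : E →L[ℝ] ℝ => L v) (by simp)) hd
  have l1 := ENNReal.Tendsto.const_mul (tendsto_lintegral_cutoff hc1 hf')
    (Or.inr (by finiteness : (2 : ℝ≥0∞) ≠ ⊤))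
  have l2 : Tendsto (fun n : ℕ => ENNReal.ofReal (1 / ((n : ℝ) + 1) * B) ^ 2) atTop (𝓝 0) := by
    have h0 : Tendsto (fun n : ℕ => 1 / ((n : ℝ) + 1) * B) atTop (𝓝 0) := by
      simpa using tendsto_one_div_add_atTop_nhds_zero_nat.mul_const B
    have := ((ENNReal.continuous_pow 2).tendsto _).comp (ENNReal.tendsto_ofReal h0)
    simpa [Function.comp_def] using this
  have l3 := ENNReal.Tendsto.const_mul (ENNReal.Tendsto.mul_const l2 (Or.inr hf))
      (Or.inr (by finiteness : (2 : ℝ≥0∞) ≠ ⊤))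
  have l4 := l1.add l3
  rw [zero_mul, mul_zero, add_zero] at l4
  refine tendsto_of_tendsto_of_tendsto_of_le_of_le tendsto_const_nhds l4
    (fun _ => zero_le) fun n => ?_
  have m1 : Measurable fun x => ‖cutoff ((n : ℝ) + 1) (fun y => fderiv ℝ h y v) x
      - fderiv ℝ h x v‖ₑ ^ 2 := by
    have : Continuous (cutoff ((n : ℝ) + 1) (fun y => fderiv ℝ h y v)) :=
      ((cutoffBump E).continuous.comp (continuous_const_smul _)).smul hc1
    exact (this.sub hc1).measurable.enorm.pow_const 2
  have m2 : Measurable fun x => ‖h x‖ₑ ^ 2 := hh.continuous.measurable.enorm.pow_const 2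
  rw [← lintegral_const_mul _ m1, ← lintegral_const_mul _ m2,
    ← lintegral_const_mul _ (m2.const_mul _), ← lintegral_add_left (m1.const_mul _)]
  refine lintegral_mono fun x => ?_
  rw [fderiv_cutoff _ hh, add_sub_right_comm]
  refine (enorm_add_sq_le _ _).trans (add_le_add le_rfl (mul_le_mul_right ?_ _))
  rw [enorm_smul, mul_pow]
  gcongr
  rw [← ofReal_norm]
  refine ENNReal.ofReal_le_ofReal ?_
  rw [norm_mul, norm_inv, Real.norm_of_nonneg (by positivity : (0 : ℝ) ≤ (n : ℝ) + 1), one_div]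
  gcongr
  exact hB _

end Density

end AnisoTrace

namespace AnisoTrace

/-! ### Density of restrictions of C^∞_c functions -/

section TestFunctions

variable {E : Type*} [NormedAddCommGroup E] [NormedSpace ℝ E]

/-- The space `C^∞_c(E)` of complex-valued functions. -/
def testFunctions (E : Type*) [NormedAddCommGroup E] [NormedSpace ℝ E] :
    Submodule ℂ (E → ℂ) where
  carrier := {w | ContDiff ℝ ∞ w ∧ HasCompactSupport w}
  zero_mem' := ⟨contDiff_const, HasCompactSupport.zero⟩
  add_mem' := fun ha hb => ⟨ha.1.add hb.1, ha.2.add hb.2⟩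
  smul_mem' := fun k _ ha => ⟨contDiff_const.smul ha.1, ha.2.smul_left (f := fun _ => k)⟩

theorem continuous_fderiv_apply {w : E → ℂ} (hw : ContDiff ℝ ∞ w) (v : E) :
    Continuous fun x => fderiv ℝ w x v :=
  (hw.continuous_fderiv (by simp)).clm_apply continuous_const

variable [MeasureSpace E] [BorelSpace E]
  [FiniteDimensional ℝ E] [(volume : Measure E).IsAddHaarMeasure]

theorem memLp_test (w : testFunctions E) (O : Set E) :
    MemLp (w : E → ℂ) 2 (volume.restrict O) :=
  (w.2.1.continuous.memLp_of_hasCompactSupport (μ := volume) w.2.2).restrict O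

theorem memLp_fderiv_test (w : testFunctions E) (O : Set E) (v : E) :
    MemLp (fun x => fderiv ℝ (w : E → ℂ) x v) 2 (volume.restrict O) :=
  ((continuous_fderiv_apply w.2.1 v).memLp_of_hasCompactSupport (μ := volume)
    ((w.2.2.fderiv (𝕜 := ℝ)).comp_left (g := fun L : E →L[ℝ] ℂ => L v) (by simp))).restrict O

/-- An element of `dirSobolev O v` given by a smooth function. -/
noncomputable def smoothSobolev {O : Set E} (hO : IsOpen O) (v : Fin 2 → E) {h : E → ℂ}
    (hh : ContDiffOn ℝ 1 h O) (h0 : MemLp h 2 (volume.restrict O))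
    (h1 : ∀ i, MemLp (fun x => fderiv ℝ h x (v i)) 2 (volume.restrict O)) : dirSobolev O v :=
  mkSobolev h (fun i x => fderiv ℝ h x (v i)) h0 h1 fun i => isWeakDeriv_of_contDiffOn hO hh (v i)

theorem smoothSobolev_coe {O : Set E} (hO : IsOpen O) (v : Fin 2 → E) {h : E → ℂ}
    (hh : ContDiffOn ℝ 1 h O) (h0 : MemLp h 2 (volume.restrict O))
    (h1 : ∀ i, MemLp (fun x => fderiv ℝ h x (v i)) 2 (volume.restrict O)) :
    ((smoothSobolev hO v hh h0 h1).1 0 : E → ℂ) =ᵐ[volume.restrict O] h := h0.coeFn_toLp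

theorem smoothSobolev_coe_succ {O : Set E} (hO : IsOpen O) (v : Fin 2 → E) {h : E → ℂ}
    (hh : ContDiffOn ℝ 1 h O) (h0 : MemLp h 2 (volume.restrict O))
    (h1 : ∀ i, MemLp (fun x => fderiv ℝ h x (v i)) 2 (volume.restrict O)) (i : Fin 2) :
    ((smoothSobolev hO v hh h0 h1).1 i.succ : E → ℂ) =ᵐ[volume.restrict O]
      fun x => fderiv ℝ h x (v i) := (h1 i).coeFn_toLp

/-- The inclusion of `C^∞_c(E)` in `dirSobolev O v`, by restriction. -/
noncomputable def testToSobolev {O : Set E} (hO : IsOpen O) (v : Fin 2 → E) :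
    testFunctions E →ₗ[ℂ] dirSobolev O v where
  toFun w := smoothSobolev hO v (w.2.1.of_le (by simp)).contDiffOn (memLp_test w O)
    fun i => memLp_fderiv_test w O (v i)
  map_add' a b := dirSobolev_ext hO (MemLp.toLp_add (memLp_test a O) (memLp_test b O))
  map_smul' k a := dirSobolev_ext hO (MemLp.toLp_const_smul k (memLp_test a O))

theorem testToSobolev_coe {O : Set E} (hO : IsOpen O) (v : Fin 2 → E) (w : testFunctions E) :
    ((testToSobolev hO v w).1 0 : E → ℂ) =ᵐ[volume.restrict O] w := (memLp_test w O).coeFn_toLp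

theorem testToSobolev_coe_succ {O : Set E} (hO : IsOpen O) (v : Fin 2 → E)
    (w : testFunctions E) (i : Fin 2) :
    ((testToSobolev hO v w).1 i.succ : E → ℂ) =ᵐ[volume.restrict O]
      fun x => fderiv ℝ (w : E → ℂ) x (v i) := (memLp_fderiv_test w O (v i)).coeFn_toLp

theorem enorm_sub_dirSobolev_sq {O : Set E} {v : Fin 2 → E} (U W : dirSobolev O v)
    {f : E → ℂ} {g : Fin 2 → E → ℂ} (hf : (U.1 0 : E → ℂ) =ᵐ[volume.restrict O] f)
    (hg : ∀ i : Fin 2, (U.1 i.succ : E → ℂ) =ᵐ[volume.restrict O] g i) :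
    ‖U - W‖ₑ ^ 2 = (∫⁻ x in O, ‖f x - W.1 0 x‖ₑ ^ 2) + (∫⁻ x in O, ‖g 0 x - W.1 1 x‖ₑ ^ 2)
      + ∫⁻ x in O, ‖g 1 x - W.1 2 x‖ₑ ^ 2 := by
  rw [enorm_dirSobolev_sq]
  congr 1
  congr 1
  · refine lintegral_congr_ae ?_
    filter_upwards [hf, Lp.coeFn_sub (U.1 0) (W.1 0)] with x h1 h2
    change ‖(U.1 0 - W.1 0 : L2 O) x‖ₑ ^ 2 = _
    rw [h2, Pi.sub_apply, h1]
  · refine lintegral_congr_ae ?_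
    filter_upwards [hg 0, Lp.coeFn_sub (U.1 1) (W.1 1)] with x h1 h2
    change ‖(U.1 1 - W.1 1 : L2 O) x‖ₑ ^ 2 = _
    rw [h2, Pi.sub_apply, ← h1]; rfl
  · refine lintegral_congr_ae ?_
    filter_upwards [hg 1, Lp.coeFn_sub (U.1 2) (W.1 2)] with x h1 h2
    change ‖(U.1 2 - W.1 2 : L2 O) x‖ₑ ^ 2 = _
    rw [h2, Pi.sub_apply, ← h1]; rfl

theorem tendsto_of_tendsto_enorm_sub_sq {F ι : Type*} [NormedAddCommGroup F] {l : Filter ι}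
    {f : ι → F} {a : F} (h : Tendsto (fun i => ‖f i - a‖ₑ ^ 2) l (𝓝 0)) : Tendsto f l (𝓝 a) := by
  rw [tendsto_iff_edist_tendsto_0]
  have h2 := (ENNReal.continuous_rpow_const (y := 1 / 2)).tendsto 0 |>.comp h
  rw [ENNReal.zero_rpow_of_pos (by norm_num)] at h2
  refine h2.congr fun i => ?_
  rw [Function.comp_apply, ← ENNReal.rpow_natCast, ← ENNReal.rpow_mul, edist_eq_enorm_sub]
  norm_num

theorem lintegral_enorm_sq_ne_top {O : Set E} {f : E → ℂ} (hf : MemLp f 2 (volume.restrict O)) :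
    ∫⁻ x in O, ‖f x‖ₑ ^ 2 ≠ ⊤ := by
  rw [← eLpNorm_two_sq]
  exact ENNReal.pow_ne_top hf.2.ne

/-- The cutoff at scale `n + 1` of a smooth function, as a test function. -/
noncomputable def cutoffTest {h : E → ℂ} (hh : ContDiff ℝ ∞ h) (n : ℕ) : testFunctions E :=
  ⟨cutoff ((n : ℝ) + 1) h, contDiff_cutoff _ hh, hasCompactSupport_cutoff (by positivity) h⟩

theorem tendsto_cutoffTest {O : Set E} (hO : IsOpen O) (v : Fin 2 → E) {h : E → ℂ}
    (hh : ContDiff ℝ ∞ h) (h0 : MemLp h 2 (volume.restrict O))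
    (h1 : ∀ i, MemLp (fun x => fderiv ℝ h x (v i)) 2 (volume.restrict O)) :
    Tendsto (fun n => testToSobolev hO v (cutoffTest hh n)) atTop
      (𝓝 (smoothSobolev hO v (hh.of_le (by simp)).contDiffOn h0 h1)) := by
  refine tendsto_of_tendsto_enorm_sub_sq ?_
  have l0 := tendsto_lintegral_cutoff (Q := O) hh.continuous (lintegral_enorm_sq_ne_top h0)
  have l1 := fun i => tendsto_lintegral_fderiv_cutoff (Q := O) hh (v i)
    (lintegral_enorm_sq_ne_top h0) (lintegral_enorm_sq_ne_top (h1 i))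
  have l := (l0.add (l1 0)).add (l1 1)
  simp only [add_zero] at l
  refine l.congr fun n => ?_
  rw [enorm_sub_dirSobolev_sq _ _ (testToSobolev_coe hO v _)
    (testToSobolev_coe_succ hO v _)]
  congr 1
  congr 1
  · refine lintegral_congr_ae ?_
    filter_upwards [smoothSobolev_coe hO v (hh.of_le (by simp)).contDiffOn h0 h1] with x hx
    rw [hx]; rfl
  · refine lintegral_congr_ae ?_
    filter_upwards [smoothSobolev_coe_succ hO v (hh.of_le (by simp)).contDiffOn h0 h1 0] with x hx
    rw [← hx]; rfl
  · refine lintegral_congr_ae ?_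
    filter_upwards [smoothSobolev_coe_succ hO v (hh.of_le (by simp)).contDiffOn h0 h1 1] with x hx
    rw [← hx]; rfl

theorem le_of_sq_le_sq_ennreal {a : ℝ≥0∞} {ε : ℝ≥0∞} (h : a ^ 2 ≤ ε ^ 2) : a ≤ ε :=
  (ENNReal.pow_le_pow_left_iff (by norm_num)).1 h

/-- Restrictions of functions in `C^∞_c` are dense in `H¹` of a convex open set. -/
theorem denseRange_testToSobolev {O : Set E} (hO : IsOpen O) (hc : Convex ℝ O)
    (hne : O.Nonempty) (v : Fin 2 → E) : DenseRange (testToSobolev hO v) := by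
  intro U
  -- Two approximations are composed: U by functions smooth on the whole space with finite norm, and
  -- each of those by its cutoffs.
  have key : U ∈ closure (closure (range (testToSobolev hO v))) := by
    rw [Metric.mem_closure_iff_infEDist_zero, ← nonpos_iff_eq_zero]
    refine le_of_forall_pos_le_add fun ε hε => ?_
    rw [zero_add]
    by_cases htop : ε = ⊤
    · rw [htop]; exact le_top
    have hε' : 0 < ε ^ 2 / 3 := ENNReal.div_pos (pow_ne_zero _ hε.ne') (by finiteness)
    obtain ⟨h, hh, a0, a1⟩ := exists_contDiff_approx hO hc hne U hε'
    -- The approximant is smooth with no control at infinity; it and its derivatives are in L²(O)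
    -- because they are close to L² functions.
    have fin : ∀ (f : E → ℂ) (u : L2 O), Continuous f →
        ∫⁻ x in O, ‖f x - u x‖ₑ ^ 2 ≤ ε ^ 2 / 3 → MemLp f 2 (volume.restrict O) := by
      intro f u hf hle
      have h1 : MemLp (fun x => f x - u x) 2 (volume.restrict O) :=
        memLp_two_of_lintegral (hf.aestronglyMeasurable.sub (Lp.aestronglyMeasurable u))
          (hle.trans_lt (ENNReal.div_lt_top (ENNReal.pow_ne_top htop) (by norm_num)))
      have h2 := h1.add (Lp.memLp u)
      refine h2.ae_eq (Eventually.of_forall fun x => ?_)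
      simp
    have h0 := fin h _ hh.continuous a0
    have h1 := fun i => fin _ _ (continuous_fderiv_apply hh (v i)) (a1 i)
    refine (Metric.infEDist_le_edist_of_mem (mem_closure_of_tendsto (tendsto_cutoffTest hO v hh h0 h1)
      (Eventually.of_forall fun n => mem_range_self _))).trans ?_
    rw [edist_comm, edist_eq_enorm_sub]
    refine le_of_sq_le_sq_ennreal ?_
    rw [enorm_sub_dirSobolev_sq _ _ (smoothSobolev_coe hO v _ h0 h1)
      (smoothSobolev_coe_succ hO v _ h0 h1)]
    refine (add_le_add (add_le_add a0 (a1 0)) (a1 1)).trans_eq ?_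
    exact ENNReal.add_thirds _
  rwa [closure_closure] at key

end TestFunctions

end AnisoTrace

namespace AnisoTrace

/-! ### One-dimensional estimates: increments and Hardy's inequality -/

section TraceInequality

theorem enorm_sub_le_lintegral_deriv {φ φ' : ℝ → ℂ} (h : ∀ t, HasDerivAt φ (φ' t) t)
    (hc : Continuous φ') {t : ℝ} (ht : 0 ≤ t) :
    ‖φ t - φ 0‖ₑ ≤ ∫⁻ τ in Ioo 0 t, ‖φ' τ‖ₑ := by
  rw [← intervalIntegral.integral_eq_sub_of_hasDerivAt (fun x _ => h x)
    (hc.intervalIntegrable 0 t), intervalIntegral.integral_of_le ht,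
    integral_Ioc_eq_integral_Ioo]
  exact enorm_integral_le_lintegral_enorm _

theorem enorm_sub_sq_le {φ φ' : ℝ → ℂ} (h : ∀ t, HasDerivAt φ (φ' t) t)
    (hc : Continuous φ') {t : ℝ} (ht : 0 ≤ t) :
    ‖φ t - φ 0‖ₑ ^ 2 ≤ ENNReal.ofReal t * ∫⁻ τ in Ioo 0 t, ‖φ' τ‖ₑ ^ 2 := by
  refine (pow_le_pow_left' (enorm_sub_le_lintegral_deriv h hc ht) 2).trans ?_
  refine (lintegral_sq_le hc.measurable.enorm.aemeasurable).trans_eq ?_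
  simp

theorem lintegral_rpow_neg_half {t : ℝ} (ht : 0 ≤ t) :
    ∫⁻ τ in Ioo 0 t, ENNReal.ofReal (τ ^ (-(1 / 2) : ℝ)) = ENNReal.ofReal (2 * t ^ (1 / 2 : ℝ)) := by
  have hi : IntervalIntegrable (fun x : ℝ => x ^ (-(1 / 2) : ℝ)) volume 0 t :=
    intervalIntegral.intervalIntegrable_rpow' (by norm_num)
  rw [intervalIntegrable_iff_integrableOn_Ioo_of_le ht] at hi
  rw [← ofReal_integral_eq_lintegral_ofReal hi]
  · congr 1
    rw [← integral_Ioc_eq_integral_Ioo, ← intervalIntegral.integral_of_le ht,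
      integral_rpow (Or.inl (by norm_num))]
    norm_num
    ring
  · filter_upwards [ae_restrict_mem measurableSet_Ioo] with x hx
    exact Real.rpow_nonneg hx.1.le _

theorem lintegral_Ioi_rpow {τ : ℝ} (hτ : 0 < τ) {p : ℝ} (hp : 1 < p) :
    ∫⁻ t in Ioi τ, ENNReal.ofReal (t ^ (-p)) = ENNReal.ofReal (τ ^ (1 - p) / (p - 1)) := by
  rw [← ofReal_integral_eq_lintegral_ofReal (integrableOn_Ioi_rpow_of_lt (by linarith) hτ)]
  · congr 1
    rw [integral_Ioi_rpow_of_lt (by linarith) hτ, ← neg_div_neg_eq, neg_neg]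
    congr 1 <;> ring_nf
  · filter_upwards [ae_restrict_mem measurableSet_Ioi] with x hx
    exact Real.rpow_nonneg (hτ.trans hx).le _

/-- Hardy's inequality. -/
theorem lintegral_hardy {φ φ' : ℝ → ℂ} (h : ∀ t, HasDerivAt φ (φ' t) t)
    (hc : Continuous φ') (δ : ℝ) :
    ∫⁻ t in Ioo 0 δ, ENNReal.ofReal (t ^ (-2 : ℝ)) * ‖φ t - φ 0‖ₑ ^ 2
      ≤ 4 * ∫⁻ τ in Ioo 0 δ, ‖φ' τ‖ₑ ^ 2 := by
  have hm : Measurable fun τ => ENNReal.ofReal (τ ^ (1 / 2 : ℝ)) * ‖φ' τ‖ₑ ^ 2 :=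
    (by fun_prop : Measurable fun τ : ℝ => ENNReal.ofReal (τ ^ (1 / 2 : ℝ))).mul
      (hc.measurable.enorm.pow_const 2)
  -- The derivative is written as τ^{-1/2} · (τ^{1/2} φ'), and Cauchy-Schwarz with kernel τ^{-1/2}
  -- yields the factor 2 t^{1/2}; with t^{-2} this makes 2 t^{-3/2}. The indicator encodes τ < t on
  -- a fixed domain, ready for Fubini.
  have h1 : ∀ t ∈ Ioo (0 : ℝ) δ, ENNReal.ofReal (t ^ (-2 : ℝ)) * ‖φ t - φ 0‖ₑ ^ 2
      ≤ ∫⁻ τ in Ioo 0 δ, (Ioi τ).indicator (fun t => ENNReal.ofReal (2 * t ^ (-(3 / 2) : ℝ))) t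
          * (ENNReal.ofReal (τ ^ (1 / 2 : ℝ)) * ‖φ' τ‖ₑ ^ 2) := by
    intro t ht
    have e1 : ‖φ t - φ 0‖ₑ ≤ ∫⁻ τ in Ioo 0 t, ENNReal.ofReal (τ ^ (-(1 / 2) : ℝ))
        * (ENNReal.ofReal (τ ^ (1 / 2 : ℝ)) * ‖φ' τ‖ₑ) := by
      refine (enorm_sub_le_lintegral_deriv h hc ht.1.le).trans_eq ?_
      refine setLIntegral_congr_fun measurableSet_Ioo fun τ hτ => ?_
      rw [← mul_assoc, ← ENNReal.ofReal_mul (Real.rpow_nonneg hτ.1.le _),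
        ← Real.rpow_add hτ.1]
      norm_num
    have e2 := lintegral_kernel_sq_le (μ := volume.restrict (Ioo 0 t))
      (k := fun τ => ENNReal.ofReal (τ ^ (-(1 / 2) : ℝ)))
      (f := fun τ => ENNReal.ofReal (τ ^ (1 / 2 : ℝ)) * ‖φ' τ‖ₑ)
      (by fun_prop) (by have := hc.measurable; fun_prop)
    have e3 : ∫⁻ τ in Ioo 0 t, ENNReal.ofReal (τ ^ (-(1 / 2) : ℝ))
        * (ENNReal.ofReal (τ ^ (1 / 2 : ℝ)) * ‖φ' τ‖ₑ) ^ 2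
        = ∫⁻ τ in Ioo 0 t, ENNReal.ofReal (τ ^ (1 / 2 : ℝ)) * ‖φ' τ‖ₑ ^ 2 := by
      refine setLIntegral_congr_fun measurableSet_Ioo fun τ hτ => ?_
      rw [mul_pow, ← mul_assoc, ← ENNReal.ofReal_pow (Real.rpow_nonneg hτ.1.le _),
        ← ENNReal.ofReal_mul (Real.rpow_nonneg hτ.1.le _), ← Real.rpow_natCast,
        ← Real.rpow_mul hτ.1.le, ← Real.rpow_add hτ.1]
      norm_num
    rw [e3, lintegral_rpow_neg_half ht.1.le] at e2
    calc _ ≤ ENNReal.ofReal (t ^ (-2 : ℝ)) * (ENNReal.ofReal (2 * t ^ (1 / 2 : ℝ))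
          * ∫⁻ τ in Ioo 0 t, ENNReal.ofReal (τ ^ (1 / 2 : ℝ)) * ‖φ' τ‖ₑ ^ 2) :=
          mul_le_mul_right ((pow_le_pow_left' e1 2).trans e2) _
      _ = ∫⁻ τ in Ioo 0 t, ENNReal.ofReal (2 * t ^ (-(3 / 2) : ℝ))
          * (ENNReal.ofReal (τ ^ (1 / 2 : ℝ)) * ‖φ' τ‖ₑ ^ 2) := by
          rw [lintegral_const_mul _ hm, ← mul_assoc,
            ← ENNReal.ofReal_mul (Real.rpow_nonneg ht.1.le _)]
          congr 2
          rw [mul_left_comm, ← Real.rpow_add ht.1]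
          norm_num
      _ = ∫⁻ τ in Ioo 0 t, (Ioi τ).indicator (fun t => ENNReal.ofReal (2 * t ^ (-(3 / 2) : ℝ))) t
          * (ENNReal.ofReal (τ ^ (1 / 2 : ℝ)) * ‖φ' τ‖ₑ ^ 2) := by
          refine setLIntegral_congr_fun measurableSet_Ioo fun τ hτ => ?_
          rw [indicator_of_mem (show t ∈ Ioi τ from hτ.2)]
      _ ≤ _ := lintegral_mono_set (Ioo_subset_Ioo_right ht.2.le)
  have hm2 : Measurable fun p : ℝ × ℝ =>
      (Ioi p.2).indicator (fun t => ENNReal.ofReal (2 * t ^ (-(3 / 2) : ℝ))) p.1 := by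
    have : (fun p : ℝ × ℝ =>
      (Ioi p.2).indicator (fun t => ENNReal.ofReal (2 * t ^ (-(3 / 2) : ℝ))) p.1)
      = {p : ℝ × ℝ | p.2 < p.1}.indicator
          fun p => ENNReal.ofReal (2 * p.1 ^ (-(3 / 2) : ℝ)) := by
      ext p
      simp [indicator_apply]
    rw [this]
    exact Measurable.indicator (by fun_prop) (measurableSet_lt measurable_snd measurable_fst)
  calc _ ≤ ∫⁻ t in Ioo 0 δ, ∫⁻ τ in Ioo 0 δ,
        (Ioi τ).indicator (fun t => ENNReal.ofReal (2 * t ^ (-(3 / 2) : ℝ))) t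
          * (ENNReal.ofReal (τ ^ (1 / 2 : ℝ)) * ‖φ' τ‖ₑ ^ 2) :=
        setLIntegral_mono_ae' measurableSet_Ioo (Eventually.of_forall h1)
    _ = ∫⁻ τ in Ioo 0 δ, ∫⁻ t in Ioo 0 δ,
        (Ioi τ).indicator (fun t => ENNReal.ofReal (2 * t ^ (-(3 / 2) : ℝ))) t
          * (ENNReal.ofReal (τ ^ (1 / 2 : ℝ)) * ‖φ' τ‖ₑ ^ 2) :=
        lintegral_lintegral_swap (hm2.mul (hm.comp measurable_snd)).aemeasurable
    _ ≤ ∫⁻ τ in Ioo 0 δ, 4 * ‖φ' τ‖ₑ ^ 2 := by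
        refine setLIntegral_mono_ae' measurableSet_Ioo (Eventually.of_forall fun τ hτ => ?_)
        have hmi : Measurable
            ((Ioi τ).indicator (fun t : ℝ => ENNReal.ofReal (2 * t ^ (-(3 / 2) : ℝ)))) :=
          Measurable.indicator (by fun_prop) measurableSet_Ioi
        rw [lintegral_mul_const _ hmi]
        -- Over (τ, ∞) the integral of 2 t^{-3/2} is 4 τ^{-1/2}, which cancels the weight τ^{1/2}
        -- and leaves the constant 4.
        have e4 : ∫⁻ t in Ioo 0 δ, (Ioi τ).indicator
            (fun t => ENNReal.ofReal (2 * t ^ (-(3 / 2) : ℝ))) t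
            ≤ ENNReal.ofReal (4 * τ ^ (-(1 / 2) : ℝ)) := by
          refine (setLIntegral_le_lintegral _ _).trans ?_
          rw [lintegral_indicator measurableSet_Ioi]
          simp only [ENNReal.ofReal_mul (zero_le_two : (0 : ℝ) ≤ 2)]
          rw [lintegral_const_mul _ (by fun_prop),
            lintegral_Ioi_rpow hτ.1 (by norm_num : (1 : ℝ) < 3 / 2),
            ← ENNReal.ofReal_mul (by norm_num)]
          refine le_of_eq (congrArg _ ?_)
          norm_num
          ring
        refine (mul_le_mul_left e4 _).trans_eq ?_
        rw [← mul_assoc, ← ENNReal.ofReal_mul (by have := Real.rpow_nonneg hτ.1.le (-(1/2) : ℝ); positivity),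
          mul_assoc 4, ← Real.rpow_add hτ.1]
        norm_num
    _ = _ := lintegral_const_mul _ (hc.measurable.enorm.pow_const 2)

end TraceInequality

end AnisoTrace

namespace AnisoTrace

/-! ### The trace inequality for C¹ functions -/

section TraceInequality

theorem setLIntegral_prod_real (s t : Set ℝ) {F : ℝ × ℝ → ℝ≥0∞} (hF : Measurable F) :
    ∫⁻ p in s ×ˢ t, F p = ∫⁻ x in s, ∫⁻ y in t, F (x, y) := by
  change ∫⁻ p, F p ∂((volume : Measure ℝ).prod volume).restrict (s ×ˢ t) = _
  rw [← Measure.prod_restrict, lintegral_prod _ hF.aemeasurable]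

theorem setLIntegral_prod_real_symm (s t : Set ℝ) {F : ℝ × ℝ → ℝ≥0∞} (hF : Measurable F) :
    ∫⁻ p in s ×ˢ t, F p = ∫⁻ y in t, ∫⁻ x in s, F (x, y) := by
  rw [setLIntegral_prod_real s t hF]
  exact lintegral_lintegral_swap hF.aemeasurable

theorem hasDerivAt_slice_fst {f : ℝ × ℝ → ℂ} (hf : ContDiff ℝ 1 f) (z t : ℝ) :
    HasDerivAt (fun t => f (t, z)) (fderiv ℝ f (t, z) (1, 0)) t := by
  have h1 : HasDerivAt (fun t : ℝ => (t, z)) (1, 0) t :=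
    (hasDerivAt_id t).prodMk (hasDerivAt_const t z)
  exact (hf.differentiable (by simp) (t, z)).hasFDerivAt.comp_hasDerivAt t h1

theorem hasDerivAt_slice_snd {f : ℝ × ℝ → ℂ} (hf : ContDiff ℝ 1 f) (x z t : ℝ) :
    HasDerivAt (fun t => f (x, z + t)) (fderiv ℝ f (x, z + t) (0, 1)) t := by
  have h1 : HasDerivAt (fun t : ℝ => (x, z + t)) (0, 1) t :=
    (hasDerivAt_const t x).prodMk ((hasDerivAt_id t).const_add z)
  exact (hf.differentiable (by simp) (x, z + t)).hasFDerivAt.comp_hasDerivAt t h1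

theorem continuous_fderiv_dir {f : ℝ × ℝ → ℂ} (hf : ContDiff ℝ 1 f) (v : ℝ × ℝ) :
    Continuous fun p => fderiv ℝ f p v :=
  (hf.continuous_fderiv (by simp)).clm_apply continuous_const

/-- On each line of fixed z, the increment from 0 to t < h has square at most h times the integral
of |∂ₓ f|²; integrating over t gives the second factor h. -/
theorem lintegral_sub_trace_le {f : ℝ × ℝ → ℂ} (hf : ContDiff ℝ 1 f) (J : Set ℝ) (h : ℝ) :
    ∫⁻ p in Ioo 0 h ×ˢ J, ‖f p - f (0, p.2)‖ₑ ^ 2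
      ≤ ENNReal.ofReal h ^ 2 * ∫⁻ p in Ioo 0 h ×ˢ J, ‖fderiv ℝ f p (1, 0)‖ₑ ^ 2 := by
  have hc := hf.continuous
  have hd := continuous_fderiv_dir hf (1, 0)
  have m1 : Measurable fun p : ℝ × ℝ => ‖f p - f (0, p.2)‖ₑ ^ 2 :=
    Continuous.measurable (by fun_prop)
  have m2 : Measurable fun p : ℝ × ℝ => ‖fderiv ℝ f p (1, 0)‖ₑ ^ 2 :=
    hd.measurable.enorm.pow_const 2
  rw [setLIntegral_prod_real_symm _ _ m1, setLIntegral_prod_real_symm _ _ m2,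
    ← lintegral_const_mul _ m2.lintegral_prod_left']
  refine lintegral_mono fun z => ?_
  calc _ ≤ ∫⁻ _ in Ioo 0 h, ENNReal.ofReal h *
        ∫⁻ τ in Ioo 0 h, ‖fderiv ℝ f (τ, z) (1, 0)‖ₑ ^ 2 := by
        refine setLIntegral_mono_ae' measurableSet_Ioo (Eventually.of_forall fun t ht => ?_)
        refine (enorm_sub_sq_le (φ := fun t => f (t, z)) (hasDerivAt_slice_fst hf z)
          (hd.comp (by fun_prop)) ht.1.le).trans ?_
        exact mul_le_mul' (ENNReal.ofReal_le_ofReal ht.2.le)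
          (lintegral_mono_set (Ioo_subset_Ioo_right ht.2.le))
    _ = _ := by
        rw [setLIntegral_const, Real.volume_Ioo, sub_zero, mul_comm, ← mul_assoc, ← sq]

/-- The boundary value, constant in x, is compared with f over a strip of width δ. -/
theorem lintegral_trace_sq_le {f : ℝ × ℝ → ℂ} (hf : ContDiff ℝ 1 f) (J : Set ℝ) (δ : ℝ) :
    ENNReal.ofReal δ * ∫⁻ z in J, ‖f (0, z)‖ₑ ^ 2
      ≤ 2 * (∫⁻ p in Ioo 0 δ ×ˢ J, ‖f p‖ₑ ^ 2)
        + 2 * (ENNReal.ofReal δ ^ 2 * ∫⁻ p in Ioo 0 δ ×ˢ J, ‖fderiv ℝ f p (1, 0)‖ₑ ^ 2) := by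
  have hc := hf.continuous
  have m1 : Measurable fun p : ℝ × ℝ => ‖f p - f (0, p.2)‖ₑ ^ 2 :=
    Continuous.measurable (by fun_prop)
  have m2 : Measurable fun p : ℝ × ℝ => ‖f p‖ₑ ^ 2 := Continuous.measurable (by fun_prop)
  have m3 : Measurable fun p : ℝ × ℝ => ‖f (0, p.2)‖ₑ ^ 2 := Continuous.measurable (by fun_prop)
  calc _ = ∫⁻ p in Ioo 0 δ ×ˢ J, ‖f (0, p.2)‖ₑ ^ 2 := by
        rw [setLIntegral_prod_real _ _ m3]
        simp [mul_comm]
    _ ≤ ∫⁻ p in Ioo 0 δ ×ˢ J, (2 * ‖f p‖ₑ ^ 2 + 2 * ‖f p - f (0, p.2)‖ₑ ^ 2) := by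
        refine lintegral_mono fun p => ?_
        have e : f (0, p.2) = f p + -(f p - f (0, p.2)) := by ring
        change ‖f (0, p.2)‖ₑ ^ 2 ≤ _
        conv_lhs => rw [e]
        refine (enorm_add_sq_le _ _).trans_eq ?_
        rw [enorm_neg]
    _ = 2 * (∫⁻ p in Ioo 0 δ ×ˢ J, ‖f p‖ₑ ^ 2)
          + 2 * ∫⁻ p in Ioo 0 δ ×ˢ J, ‖f p - f (0, p.2)‖ₑ ^ 2 := by
        rw [lintegral_add_left (m2.const_mul 2), lintegral_const_mul _ m2,
          lintegral_const_mul _ m1]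
    _ ≤ _ := by gcongr; exact lintegral_sub_trace_le hf J δ

theorem setLIntegral_shift_le {J : Set ℝ} (hJ : MeasurableSet J) (t : ℝ) (F : ℝ → ℝ≥0∞)
    {S : Set ℝ} (hS : MeasurableSet S) (hSJ : ∀ z ∈ S, z + t ∈ J) :
    ∫⁻ z in S, F (z + t) ≤ ∫⁻ z in J, F z := by
  rw [← lintegral_indicator hS, ← lintegral_indicator hJ,
    ← lintegral_add_right_eq_self (J.indicator F) t]
  refine lintegral_mono fun z => ?_
  by_cases hz : z ∈ S
  · rw [indicator_of_mem hz, indicator_of_mem (hSJ z hz)]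
  · rw [indicator_of_notMem hz]; exact zero_le

/-- The points of `J` which stay in `J` after a shift by `t`. -/
def shiftSet (J : Set ℝ) (t : ℝ) : Set ℝ := {z | z ∈ J ∧ z + t ∈ J}

theorem measurableSet_shiftSet {J : Set ℝ} (hJ : MeasurableSet J) (t : ℝ) :
    MeasurableSet (shiftSet J t) :=
  hJ.inter (measurable_add_const t hJ)

/-- The boundary points z and z + t are joined by the path that goes into the strip to height t,
along it by t, and back. Hardy's inequality controls the two vertical sides against the weight
t^{-2}. Along the horizontal side, two factors t come from Cauchy-Schwarz and from the length of the
path, and they cancel the weight. -/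
theorem lintegral_trace_near_le {f : ℝ × ℝ → ℂ} (hf : ContDiff ℝ 1 f) {J : Set ℝ}
    (hJ : MeasurableSet J) (hJ' : J.OrdConnected) (δ : ℝ) :
    ∫⁻ t in Ioo 0 δ, ∫⁻ z in shiftSet J t,
        ENNReal.ofReal (t ^ (-2 : ℝ)) * ‖f (0, z + t) - f (0, z)‖ₑ ^ 2
      ≤ 32 * ((∫⁻ p in Ioo 0 δ ×ˢ J, ‖fderiv ℝ f p (1, 0)‖ₑ ^ 2)
        + ∫⁻ p in Ioo 0 δ ×ˢ J, ‖fderiv ℝ f p (0, 1)‖ₑ ^ 2) := by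
  have hc := hf.continuous
  have hd := continuous_fderiv_dir hf (1, 0)
  have hd' := continuous_fderiv_dir hf (0, 1)
  set A := ∫⁻ p in Ioo 0 δ ×ˢ J, ‖fderiv ℝ f p (1, 0)‖ₑ ^ 2 with hA
  set B := ∫⁻ p in Ioo 0 δ ×ˢ J, ‖fderiv ℝ f p (0, 1)‖ₑ ^ 2 with hB
  have mA : Measurable fun p : ℝ × ℝ => ‖fderiv ℝ f p (1, 0)‖ₑ ^ 2 :=
    hd.measurable.enorm.pow_const 2
  have mB : Measurable fun p : ℝ × ℝ => ‖fderiv ℝ f p (0, 1)‖ₑ ^ 2 :=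
    hd'.measurable.enorm.pow_const 2
  have mH : Measurable fun p : ℝ × ℝ =>
      ENNReal.ofReal (p.1 ^ (-2 : ℝ)) * ‖f (p.1, p.2) - f (0, p.2)‖ₑ ^ 2 :=
    (by fun_prop : Measurable fun p : ℝ × ℝ => ENNReal.ofReal (p.1 ^ (-2 : ℝ))).mul
      (Continuous.measurable (by fun_prop))
  have hardy : ∫⁻ t in Ioo 0 δ, ∫⁻ z in J,
      ENNReal.ofReal (t ^ (-2 : ℝ)) * ‖f (t, z) - f (0, z)‖ₑ ^ 2 ≤ 4 * A := by
    rw [hA, setLIntegral_prod_real_symm _ _ mA, ← lintegral_const_mul _ mA.lintegral_prod_left',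
      lintegral_lintegral_swap mH.aemeasurable]
    refine lintegral_mono fun z => ?_
    exact lintegral_hardy (φ := fun t => f (t, z)) (hasDerivAt_slice_fst hf z)
      (hd.comp (by fun_prop)) δ
  -- The horizontal side. The intermediate points z + r stay in J because J is an interval
  -- containing both ends.
  have mid : ∀ t ∈ Ioo 0 δ, ∫⁻ z in shiftSet J t,
      ENNReal.ofReal (t ^ (-2 : ℝ)) * ‖f (t, z + t) - f (t, z)‖ₑ ^ 2
        ≤ ∫⁻ z in J, ‖fderiv ℝ f (t, z) (0, 1)‖ₑ ^ 2 := by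
    intro t ht
    have hS := measurableSet_shiftSet hJ t
    calc _ ≤ ∫⁻ z in shiftSet J t, ENNReal.ofReal (t ^ (-2 : ℝ)) * (ENNReal.ofReal t *
          ∫⁻ r in Ioo 0 t, ‖fderiv ℝ f (t, z + r) (0, 1)‖ₑ ^ 2) := by
          refine lintegral_mono fun z => mul_le_mul_right ?_ _
          have := enorm_sub_sq_le (φ := fun r => f (t, z + r)) (hasDerivAt_slice_snd hf t z)
            (hd'.comp (by fun_prop)) ht.1.le
          simpa using this
      _ = ENNReal.ofReal (t ^ (-1 : ℝ)) * ∫⁻ r in Ioo 0 t, ∫⁻ z in shiftSet J t,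
            ‖fderiv ℝ f (t, z + r) (0, 1)‖ₑ ^ 2 := by
          have m4 : Measurable fun p : ℝ × ℝ => ‖fderiv ℝ f (t, p.1 + p.2) (0, 1)‖ₑ ^ 2 :=
            mB.comp (by fun_prop)
          simp only [← mul_assoc, ← ENNReal.ofReal_mul (Real.rpow_nonneg ht.1.le _)]
          rw [lintegral_const_mul _ m4.lintegral_prod_right',
            lintegral_lintegral_swap m4.aemeasurable]
          congr 2
          conv_lhs => rw [← Real.rpow_one t, ← Real.rpow_mul ht.1.le, ← Real.rpow_add ht.1]
          norm_num
      _ ≤ ENNReal.ofReal (t ^ (-1 : ℝ)) * ∫⁻ r in Ioo 0 t, ∫⁻ z in J,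
            ‖fderiv ℝ f (t, z) (0, 1)‖ₑ ^ 2 := by
          refine mul_le_mul_right (setLIntegral_mono_ae' measurableSet_Ioo
            (Eventually.of_forall fun r hr => ?_)) _
          refine setLIntegral_shift_le hJ r (fun z => ‖fderiv ℝ f (t, z) (0, 1)‖ₑ ^ 2) hS ?_
          intro z hz
          exact hJ'.out hz.1 hz.2 ⟨by linarith [hr.1], by linarith [hr.2]⟩
      _ = _ := by
          rw [setLIntegral_const, Real.volume_Ioo, sub_zero, mul_comm _ (ENNReal.ofReal t),
            ← mul_assoc, ← ENNReal.ofReal_mul (Real.rpow_nonneg ht.1.le _), Real.rpow_neg_one,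
            inv_mul_cancel₀ ht.1.ne', ENNReal.ofReal_one, one_mul]
  have hB2 : B = ∫⁻ t in Ioo 0 δ, ∫⁻ z in J, ‖fderiv ℝ f (t, z) (0, 1)‖ₑ ^ 2 :=
    setLIntegral_prod_real _ _ mB
  -- Splitting a sum of three terms costs a factor 4 on each. The two vertical sides have the same
  -- bound after a shift of z, whence 8.
  have point : ∀ t ∈ Ioo 0 δ, ∫⁻ z in shiftSet J t,
      ENNReal.ofReal (t ^ (-2 : ℝ)) * ‖f (0, z + t) - f (0, z)‖ₑ ^ 2
      ≤ 8 * (∫⁻ z in J, ENNReal.ofReal (t ^ (-2 : ℝ)) * ‖f (t, z) - f (0, z)‖ₑ ^ 2)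
        + 4 * ∫⁻ z in J, ‖fderiv ℝ f (t, z) (0, 1)‖ₑ ^ 2 := by
    intro t ht
    have hS := measurableSet_shiftSet hJ t
    set κ := ENNReal.ofReal (t ^ (-2 : ℝ)) with hκ
    have n1 : Measurable fun z => κ * ‖f (t, z) - f (0, z)‖ₑ ^ 2 :=
      (Continuous.measurable (by fun_prop) : Measurable fun z : ℝ =>
        ‖f (t, z) - f (0, z)‖ₑ ^ 2).const_mul _
    have n2 : Measurable fun z => κ * ‖f (t, z + t) - f (t, z)‖ₑ ^ 2 :=
      (Continuous.measurable (by fun_prop) : Measurable fun z : ℝ =>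
        ‖f (t, z + t) - f (t, z)‖ₑ ^ 2).const_mul _
    have n3 : Measurable fun z => κ * ‖f (t, z + t) - f (0, z + t)‖ₑ ^ 2 :=
      (Continuous.measurable (by fun_prop) : Measurable fun z : ℝ =>
        ‖f (t, z + t) - f (0, z + t)‖ₑ ^ 2).const_mul _
    calc _ ≤ ∫⁻ z in shiftSet J t, (4 * (κ * ‖f (t, z) - f (0, z)‖ₑ ^ 2)
          + 4 * (κ * ‖f (t, z + t) - f (t, z)‖ₑ ^ 2))
          + 4 * (κ * ‖f (t, z + t) - f (0, z + t)‖ₑ ^ 2) := by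
          refine lintegral_mono fun z => ?_
          have e : f (0, z + t) - f (0, z) = ((f (t, z) - f (0, z)) + (f (t, z + t) - f (t, z)))
            + -(f (t, z + t) - f (0, z + t)) := by ring
          simp only [e]
          have h1 := enorm_add_sq_le ((f (t, z) - f (0, z)) + (f (t, z + t) - f (t, z)))
            (-(f (t, z + t) - f (0, z + t)))
          have h2 := enorm_add_sq_le (f (t, z) - f (0, z)) (f (t, z + t) - f (t, z))
          rw [enorm_neg] at h1
          have h3 := h1.trans (add_le_add (mul_le_mul_right h2 2) (by
            gcongr; norm_num : 2 * ‖f (t, z + t) - f (0, z + t)‖ₑ ^ 2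
              ≤ 4 * ‖f (t, z + t) - f (0, z + t)‖ₑ ^ 2))
          refine (mul_le_mul_right h3 κ).trans_eq ?_
          ring
      _ = 4 * (∫⁻ z in shiftSet J t, κ * ‖f (t, z) - f (0, z)‖ₑ ^ 2)
          + 4 * (∫⁻ z in shiftSet J t, κ * ‖f (t, z + t) - f (t, z)‖ₑ ^ 2)
          + 4 * ∫⁻ z in shiftSet J t, κ * ‖f (t, z + t) - f (0, z + t)‖ₑ ^ 2 := by
          rw [lintegral_add_right _ (n3.const_mul _), lintegral_add_right _ (n2.const_mul _),
            lintegral_const_mul _ n1, lintegral_const_mul _ n2, lintegral_const_mul _ n3]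
      _ ≤ 4 * (∫⁻ z in J, κ * ‖f (t, z) - f (0, z)‖ₑ ^ 2)
          + 4 * (∫⁻ z in J, ‖fderiv ℝ f (t, z) (0, 1)‖ₑ ^ 2)
          + 4 * ∫⁻ z in J, κ * ‖f (t, z) - f (0, z)‖ₑ ^ 2 := by
          refine add_le_add (add_le_add ?_ ?_) ?_
          · exact mul_le_mul_right (lintegral_mono_set fun z hz => hz.1) _
          · exact mul_le_mul_right (mid t ht) _
          · exact mul_le_mul_right (setLIntegral_shift_le hJ t
              (fun z => κ * ‖f (t, z) - f (0, z)‖ₑ ^ 2) hS fun z hz => hz.2) _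
      _ = _ := by ring
  calc _ ≤ ∫⁻ t in Ioo 0 δ, (8 * (∫⁻ z in J, ENNReal.ofReal (t ^ (-2 : ℝ))
            * ‖f (t, z) - f (0, z)‖ₑ ^ 2)
          + 4 * ∫⁻ z in J, ‖fderiv ℝ f (t, z) (0, 1)‖ₑ ^ 2) :=
        setLIntegral_mono_ae' measurableSet_Ioo (Eventually.of_forall point)
    _ = 8 * (∫⁻ t in Ioo 0 δ, ∫⁻ z in J, ENNReal.ofReal (t ^ (-2 : ℝ))
            * ‖f (t, z) - f (0, z)‖ₑ ^ 2) + 4 * B := by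
        have p1 : Measurable fun t => ∫⁻ z in J, ENNReal.ofReal (t ^ (-2 : ℝ))
            * ‖f (t, z) - f (0, z)‖ₑ ^ 2 := mH.lintegral_prod_right'
        have p2 : Measurable fun t => ∫⁻ z in J, ‖fderiv ℝ f (t, z) (0, 1)‖ₑ ^ 2 :=
          mB.lintegral_prod_right'
        rw [lintegral_add_right _ (p2.const_mul _), lintegral_const_mul _ p1,
          lintegral_const_mul _ p2, ← hB2]
    _ ≤ 8 * (4 * A) + 4 * B := by gcongr
    _ ≤ 32 * A + 32 * B := by
        rw [← mul_assoc]
        norm_num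
        gcongr
        norm_num
    _ = 32 * (A + B) := (mul_add _ _ _).symm

/-- For shifts t ≥ δ no cancellation is needed: the squared difference integrates to at most four
times the squared L² norm, and the integral of t^{-2} over (δ, ∞) is 1/δ. -/
theorem lintegral_trace_far_le {g : ℝ → ℂ} (hg : Continuous g) {J : Set ℝ}
    (hJ : MeasurableSet J) {δ : ℝ} (hδ : 0 < δ) :
    ∫⁻ t in Ici δ, ∫⁻ z in shiftSet J t, ENNReal.ofReal (t ^ (-2 : ℝ)) * ‖g (z + t) - g z‖ₑ ^ 2
      ≤ ENNReal.ofReal (4 / δ) * ∫⁻ z in J, ‖g z‖ₑ ^ 2 := by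
  set G := ∫⁻ z in J, ‖g z‖ₑ ^ 2 with hG
  have mg : Measurable fun z => ‖g z‖ₑ ^ 2 := hg.measurable.enorm.pow_const 2
  have h1 : ∀ t, ∫⁻ z in shiftSet J t, ENNReal.ofReal (t ^ (-2 : ℝ)) * ‖g (z + t) - g z‖ₑ ^ 2
      ≤ ENNReal.ofReal (t ^ (-2 : ℝ)) * (4 * G) := by
    intro t
    have m1 : Measurable fun z => ‖g (z + t) - g z‖ₑ ^ 2 := Continuous.measurable (by fun_prop)
    have m2 : Measurable fun z => ‖g (z + t)‖ₑ ^ 2 := Continuous.measurable (by fun_prop)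
    rw [lintegral_const_mul _ m1]
    refine mul_le_mul_right ?_ _
    calc _ ≤ ∫⁻ z in shiftSet J t, 2 * ‖g (z + t)‖ₑ ^ 2 + 2 * ‖g z‖ₑ ^ 2 := by
          refine lintegral_mono fun z => ?_
          simp only [sub_eq_add_neg]
          refine (enorm_add_sq_le _ _).trans_eq ?_
          rw [enorm_neg]
      _ = 2 * (∫⁻ z in shiftSet J t, ‖g (z + t)‖ₑ ^ 2) + 2 * ∫⁻ z in shiftSet J t, ‖g z‖ₑ ^ 2 := by
          rw [lintegral_add_right _ (mg.const_mul _), lintegral_const_mul _ m2,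
            lintegral_const_mul _ mg]
      _ ≤ 2 * G + 2 * G := by
          gcongr
          · exact setLIntegral_shift_le hJ t (fun z => ‖g z‖ₑ ^ 2)
              (measurableSet_shiftSet hJ t) fun z hz => hz.2
          · exact lintegral_mono_set fun z hz => hz.1
      _ = 4 * G := by ring
  refine (lintegral_mono h1).trans ?_
  rw [lintegral_mul_const _ (by fun_prop), setLIntegral_congr Ioi_ae_eq_Ici.symm,
    lintegral_Ioi_rpow hδ (by norm_num), ← mul_assoc]
  refine mul_le_mul_left (le_of_eq ?_) _
  rw [show (4 : ℝ≥0∞) = ENNReal.ofReal 4 by norm_num, ← ENNReal.ofReal_mul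
    (div_nonneg (Real.rpow_nonneg hδ.le _) (by norm_num))]
  congr 1
  norm_num [Real.rpow_neg_one]
  field_simp

open Classical in
/-- The Slobodeckij kernel in terms of shifts. -/
theorem lintegral_slobodeckij_le {g : ℝ → ℂ} (hg : Continuous g) {J : Set ℝ}
    (hJ : MeasurableSet J) {δ : ℝ} (hδ : 0 < δ) :
    ∫⁻ p in J ×ˢ J, ‖(g p.1 - g p.2) / ((p.1 - p.2 : ℝ) : ℂ)‖ₑ ^ 2
      ≤ 2 * ((∫⁻ t in Ioo 0 δ, ∫⁻ z in shiftSet J t,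
          ENNReal.ofReal (t ^ (-2 : ℝ)) * ‖g (z + t) - g z‖ₑ ^ 2)
        + ∫⁻ t in Ici δ, ∫⁻ z in shiftSet J t,
          ENNReal.ofReal (t ^ (-2 : ℝ)) * ‖g (z + t) - g z‖ₑ ^ 2) := by
  set k : ℝ × ℝ → ℝ≥0∞ := fun p => ‖(g p.1 - g p.2) / ((p.1 - p.2 : ℝ) : ℂ)‖ₑ ^ 2 with hk
  have mk : Measurable k := by
    have := hg.measurable
    simp only [hk]; fun_prop
  have hsymm : ∀ p, k p.swap = k p := by
    intro p
    simp only [hk, Prod.fst_swap, Prod.snd_swap]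
    congr 2
    rw [← neg_div_neg_eq]
    push_cast
    ring
  have hkz : ∀ z t, 0 < t → k (z + t, z)
      = ENNReal.ofReal (t ^ (-2 : ℝ)) * ‖g (z + t) - g z‖ₑ ^ 2 := by
    intro z t ht
    simp only [hk, add_sub_cancel_left]
    rw [div_eq_inv_mul, enorm_mul, mul_pow]
    congr 1
    rw [← ofReal_norm, norm_inv, Complex.norm_real, Real.norm_of_nonneg ht.le,
      ← ENNReal.ofReal_pow (by positivity), Real.rpow_neg ht.le]
    norm_num
  set D : Set (ℝ × ℝ) := {p | p.2 < p.1} with hD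
  have mD : MeasurableSet D := measurableSet_lt measurable_snd measurable_fst
  -- By symmetry only the half p.2 < p.1 matters, whence the factor 2. On the diagonal the quotient
  -- is 0 / 0 = 0.
  have h1 : ∀ p, k p ≤ D.indicator k p + D.indicator k p.swap := by
    intro p
    rcases lt_trichotomy p.1 p.2 with h | h | h
    · have : p.swap ∈ D := h
      rw [indicator_of_mem this, hsymm]
      exact le_add_self
    · have : k p = 0 := by simp [hk, h]
      rw [this]; exact zero_le
    · have : p ∈ D := h
      rw [indicator_of_mem this]
      exact le_self_add
  have mDk : Measurable (D.indicator k) := mk.indicator mD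
  have h2 : ∫⁻ p in J ×ˢ J, k p ≤ 2 * ∫⁻ p in J ×ˢ J, D.indicator k p := by
    refine (lintegral_mono h1).trans ?_
    rw [lintegral_add_left mDk, two_mul]
    refine add_le_add le_rfl (le_of_eq ?_)
    rw [setLIntegral_prod_real J J (F := fun p => D.indicator k p.swap)
        (mDk.comp measurable_swap),
      setLIntegral_prod_real_symm _ _ mDk]
    rfl
  refine h2.trans (mul_le_mul_right ?_ _)
  rw [setLIntegral_prod_real_symm _ _ mDk]
  have mS : MeasurableSet {q : ℝ × ℝ | q.1 + q.2 ∈ J ∧ 0 < q.2} :=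
    (hJ.preimage (by fun_prop : Measurable fun q : ℝ × ℝ => q.1 + q.2)).inter
      (measurableSet_lt measurable_const measurable_snd)
  -- The kernel in the variables z and t = x - z, extended by zero so that the order of integration
  -- can be exchanged.
  set F : ℝ → ℝ → ℝ≥0∞ := fun z t =>
    {q : ℝ × ℝ | q.1 + q.2 ∈ J ∧ 0 < q.2}.indicator (fun q => k (q.1 + q.2, q.1)) (z, t) with hF
  have mF : Measurable (Function.uncurry F) :=
    Measurable.indicator (mk.comp (by fun_prop)) mS
  have h3 : ∀ z, ∫⁻ x in J, D.indicator k (x, z) = ∫⁻ t, F z t := by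
    intro z
    rw [← lintegral_indicator hJ, ← lintegral_add_left_eq_self _ z]
    refine lintegral_congr fun t => ?_
    simp only [hF, indicator_apply, hD, mem_ofPred_eq]
    by_cases a : z + t ∈ J <;> by_cases b : 0 < t <;> simp [a, b]
  simp only [h3]
  rw [lintegral_lintegral_swap mF.aemeasurable]
  have h4 : ∀ t, ∫⁻ z in J, F z t ≤ (Ioi 0).indicator (fun t => ∫⁻ z in shiftSet J t,
      ENNReal.ofReal (t ^ (-2 : ℝ)) * ‖g (z + t) - g z‖ₑ ^ 2) t := by
    intro t
    by_cases ht : 0 < t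
    · rw [indicator_of_mem (show t ∈ Ioi (0 : ℝ) from ht), ← lintegral_indicator hJ,
        ← lintegral_indicator (measurableSet_shiftSet hJ t)]
      refine lintegral_mono fun z => ?_
      simp only [hF, indicator_apply, shiftSet, mem_ofPred_eq, ht, and_true, hkz z t ht]
      by_cases a : z ∈ J <;> by_cases b : z + t ∈ J <;> simp [a, b]
    · simp [hF, ht]
  refine (lintegral_mono h4).trans ?_
  rw [lintegral_indicator measurableSet_Ioi, ← Ioo_union_Ici_eq_Ioi hδ]
  exact lintegral_union_le _ _ _

end TraceInequality

end AnisoTrace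

/-! ### Strips and the classical trace operator -/

namespace AnisoTrace

/-- `Ix × J` is a product of open intervals, with `{0} × J` in its closure. -/
structure IsStrip (Ix J : Set ℝ) : Prop where
  isOpen_left : IsOpen Ix
  ordConnected_left : Ix.OrdConnected
  zero_mem : (0 : ℝ) ∈ closure Ix
  isOpen_right : IsOpen J
  ordConnected_right : J.OrdConnected
  nonempty_right : J.Nonempty

namespace IsStrip

variable {Ix J : Set ℝ}

theorem isOpen_prod (h : IsStrip Ix J) : IsOpen (Ix ×ˢ J) := h.isOpen_left.prod h.isOpen_right

theorem convex_prod (h : IsStrip Ix J) : Convex ℝ (Ix ×ˢ J) :=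
  h.ordConnected_left.convex.prod h.ordConnected_right.convex

theorem nonempty_prod (h : IsStrip Ix J) : (Ix ×ˢ J).Nonempty :=
  (closure_nonempty_iff.1 ⟨0, h.zero_mem⟩).prod h.nonempty_right

/-- `Ix` contains an interval with end point `0`. -/
theorem exists_side (h : IsStrip Ix J) : ∃ σ δ : ℝ, (σ = 1 ∨ σ = -1) ∧ 0 < δ ∧
    ∀ t ∈ Ioo 0 δ, σ * t ∈ Ix := by
  -- The sign of a nonzero point y of the interval decides the side. Since 0 is in the closure, some
  -- point x of the interval has |x| < t, and σ t lies between x and y.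
  obtain ⟨y, hy, hy0⟩ : ∃ y ∈ Ix, y ≠ 0 := by
    obtain ⟨y, hy⟩ := closure_nonempty_iff.1 ⟨0, h.zero_mem⟩
    by_cases hy0 : y = 0
    · obtain ⟨r, hr, hball⟩ := Metric.isOpen_iff.1 h.isOpen_left y hy
      refine ⟨y + r / 2, hball ?_, by rw [hy0]; simpa using hr.ne'⟩
      rw [Metric.mem_ball, Real.dist_eq, add_sub_cancel_left, abs_of_pos (by positivity)]
      linarith
    · exact ⟨y, hy, hy0⟩
  rcases lt_or_gt_of_ne hy0 with hneg | hpos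
  · refine ⟨-1, -y, Or.inr rfl, by linarith, fun t ht => ?_⟩
    obtain ⟨x, hx, hxt⟩ := Metric.mem_closure_iff.1 h.zero_mem t ht.1
    rw [Real.dist_eq, zero_sub, abs_neg, abs_lt] at hxt
    exact h.ordConnected_left.out hy hx ⟨by linarith [ht.2], by linarith⟩
  · refine ⟨1, y, Or.inl rfl, hpos, fun t ht => ?_⟩
    obtain ⟨x, hx, hxt⟩ := Metric.mem_closure_iff.1 h.zero_mem t ht.1
    rw [Real.dist_eq, zero_sub, abs_neg, abs_lt] at hxt
    exact h.ordConnected_left.out hx hy ⟨by linarith, by linarith [ht.2]⟩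

end IsStrip

/-- The reflection x ↦ σ x lets estimates on (0, δ) serve whichever side of 0 the interval covers.
-/
theorem setLIntegral_flip_le {Ix J : Set ℝ} (hIx : MeasurableSet Ix) {σ δ : ℝ}
    (hσ : σ = 1 ∨ σ = -1) (hs : ∀ t ∈ Ioo 0 δ, σ * t ∈ Ix) {F : ℝ × ℝ → ℝ≥0∞}
    (hF : Measurable F) :
    ∫⁻ p in Ioo 0 δ ×ˢ J, F (σ * p.1, p.2) ≤ ∫⁻ p in Ix ×ˢ J, F p := by
  rw [setLIntegral_prod_real_symm (Ioo 0 δ) J (F := fun p => F (σ * p.1, p.2))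
    (hF.comp (by fun_prop)), setLIntegral_prod_real_symm _ _ hF]
  refine lintegral_mono fun z => ?_
  rw [← lintegral_indicator measurableSet_Ioo, ← lintegral_indicator hIx]
  have e : ∫⁻ x, Ix.indicator (fun x => F (x, z)) x
      = ∫⁻ x, Ix.indicator (fun x => F (x, z)) (σ * x) := by
    rcases hσ with rfl | rfl
    · simp
    · simp only [neg_one_mul]
      exact (lintegral_neg_eq_self _).symm
  rw [e]
  refine lintegral_mono fun t => ?_
  by_cases ht : t ∈ Ioo 0 δ
  · rw [indicator_of_mem ht, indicator_of_mem (hs t ht)]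
  · rw [indicator_of_notMem ht]; exact zero_le

theorem contDiff_flip {f : ℝ × ℝ → ℂ} (hf : ContDiff ℝ 1 f) (σ : ℝ) :
    ContDiff ℝ 1 fun p : ℝ × ℝ => f (σ * p.1, p.2) :=
  hf.comp (by fun_prop)

theorem fderiv_flip {f : ℝ × ℝ → ℂ} (hf : ContDiff ℝ 1 f) (σ : ℝ) (p v : ℝ × ℝ) :
    fderiv ℝ (fun p : ℝ × ℝ => f (σ * p.1, p.2)) p v = fderiv ℝ f (σ * p.1, p.2) (σ * v.1, v.2) := by
  have h1 : HasFDerivAt (fun p : ℝ × ℝ => (σ * p.1, p.2))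
      ((σ • ContinuousLinearMap.fst ℝ ℝ ℝ).prod (ContinuousLinearMap.snd ℝ ℝ ℝ)) p :=
    (hasFDerivAt_fst.const_mul σ).prodMk hasFDerivAt_snd
  have h2 := (hf.differentiable (by simp) (σ * p.1, p.2)).hasFDerivAt.comp p h1
  rw [HasFDerivAt.fderiv (f := fun p : ℝ × ℝ => f (σ * p.1, p.2)) h2]
  rfl

theorem enorm_fderiv_flip_fst {f : ℝ × ℝ → ℂ} (hf : ContDiff ℝ 1 f) {σ : ℝ}
    (hσ : σ = 1 ∨ σ = -1) (p : ℝ × ℝ) :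
    ‖fderiv ℝ (fun p : ℝ × ℝ => f (σ * p.1, p.2)) p (1, 0)‖ₑ
      = ‖fderiv ℝ f (σ * p.1, p.2) (1, 0)‖ₑ := by
  rw [fderiv_flip hf]
  rcases hσ with rfl | rfl
  · simp
  · have : ((-1 : ℝ) * (1 : ℝ), (0 : ℝ)) = -((1 : ℝ), (0 : ℝ)) := by ext <;> simp
    simp only [this, map_neg, enorm_neg]

theorem enorm_fderiv_flip_snd {f : ℝ × ℝ → ℂ} (hf : ContDiff ℝ 1 f) (σ : ℝ) (p : ℝ × ℝ) :
    ‖fderiv ℝ (fun p : ℝ × ℝ => f (σ * p.1, p.2)) p (0, 1)‖ₑ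
      = ‖fderiv ℝ f (σ * p.1, p.2) (0, 1)‖ₑ := by
  rw [fderiv_flip hf]
  simp

/-- The square of the `H¹` norm of a smooth function. -/
noncomputable def sobolevSq (O : Set (ℝ × ℝ)) (f : ℝ × ℝ → ℂ) : ℝ≥0∞ :=
  (∫⁻ p in O, ‖f p‖ₑ ^ 2) + (∫⁻ p in O, ‖fderiv ℝ f p (1, 0)‖ₑ ^ 2)
    + ∫⁻ p in O, ‖fderiv ℝ f p (0, 1)‖ₑ ^ 2

/-- The square of the `H^{1/2}` norm of a function. -/
noncomputable def slobodeckijSq (J : Set ℝ) (g : ℝ → ℂ) : ℝ≥0∞ :=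
  (∫⁻ z in J, ‖g z‖ₑ ^ 2) + ∫⁻ p in J ×ˢ J, ‖(g p.1 - g p.2) / ((p.1 - p.2 : ℝ) : ℂ)‖ₑ ^ 2

/-- The difference quotient is split at distance δ, the width of the strip available inside the
domain: near pairs are controlled by the gradient, far pairs by the L² norm of the trace, and this
norm in turn by the H¹ norm. -/
theorem exists_trace_inequality {Ix J : Set ℝ} (h : IsStrip Ix J) :
    ∃ K : ℝ≥0∞, K ≠ ⊤ ∧ ∀ f : ℝ × ℝ → ℂ, ContDiff ℝ 1 f →
      slobodeckijSq J (fun z => f (0, z)) ≤ K * sobolevSq (Ix ×ˢ J) f := by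
  obtain ⟨σ, δ, hσ, hδ, hs⟩ := h.exists_side
  set d := ENNReal.ofReal δ with hd
  have hd0 : d ≠ 0 := by simpa [hd] using hδ
  have hdt : d ≠ ⊤ := by simp [hd]
  set K₁ : ℝ≥0∞ := d⁻¹ * (2 + 2 * d ^ 2) with hK₁
  have hK₁t : K₁ ≠ ⊤ := by simp only [hK₁]; finiteness
  -- K₁ bounds the L² part, 32 the near pairs, 4 K₁ / δ the far pairs; the factor 2 is the symmetry
  -- of the kernel.
  refine ⟨K₁ + 2 * (32 + ENNReal.ofReal (4 / δ) * K₁), by finiteness, fun f hf => ?_⟩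
  set N := sobolevSq (Ix ×ˢ J) f with hN
  have hf' := contDiff_flip hf σ
  have hmJ := h.isOpen_right.measurableSet
  have flip : ∀ F : ℝ × ℝ → ℂ, Continuous F →
      ∫⁻ p in Ioo 0 δ ×ˢ J, ‖F (σ * p.1, p.2)‖ₑ ^ 2 ≤ ∫⁻ p in Ix ×ˢ J, ‖F p‖ₑ ^ 2 :=
    fun F hF => setLIntegral_flip_le h.isOpen_left.measurableSet hσ hs
      (F := fun p => ‖F p‖ₑ ^ 2) (hF.measurable.enorm.pow_const 2)
  have hN0 := flip f hf.continuous
  have hN1 := flip _ (continuous_fderiv_dir hf (1, 0))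
  have hN2 := flip _ (continuous_fderiv_dir hf (0, 1))
  have t1 := lintegral_trace_sq_le hf' J δ
  have t2 := lintegral_trace_near_le hf' hmJ h.ordConnected_right δ
  have t3 := lintegral_trace_far_le (g := fun z => f (0, z)) (hf.continuous.comp (by fun_prop))
    hmJ hδ
  have t4 := lintegral_slobodeckij_le (g := fun z => f (0, z)) (hf.continuous.comp (by fun_prop))
    hmJ hδ
  simp only [mul_zero, enorm_fderiv_flip_fst hf hσ, enorm_fderiv_flip_snd hf] at t1 t2
  have b1 : ∫⁻ z in J, ‖f (0, z)‖ₑ ^ 2 ≤ K₁ * N := by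
    have e : ∫⁻ z in J, ‖f (0, z)‖ₑ ^ 2 = d⁻¹ * (d * ∫⁻ z in J, ‖f (0, z)‖ₑ ^ 2) := by
      rw [← mul_assoc, ENNReal.inv_mul_cancel hd0 hdt, one_mul]
    rw [e, hK₁, mul_assoc]
    refine mul_le_mul_right (t1.trans ?_) _
    rw [add_mul, mul_assoc]
    refine add_le_add (mul_le_mul_right (hN0.trans ?_) _)
      (mul_le_mul_right (mul_le_mul_right (hN1.trans ?_) _) _)
    · exact le_self_add.trans le_self_add
    · exact le_add_self.trans le_self_add
  have b2 := t2.trans (mul_le_mul_right (add_le_add hN1 hN2) _)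
  have b3 : (∫⁻ p in Ix ×ˢ J, ‖fderiv ℝ f p (1, 0)‖ₑ ^ 2)
      + ∫⁻ p in Ix ×ˢ J, ‖fderiv ℝ f p (0, 1)‖ₑ ^ 2 ≤ N := by
    rw [hN, sobolevSq, add_assoc]; exact le_add_self
  calc _ ≤ K₁ * N + 2 * (32 * N + ENNReal.ofReal (4 / δ) * (K₁ * N)) := by
        refine add_le_add b1 (t4.trans (mul_le_mul_right (add_le_add
          (b2.trans (mul_le_mul_right b3 _)) (t3.trans (mul_le_mul_right b1 _))) _))
    _ = _ := by ring

/-- The element of `H^{1/2}(J)` given by a function. -/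
noncomputable def mkH12 {J : Set ℝ} (g : ℝ → ℂ) (hg : MemLp g 2 (volume.restrict J))
    (hk : MemLp (fun p : ℝ × ℝ => (g p.1 - g p.2) / ((p.1 - p.2 : ℝ) : ℂ)) 2
      (volume.restrict (J ×ˢ J))) : H12 J :=
  ⟨WithLp.toLp 2 (hg.toLp g, hk.toLp _), by
    have h1 : ∀ᵐ p ∂(volume.restrict (J ×ˢ J) : Measure (ℝ × ℝ)), hg.toLp g p.1 = g p.1 := by
      rw [restrict_prod_self]
      exact Measure.quasiMeasurePreserving_fst.ae hg.coeFn_toLp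
    have h2 : ∀ᵐ p ∂(volume.restrict (J ×ˢ J) : Measure (ℝ × ℝ)), hg.toLp g p.2 = g p.2 := by
      rw [restrict_prod_self]
      exact Measure.quasiMeasurePreserving_snd.ae hg.coeFn_toLp
    change (hk.toLp _ : ℝ × ℝ → ℂ) =ᵐ[_] fun p => (hg.toLp g p.1 - hg.toLp g p.2) / _
    filter_upwards [h1, h2, hk.coeFn_toLp] with p a b d
    rw [a, b, d]⟩

theorem enorm_mkH12_sq {J : Set ℝ} {g : ℝ → ℂ} (hg : MemLp g 2 (volume.restrict J))
    (hk : MemLp (fun p : ℝ × ℝ => (g p.1 - g p.2) / ((p.1 - p.2 : ℝ) : ℂ)) 2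
      (volume.restrict (J ×ˢ J))) : ‖mkH12 g hg hk‖ₑ ^ 2 = slobodeckijSq J g := by
  rw [enorm_H12_sq, slobodeckijSq]
  congr 1
  · refine lintegral_congr_ae ?_
    filter_upwards [hg.coeFn_toLp] with x hx
    rw [← hx]; rfl
  · refine lintegral_congr_ae ?_
    filter_upwards [hk.coeFn_toLp] with x hx
    rw [← hx]; rfl

theorem enorm_testToSobolev_sq {O : Set (ℝ × ℝ)} (hO : IsOpen O) (w : testFunctions (ℝ × ℝ)) :
    ‖testToSobolev hO ![((1 : ℝ), (0 : ℝ)), (0, 1)] w‖ₑ ^ 2 = sobolevSq O w := by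
  rw [enorm_dirSobolev_sq, sobolevSq]
  congr 1
  congr 1
  · refine lintegral_congr_ae ?_
    filter_upwards [testToSobolev_coe hO ![((1 : ℝ), (0 : ℝ)), (0, 1)] w] with x hx
    rw [hx]
  · refine lintegral_congr_ae ?_
    filter_upwards [testToSobolev_coe_succ hO ![((1 : ℝ), (0 : ℝ)), (0, 1)] w 0] with x hx
    have : fderiv ℝ (w : ℝ × ℝ → ℂ) x (1, 0) = _ := hx.symm
    rw [this]; rfl
  · refine lintegral_congr_ae ?_
    filter_upwards [testToSobolev_coe_succ hO ![((1 : ℝ), (0 : ℝ)), (0, 1)] w 1] with x hx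
    have : fderiv ℝ (w : ℝ × ℝ → ℂ) x (0, 1) = _ := hx.symm
    rw [this]; rfl

theorem slobodeckijSq_test_lt_top {Ix J : Set ℝ} (h : IsStrip Ix J) (w : testFunctions (ℝ × ℝ)) :
    slobodeckijSq J (fun z => (w : ℝ × ℝ → ℂ) (0, z)) < ⊤ := by
  obtain ⟨K, hK, hle⟩ := exists_trace_inequality h
  refine (hle w (w.2.1.of_le (by simp))).trans_lt (ENNReal.mul_lt_top hK.lt_top ?_)
  rw [← enorm_testToSobolev_sq h.isOpen_prod]
  finiteness

theorem memLp_slice {Ix J : Set ℝ} (h : IsStrip Ix J) (w : testFunctions (ℝ × ℝ)) :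
    MemLp (fun z => (w : ℝ × ℝ → ℂ) (0, z)) 2 (volume.restrict J) :=
  memLp_two_of_lintegral (w.2.1.continuous.comp (by fun_prop)).aestronglyMeasurable
    (le_self_add.trans_lt (slobodeckijSq_test_lt_top h w))

theorem memLp_slice_quotient {Ix J : Set ℝ} (h : IsStrip Ix J) (w : testFunctions (ℝ × ℝ)) :
    MemLp (fun p : ℝ × ℝ => ((w : ℝ × ℝ → ℂ) (0, p.1) - (w : ℝ × ℝ → ℂ) (0, p.2))
      / ((p.1 - p.2 : ℝ) : ℂ)) 2 (volume.restrict (J ×ˢ J)) := by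
  refine memLp_two_of_lintegral ?_ (le_add_self.trans_lt (slobodeckijSq_test_lt_top h w))
  have := w.2.1.continuous.measurable
  exact Measurable.aestronglyMeasurable (by fun_prop)

/-- The restriction `w ↦ w(0, ·)` from `C^∞_c(ℝ²)` to `H^{1/2}(J)`. -/
noncomputable def traceTest {Ix J : Set ℝ} (h : IsStrip Ix J) :
    testFunctions (ℝ × ℝ) →ₗ[ℂ] H12 J where
  toFun w := mkH12 (fun z => (w : ℝ × ℝ → ℂ) (0, z)) (memLp_slice h w) (memLp_slice_quotient h w)
  map_add' a b := H12_ext (MemLp.toLp_add (memLp_slice h a) (memLp_slice h b))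
  map_smul' k a := H12_ext (MemLp.toLp_const_smul k (memLp_slice h a))

theorem exists_norm_traceTest_le {Ix J : Set ℝ} (h : IsStrip Ix J) :
    ∃ C, ∀ w, ‖traceTest h w‖
      ≤ C * ‖testToSobolev h.isOpen_prod ![((1 : ℝ), (0 : ℝ)), (0, 1)] w‖ := by
  obtain ⟨K, hK, hle⟩ := exists_trace_inequality h
  refine ⟨√K.toReal, fun w => ?_⟩
  have h1 := hle w (w.2.1.of_le (by simp))
  rw [← enorm_testToSobolev_sq h.isOpen_prod,
    ← enorm_mkH12_sq (memLp_slice h w) (memLp_slice_quotient h w)] at h1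
  change ‖traceTest h w‖ₑ ^ 2 ≤ _ at h1
  have h2 := ENNReal.toReal_mono (by finiteness) h1
  simp only [ENNReal.toReal_mul, ENNReal.toReal_pow, toReal_enorm] at h2
  refine abs_le_of_sq_le_sq' ?_ (by positivity) |>.2
  rwa [mul_pow, Real.sq_sqrt ENNReal.toReal_nonneg]

/-- The trace operator `H¹(Ix × J) → H^{1/2}(J)`. -/
noncomputable def traceOp {Ix J : Set ℝ} (h : IsStrip Ix J) : H1 (Ix ×ˢ J) →L[ℂ] H12 J :=
  (traceTest h).extendOfNorm (testToSobolev h.isOpen_prod _)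

/-- `extendOfNorm` is a genuine extension because the test functions are dense and the trace
inequality bounds the restriction. -/
theorem traceOp_test {Ix J : Set ℝ} (h : IsStrip Ix J) (w : testFunctions (ℝ × ℝ)) :
    traceOp h (testToSobolev h.isOpen_prod _ w) = traceTest h w :=
  LinearMap.extendOfNorm_eq (denseRange_testToSobolev h.isOpen_prod h.convex_prod
    h.nonempty_prod _) (exists_norm_traceTest_le h) w

theorem continuous_H12_fst (J : Set ℝ) : Continuous fun g : H12 J => g.1.fst :=
  (WithLp.prod_continuous_ofLp 2 _ _).fst.comp continuous_subtype_val

theorem traceTest_coe {Ix J : Set ℝ} (h : IsStrip Ix J) (w : testFunctions (ℝ × ℝ)) :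
    ((traceTest h w).1.fst : ℝ → ℂ) =ᵐ[volume.restrict J] fun z => (w : ℝ × ℝ → ℂ) (0, z) :=
  (memLp_slice h w).coeFn_toLp

/-- The map u ↦ (u, trace of u) is continuous and sends the dense set of test functions into the set
whose closure defines `HasTrace`. -/
theorem hasTrace_traceOp {Ix J : Set ℝ} (h : IsStrip Ix J) (u : H1 (Ix ×ˢ J)) :
    HasTrace u (traceOp h u).1.fst := by
  have hc : Continuous fun u : H1 (Ix ×ˢ J) => (u, (traceOp h u).1.fst) :=
    continuous_id.prodMk ((continuous_H12_fst J).comp (traceOp h).continuous)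
  have hu := denseRange_testToSobolev h.isOpen_prod h.convex_prod h.nonempty_prod
    ![((1 : ℝ), (0 : ℝ)), (0, 1)] u
  refine map_mem_closure (f := fun u : H1 (Ix ×ˢ J) => (u, (traceOp h u).1.fst)) hc hu ?_
  rintro _ ⟨w, rfl⟩
  refine ⟨w, w.2.1, w.2.2, testToSobolev_coe _ _ w, ?_⟩
  change ((traceOp h (testToSobolev _ _ w)).1.fst : ℝ → ℂ) =ᵐ[_] _
  rw [traceOp_test]
  exact traceTest_coe h w

end AnisoTrace

/-! ### Traces of functions that are Lipschitz in the transverse variable -/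

namespace AnisoTrace

theorem enorm_fst_H12_le {J : Set ℝ} (U : H12 J) : ‖U.1.fst‖ₑ ^ 2 ≤ ‖U‖ₑ ^ 2 := by
  rw [enorm_H12_sq, enorm_Lp_sq]
  exact le_self_add

theorem lintegral_coeFn_sub_sq {α : Type*} [MeasurableSpace α] {μ : Measure α} (u v : Lp ℂ 2 μ) :
    ∫⁻ x, ‖u x - v x‖ₑ ^ 2 ∂μ = ‖u - v‖ₑ ^ 2 := by
  rw [enorm_Lp_sq]
  refine lintegral_congr_ae ?_
  filter_upwards [Lp.coeFn_sub u v] with x hx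
  rw [hx, Pi.sub_apply]

theorem tendsto_enorm_sub_sq {F ι : Type*} [NormedAddCommGroup F] {l : Filter ι}
    {f : ι → F} {a : F} (h : Tendsto f l (𝓝 a)) : Tendsto (fun i => ‖f i - a‖ₑ ^ 2) l (𝓝 0) := by
  have h1 := (ENNReal.continuous_pow 2).tendsto _ |>.comp
    ((continuous_enorm.tendsto _).comp (h.sub_const a))
  simpa [Function.comp_def] using h1

/-- A function in `H¹` is close in the mean to its trace near the edge. -/
theorem lintegral_sub_traceOp_le {Ix J : Set ℝ} (h : IsStrip Ix J) {σ δ : ℝ}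
    (hσ : σ = 1 ∨ σ = -1) (hs : ∀ t ∈ Ioo 0 δ, σ * t ∈ Ix) (u : H1 (Ix ×ˢ J)) :
    ∫⁻ p in Ioo 0 δ ×ˢ J, ‖u.1 0 (σ * p.1, p.2) - (traceOp h u).1.fst p.2‖ₑ ^ 2
      ≤ 2 * (ENNReal.ofReal δ ^ 2 * ‖u‖ₑ ^ 2) := by
  have hO := h.isOpen_prod
  have hmIx := h.isOpen_left.measurableSet
  obtain ⟨W, hW, hlim⟩ := mem_closure_iff_seq_limit.1
    (denseRange_testToSobolev hO h.convex_prod h.nonempty_prod ![((1 : ℝ), (0 : ℝ)), (0, 1)] u)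
  choose w hw using hW
  have hlimγ : Tendsto (fun n => traceOp h (W n)) atTop (𝓝 (traceOp h u)) :=
    ((traceOp h).continuous.tendsto u).comp hlim
  -- For test functions the bound is `lintegral_sub_trace_le`. Replacing u and its trace by those of
  -- an approximating test function costs the two errors treated here, both of which tend to 0.
  have l1 := ENNReal.Tendsto.const_mul (tendsto_enorm_sub_sq hlim)
    (Or.inr (by finiteness : (4 : ℝ≥0∞) ≠ ⊤))
  have l2 := ENNReal.Tendsto.const_mul (ENNReal.Tendsto.const_mul (tendsto_enorm_sub_sq hlimγ)
    (Or.inr (ENNReal.ofReal_ne_top (r := δ)))) (Or.inr (by finiteness : (4 : ℝ≥0∞) ≠ ⊤))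
  have l3 : Tendsto (fun n => 2 * (ENNReal.ofReal δ ^ 2 * ‖W n‖ₑ ^ 2)) atTop
      (𝓝 (2 * (ENNReal.ofReal δ ^ 2 * ‖u‖ₑ ^ 2))) :=
    ENNReal.Tendsto.const_mul (ENNReal.Tendsto.const_mul
      (((ENNReal.continuous_pow 2).tendsto _).comp ((continuous_enorm.tendsto _).comp hlim))
      (Or.inr (by finiteness))) (Or.inr (by finiteness))
  have l4 := (l1.add l2).add l3
  simp only [mul_zero, add_zero, zero_add] at l4
  refine ge_of_tendsto' l4 fun n => ?_
  set f : ℝ × ℝ → ℂ := (w n).1 with hf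
  have hfc : ContDiff ℝ 1 f := (w n).2.1.of_le (by simp)
  have mf := hfc.continuous.measurable
  have mu : Measurable (u.1 0 : ℝ × ℝ → ℂ) := (Lp.stronglyMeasurable _).measurable
  have mg : Measurable ((traceOp h u).1.fst : ℝ → ℂ) := (Lp.stronglyMeasurable _).measurable
  have m1 : Measurable fun p : ℝ × ℝ =>
      ‖f (σ * p.1, p.2) - u.1 0 (σ * p.1, p.2)‖ₑ ^ 2 := by fun_prop
  have m2 : Measurable fun p : ℝ × ℝ => ‖f (0, p.2) - (traceOp h u).1.fst p.2‖ₑ ^ 2 := by fun_prop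
  have m3 : Measurable fun p : ℝ × ℝ => ‖f (σ * p.1, p.2) - f (0, p.2)‖ₑ ^ 2 := by fun_prop
  calc _ ≤ ∫⁻ p in Ioo 0 δ ×ˢ J, (4 * ‖f (σ * p.1, p.2) - u.1 0 (σ * p.1, p.2)‖ₑ ^ 2
        + 4 * ‖f (0, p.2) - (traceOp h u).1.fst p.2‖ₑ ^ 2)
        + 2 * ‖f (σ * p.1, p.2) - f (0, p.2)‖ₑ ^ 2 := by
        refine lintegral_mono fun p => ?_
        have e : u.1 0 (σ * p.1, p.2) - (traceOp h u).1.fst p.2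
            = (-(f (σ * p.1, p.2) - u.1 0 (σ * p.1, p.2))
              + (f (0, p.2) - (traceOp h u).1.fst p.2)) + (f (σ * p.1, p.2) - f (0, p.2)) := by ring
        simp only [e]
        refine (enorm_add_sq_le _ _).trans (add_le_add ?_ le_rfl)
        refine (mul_le_mul_right (enorm_add_sq_le _ _) 2).trans_eq ?_
        rw [enorm_neg, mul_add, ← mul_assoc, ← mul_assoc]
        norm_num
    _ = 4 * (∫⁻ p in Ioo 0 δ ×ˢ J, ‖f (σ * p.1, p.2) - u.1 0 (σ * p.1, p.2)‖ₑ ^ 2)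
        + 4 * (∫⁻ p in Ioo 0 δ ×ˢ J, ‖f (0, p.2) - (traceOp h u).1.fst p.2‖ₑ ^ 2)
        + 2 * ∫⁻ p in Ioo 0 δ ×ˢ J, ‖f (σ * p.1, p.2) - f (0, p.2)‖ₑ ^ 2 := by
        rw [lintegral_add_right _ (m3.const_mul _), lintegral_add_right _ (m2.const_mul _),
          lintegral_const_mul _ m1, lintegral_const_mul _ m2, lintegral_const_mul _ m3]
    _ ≤ _ := by
        refine add_le_add (add_le_add (mul_le_mul_right ?_ _) (mul_le_mul_right ?_ _))
          (mul_le_mul_right ?_ _)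
        · refine (setLIntegral_flip_le hmIx hσ hs (F := fun p => ‖f p - u.1 0 p‖ₑ ^ 2)
            (by fun_prop)).trans ?_
          have e := enorm_sub_dirSobolev_sq (W n) u (f := f)
            (g := fun i => (W n).1 i.succ) (by rw [← hw n]; exact testToSobolev_coe _ _ (w n))
            (fun i => EventuallyEq.rfl)
          rw [e, add_assoc]
          exact le_self_add
        · rw [setLIntegral_prod_real _ _ m2]
          dsimp only
          rw [setLIntegral_const, mul_comm, Real.volume_Ioo,
            sub_zero]
          refine mul_le_mul_right ?_ _
          refine le_trans (le_of_eq ?_) (enorm_fst_H12_le (traceOp h (W n) - traceOp h u))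
          change _ = ‖(traceOp h (W n)).1.fst - (traceOp h u).1.fst‖ₑ ^ 2
          rw [← lintegral_coeFn_sub_sq]
          refine lintegral_congr_ae ?_
          have := traceTest_coe h (w n)
          rw [← traceOp_test, hw n] at this
          filter_upwards [this] with z hz
          rw [hz]
        · have b := lintegral_sub_trace_le (contDiff_flip hfc σ) J δ
          simp only [mul_zero, enorm_fderiv_flip_fst hfc hσ] at b
          refine b.trans (mul_le_mul_right ?_ _)
          refine (setLIntegral_flip_le hmIx hσ hs (F := fun p => ‖fderiv ℝ f p (1, 0)‖ₑ ^ 2)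
            ((continuous_fderiv_dir hfc _).measurable.enorm.pow_const 2)).trans ?_
          rw [← hw n, enorm_testToSobolev_sq, sobolevSq]
          exact le_add_self.trans le_self_add

/-- The trace of a function which is uniformly Lipschitz in the transverse variable. -/
theorem traceOp_eq_of_lipschitz {Ix J : Set ℝ} (h : IsStrip Ix J) (u : H1 (Ix ×ˢ J))
    {f : ℝ × ℝ → ℂ} {g : ℝ → ℂ} (hf : (u.1 0 : ℝ × ℝ → ℂ) =ᵐ[volume.restrict (Ix ×ˢ J)] f)
    (hfm : Measurable f) (hg : Measurable g) {L : ℝ}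
    (hL : ∀ p ∈ Ix ×ˢ J, ‖f p - g p.2‖ ≤ L * |p.1|) :
    ((traceOp h u).1.fst : ℝ → ℂ) =ᵐ[volume.restrict J] g := by
  obtain ⟨σ, δ, hσ, hδ, hs⟩ := h.exists_side
  have hmIx := h.isOpen_left.measurableSet
  have hmJ := h.isOpen_right.measurableSet
  have mu : Measurable (u.1 0 : ℝ × ℝ → ℂ) := (Lp.stronglyMeasurable _).measurable
  set γ : ℝ → ℂ := ((traceOp h u).1.fst : ℝ → ℂ) with hγ
  have mγ : Measurable γ := (Lp.stronglyMeasurable _).measurable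
  -- Over a strip of width ε, u is close in the mean to its trace, and close to g by the Lipschitz
  -- bound. The truncation to [-R, R] is needed because the Lipschitz error is uniform in z and J
  -- may have infinite length.
  have key : ∀ R : ℕ, ∀ ε ∈ Ioo 0 δ, ∫⁻ z in J ∩ Icc (-(R : ℝ)) R, ‖γ z - g z‖ₑ ^ 2
      ≤ 4 * (ENNReal.ofReal ε * ‖u‖ₑ ^ 2)
        + 2 * (ENNReal.ofReal (|L| * ε) ^ 2 * ENNReal.ofReal (2 * R)) := by
    intro R ε hε
    set J' := J ∩ Icc (-(R : ℝ)) R with hJ'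
    have hmJ' : MeasurableSet J' := hmJ.inter measurableSet_Icc
    have hs' : ∀ t ∈ Ioo 0 ε, σ * t ∈ Ix := fun t ht => hs t ⟨ht.1, ht.2.trans hε.2⟩
    have hε0 : ENNReal.ofReal ε ≠ 0 := by simpa using hε.1
    have mz : Measurable fun p : ℝ × ℝ => ‖γ p.2 - g p.2‖ₑ ^ 2 := by fun_prop
    have m1 : Measurable fun p : ℝ × ℝ => ‖u.1 0 (σ * p.1, p.2) - γ p.2‖ₑ ^ 2 := by fun_prop
    have m2 : Measurable fun p : ℝ × ℝ => ‖u.1 0 (σ * p.1, p.2) - g p.2‖ₑ ^ 2 := by fun_prop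
    have a1 : ∫⁻ p in Ioo 0 ε ×ˢ J', ‖γ p.2 - g p.2‖ₑ ^ 2
        = ENNReal.ofReal ε * ∫⁻ z in J', ‖γ z - g z‖ₑ ^ 2 := by
      rw [setLIntegral_prod_real _ _ mz]
      dsimp only
      rw [setLIntegral_const, mul_comm, Real.volume_Ioo, sub_zero]
    have a2 : ∫⁻ p in Ioo 0 ε ×ˢ J', ‖u.1 0 (σ * p.1, p.2) - g p.2‖ₑ ^ 2
        ≤ ENNReal.ofReal (|L| * ε) ^ 2 * (ENNReal.ofReal ε * ENNReal.ofReal (2 * R)) := by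
      have b1 : ∫⁻ p in Ioo 0 ε ×ˢ J', ‖u.1 0 (σ * p.1, p.2) - f (σ * p.1, p.2)‖ₑ ^ 2 = 0 := by
        refine nonpos_iff_eq_zero.1 ((lintegral_mono_set
          (prod_mono_right inter_subset_left)).trans ((setLIntegral_flip_le hmIx hσ hs'
          (F := fun p => ‖u.1 0 p - f p‖ₑ ^ 2) (by fun_prop)).trans ?_))
        rw [lintegral_congr_ae (g := fun _ => 0)]
        · simp
        · filter_upwards [hf] with p hp
          rw [hp]; simp
      rw [lintegral_eq_zero_iff (by fun_prop)] at b1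
      have b2 : ∫⁻ p in Ioo 0 ε ×ˢ J', ‖u.1 0 (σ * p.1, p.2) - g p.2‖ₑ ^ 2
          ≤ ∫⁻ p in Ioo 0 ε ×ˢ J', ENNReal.ofReal (|L| * ε) ^ 2 := by
        refine lintegral_mono_ae ?_
        filter_upwards [b1, ae_restrict_mem (measurableSet_Ioo.prod hmJ')] with p hp hp'
        have hp0 : u.1 0 (σ * p.1, p.2) = f (σ * p.1, p.2) := by
          simpa [sub_eq_zero] using hp
        rw [hp0]
        refine pow_le_pow_left' ?_ 2
        rw [← ofReal_norm]
        refine ENNReal.ofReal_le_ofReal ?_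
        refine (hL (σ * p.1, p.2) ⟨hs' _ hp'.1, hp'.2.1⟩).trans ?_
        have habs : |σ * p.1| = p.1 := by
          rcases hσ with rfl | rfl
          · simpa using hp'.1.1.le
          · simpa using hp'.1.1.le
        simp only [habs]
        have h1 := hp'.1.2.le
        have h2 := hp'.1.1.le
        calc L * p.1 ≤ |L| * p.1 := by gcongr; exact le_abs_self L
          _ ≤ |L| * ε := by gcongr
      refine b2.trans ?_
      rw [setLIntegral_const]
      refine mul_le_mul_right ?_ _
      change ((volume : Measure ℝ).prod volume) (Ioo 0 ε ×ˢ J') ≤ _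
      rw [Measure.prod_prod, Real.volume_Ioo, sub_zero]
      refine mul_le_mul_right ((measure_mono inter_subset_right).trans_eq ?_) _
      rw [Real.volume_Icc]
      congr 1; ring
    have a3 : ∫⁻ p in Ioo 0 ε ×ˢ J', ‖u.1 0 (σ * p.1, p.2) - γ p.2‖ₑ ^ 2
        ≤ 2 * (ENNReal.ofReal ε ^ 2 * ‖u‖ₑ ^ 2) :=
      (lintegral_mono_set (prod_mono_right inter_subset_left)).trans
        (lintegral_sub_traceOp_le h hσ hs' u)
    -- The integrand on the left is constant in x, which gives a factor ε. The right side also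
    -- carries it and, after division by ε, still vanishes in the limit.
    have a4 : ENNReal.ofReal ε * ∫⁻ z in J', ‖γ z - g z‖ₑ ^ 2
        ≤ ENNReal.ofReal ε * (4 * (ENNReal.ofReal ε * ‖u‖ₑ ^ 2)
        + 2 * (ENNReal.ofReal (|L| * ε) ^ 2 * ENNReal.ofReal (2 * R))) := by
      rw [← a1]
      calc _ ≤ ∫⁻ p in Ioo 0 ε ×ˢ J', (2 * ‖u.1 0 (σ * p.1, p.2) - γ p.2‖ₑ ^ 2
            + 2 * ‖u.1 0 (σ * p.1, p.2) - g p.2‖ₑ ^ 2) := by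
            refine lintegral_mono fun p => ?_
            have e : γ p.2 - g p.2 = -(u.1 0 (σ * p.1, p.2) - γ p.2)
              + (u.1 0 (σ * p.1, p.2) - g p.2) := by ring
            simp only [e]
            refine (enorm_add_sq_le _ _).trans_eq ?_
            rw [enorm_neg]
        _ = 2 * (∫⁻ p in Ioo 0 ε ×ˢ J', ‖u.1 0 (σ * p.1, p.2) - γ p.2‖ₑ ^ 2)
            + 2 * ∫⁻ p in Ioo 0 ε ×ˢ J', ‖u.1 0 (σ * p.1, p.2) - g p.2‖ₑ ^ 2 := by
            rw [lintegral_add_right _ (m2.const_mul _), lintegral_const_mul _ m1,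
              lintegral_const_mul _ m2]
        _ ≤ 2 * (2 * (ENNReal.ofReal ε ^ 2 * ‖u‖ₑ ^ 2)) + 2 * (ENNReal.ofReal (|L| * ε) ^ 2
            * (ENNReal.ofReal ε * ENNReal.ofReal (2 * R))) := by gcongr
        _ = _ := by ring
    exact (ENNReal.mul_le_mul_iff_right hε0 ENNReal.ofReal_ne_top).1 a4
  have hzero : ∀ R : ℕ, ∀ᵐ z ∂volume.restrict (J ∩ Icc (-(R : ℝ)) R), γ z = g z := by
    intro R
    have hz : ∫⁻ z in J ∩ Icc (-(R : ℝ)) R, ‖γ z - g z‖ₑ ^ 2 = 0 := by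
      refine nonpos_iff_eq_zero.1 (ge_of_tendsto (x := 𝓝[>] (0 : ℝ))
        (f := fun ε => 4 * (ENNReal.ofReal ε * ‖u‖ₑ ^ 2)
          + 2 * (ENNReal.ofReal (|L| * ε) ^ 2 * ENNReal.ofReal (2 * R))) ?_ ?_)
      · have c : Continuous fun ε : ℝ => 4 * (ENNReal.ofReal ε * ‖u‖ₑ ^ 2)
            + 2 * (ENNReal.ofReal (|L| * ε) ^ 2 * ENNReal.ofReal (2 * R)) := by
          have c1 : Continuous fun ε : ℝ => ENNReal.ofReal ε * ‖u‖ₑ ^ 2 :=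
            (ENNReal.continuous_mul_const (by finiteness)).comp ENNReal.continuous_ofReal
          have c2 : Continuous fun ε : ℝ => ENNReal.ofReal (|L| * ε) ^ 2
              * ENNReal.ofReal (2 * R) :=
            (ENNReal.continuous_mul_const (by finiteness)).comp
              ((ENNReal.continuous_pow 2).comp (ENNReal.continuous_ofReal.comp (by fun_prop)))
          exact ((ENNReal.continuous_const_mul (by finiteness)).comp c1).add
            ((ENNReal.continuous_const_mul (by finiteness)).comp c2)
        have := c.tendsto 0
        simp only [ENNReal.ofReal_zero, mul_zero, zero_mul, add_zero, ne_eq, OfNat.ofNat_ne_zero,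
          not_false_eq_true, zero_pow] at this
        exact this.mono_left nhdsWithin_le_nhds
      · filter_upwards [Ioo_mem_nhdsGT hδ] with ε hε
        exact key R ε hε
    rw [lintegral_eq_zero_iff (by fun_prop)] at hz
    filter_upwards [hz] with z h1
    simpa [sub_eq_zero] using h1
  have hU : J = ⋃ R : ℕ, J ∩ Icc (-(R : ℝ)) R := by
    rw [← inter_iUnion, eq_comm, inter_eq_left]
    intro z _
    obtain ⟨R, hR⟩ := exists_nat_ge |z|
    exact mem_iUnion.2 ⟨R, abs_le.1 hR⟩
  rw [hU]
  exact (ae_restrict_iUnion_iff _ _).2 hzero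

end AnisoTrace

/-! ### Tools for surjectivity: images of balls, traces of smooth functions, admissible shifts -/

namespace AnisoTrace

/-- The image of a ball under a bounded operator between Hilbert spaces is closed. -/
theorem exists_of_tendsto_of_bounded {H G : Type*} [NormedAddCommGroup H] [InnerProductSpace ℂ H]
    [CompleteSpace H] [NormedAddCommGroup G] [InnerProductSpace ℂ G] [CompleteSpace G]
    (T : H →L[ℂ] G) {u : ℕ → H} {M : ℝ} (hu : ∀ n, ‖u n‖ ≤ M) {g : G}
    (hg : Tendsto (fun n => T (u n)) atTop (𝓝 g)) : ∃ v, T v = g := by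
  have hM : 0 ≤ M := (norm_nonneg _).trans (hu 0)
  set A : G →L[ℂ] H := ContinuousLinearMap.adjoint T with hA
  -- In the limit of ⟨T uₙ, φ⟩ = ⟨uₙ, A φ⟩. Hence A φ ↦ ⟨g, φ⟩ is well defined and bounded on the
  -- range of the adjoint; extended by Hahn-Banach and represented by Riesz, it yields v with T v =
  -- g.
  have bound : ∀ φ : G, ‖inner ℂ g φ‖ ≤ M * ‖A φ‖ := by
    intro φ
    have h1 : Tendsto (fun n => ‖inner ℂ (T (u n)) φ‖) atTop (𝓝 ‖inner ℂ g φ‖) :=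
      (hg.inner tendsto_const_nhds).norm
    refine le_of_tendsto' h1 fun n => ?_
    rw [← ContinuousLinearMap.adjoint_inner_right]
    exact (norm_inner_le_norm _ _).trans (mul_le_mul_of_nonneg_right (hu n) (norm_nonneg _))
  let e : G →ₗ[ℂ] LinearMap.range A.toLinearMap := A.toLinearMap.rangeRestrict
  have he : DenseRange e := (LinearMap.surjective_rangeRestrict _).denseRange
  let F : LinearMap.range A.toLinearMap →L[ℂ] ℂ :=
    (innerSL ℂ g).toLinearMap.extendOfNorm e
  have hF : ∀ φ, F (e φ) = inner ℂ g φ := fun φ =>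
    LinearMap.extendOfNorm_eq he ⟨M, fun x => bound x⟩ φ
  obtain ⟨L, hL, -⟩ := exists_extension_norm_eq (LinearMap.range A.toLinearMap) F
  refine ⟨(InnerProductSpace.toDual ℂ H).symm L, ?_⟩
  refine ext_inner_right ℂ fun φ => ?_
  rw [← ContinuousLinearMap.adjoint_inner_right, InnerProductSpace.toDual_symm_apply, ← hF φ,
    ← hL (e φ)]
  rfl

/-- The trace of a smooth function in `H¹` is its restriction. -/
theorem traceOp_smooth {Ix J : Set ℝ} (h : IsStrip Ix J) {f : ℝ × ℝ → ℂ} (hf : ContDiff ℝ ∞ f)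
    (h0 : MemLp f 2 (volume.restrict (Ix ×ˢ J)))
    (h1 : ∀ i, MemLp (fun x => fderiv ℝ f x (![((1 : ℝ), (0 : ℝ)), (0, 1)] i)) 2
      (volume.restrict (Ix ×ˢ J))) :
    ((traceOp h (smoothSobolev h.isOpen_prod _ (hf.of_le (by simp)).contDiffOn h0 h1)).1.fst
      : ℝ → ℂ) =ᵐ[volume.restrict J] fun z => f (0, z) := by
  have l1 := tendsto_cutoffTest h.isOpen_prod ![((1 : ℝ), (0 : ℝ)), (0, 1)] hf h0 h1
  have l2 := (((continuous_H12_fst J).comp (traceOp h).continuous).tendsto _).comp l1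
  obtain ⟨ns, hns, hae⟩ := (tendstoInMeasure_of_tendsto_Lp l2).exists_seq_tendsto_ae
  have hv : ∀ᵐ z ∂volume.restrict J, ∀ n,
      (traceTest h (cutoffTest hf n)).1.fst z = cutoff ((n : ℝ) + 1) f (0, z) :=
    ae_all_iff.2 fun n => traceTest_coe h (cutoffTest hf n)
  filter_upwards [hae, hv] with z hz hz2
  refine tendsto_nhds_unique hz ?_
  refine tendsto_const_nhds.congr' ?_
  filter_upwards [hns.tendsto_atTop.eventually_ge_atTop ⌈‖((0 : ℝ), z)‖⌉₊] with n hn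
  have h3 : ‖((0 : ℝ), z)‖ ≤ (ns n : ℝ) + 1 := by
    have := (Nat.le_ceil ‖((0 : ℝ), z)‖).trans (Nat.cast_le.2 hn)
    linarith
  simp only [Function.comp_apply]
  rw [traceOp_test, hz2, cutoff_of_le (by positivity) f h3]

/-- Averages over suitable affine images of small intervals stay in an open interval. -/
theorem exists_affine_shift {J : Set ℝ} (hO : IsOpen J) (hJ : J.OrdConnected) (hne : J.Nonempty) :
    ∃ α β M ρ : ℝ, 0 < ρ ∧ 0 ≤ M ∧ (∀ z ∈ J, |α + β * z| ≤ M) ∧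
      ∀ z ∈ J, ∀ X ∈ Icc (0 : ℝ) 1, ∀ t, |t| ≤ ρ → z + X * (α + β * z + t) ∈ J := by
  -- In a bounded interval points are pulled towards an interior point c, with α + β z = c - z, so
  -- that the image is a convex combination of z and c + t. In an unbounded interval a constant unit
  -- shift in an unbounded direction suffices.
  by_cases ha : BddAbove J
  · by_cases hb : BddBelow J
    · obtain ⟨c, hc⟩ := hne
      obtain ⟨r, hr, hball⟩ := Metric.isOpen_iff.1 hO c hc
      obtain ⟨a, ha⟩ := ha
      obtain ⟨b, hb⟩ := hb
      refine ⟨c, -1, a - b, r / 2, by positivity, ?_, fun z hz => ?_, fun z hz X hX t ht => ?_⟩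
      · linarith [ha hc, hb hc]
      · have := ha hz; have := hb hz; have := ha hc; have := hb hc
        rw [abs_le]; constructor <;> linarith
      · have h1 : c + t ∈ J := by
          apply hball
          rw [Metric.mem_ball, Real.dist_eq, add_sub_cancel_left]
          linarith
        have e : z + X * (c + -1 * z + t) = (1 - X) • z + X • (c + t) := by
          simp only [smul_eq_mul]; ring
        rw [e]
        exact hJ.convex hz h1 (by linarith [hX.2]) hX.1 (by ring)
    · refine ⟨-1, 0, 1, 1, one_pos, zero_le_one, fun z _ => by simp, fun z hz X hX t ht => ?_⟩
      rw [not_bddBelow_iff] at hb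
      obtain ⟨y, hy, hyz⟩ := hb (z + X * (-1 + 0 * z + t))
      refine hJ.out hy hz ⟨hyz.le, ?_⟩
      have := (abs_le.1 ht).2
      nlinarith [hX.1]
  · refine ⟨1, 0, 1, 1, one_pos, zero_le_one, fun z _ => by simp, fun z hz X hX t ht => ?_⟩
    rw [not_bddAbove_iff] at ha
    obtain ⟨y, hy, hyz⟩ := ha (z + X * (1 + 0 * z + t))
    refine hJ.out hz hy ⟨?_, hyz.le⟩
    have := (abs_le.1 ht).1
    nlinarith [hX.1]

/-! ### Differentiation of integrals against a parameter-dependent kernel -/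

section ParamIntegral

open scoped Convolution

/-- `k` has compact support in the second variable, locally uniformly in the first one. -/
def HasCompactSupportParam (k : (ℝ × ℝ) × ℝ → ℝ) : Prop :=
  ∀ p₀ : ℝ × ℝ, ∃ (s : Set (ℝ × ℝ)) (K : Set ℝ), IsOpen s ∧ p₀ ∈ s ∧ IsCompact K ∧
    ∀ p y, p ∈ s → y ∉ K → k (p, y) = 0

theorem HasCompactSupportParam.fderiv_eq_zero {k : (ℝ × ℝ) × ℝ → ℝ} {s : Set (ℝ × ℝ)} {K : Set ℝ}
    (hs : IsOpen s) (hK : IsCompact K) (hz : ∀ p y, p ∈ s → y ∉ K → k (p, y) = 0)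
    {p : ℝ × ℝ} (hp : p ∈ s) {y : ℝ} (hy : y ∉ K) : fderiv ℝ k (p, y) = 0 := by
  have : k =ᶠ[𝓝 (p, y)] fun _ => 0 := by
    filter_upwards [(hs.prod hK.isClosed.isOpen_compl).mem_nhds
      (show (p, y) ∈ s ×ˢ Kᶜ from ⟨hp, hy⟩)] with q hq
    exact hz q.1 q.2 hq.1 hq.2
  rw [this.fderiv_eq]
  simp

/-- With G(p, x) = k(p, -x) the integral is the convolution of f and G(p, ·) at the point 0, so the
smoothness of convolutions depending on a parameter applies. -/
theorem integral_param {k : (ℝ × ℝ) × ℝ → ℝ} (hk : ContDiff ℝ ∞ k)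
    (hks : HasCompactSupportParam k) {f : ℝ → ℂ} (hf : LocallyIntegrable f) :
    ContDiff ℝ ∞ (fun p => ∫ y, k (p, y) • f y) ∧
      ∀ p v, fderiv ℝ (fun p => ∫ y, k (p, y) • f y) p v
        = ∫ y, (fderiv ℝ k (p, y) (v, 0)) • f y := by
  set G : ℝ × ℝ → ℝ → ℝ := fun p x => k (p, -x) with hG
  set L : ℂ →L[ℝ] ℝ →L[ℝ] ℂ := (ContinuousLinearMap.lsmul ℝ ℝ : ℝ →L[ℝ] ℂ →L[ℝ] ℂ).flip with hL
  have hGc : ContDiff ℝ ∞ (↿G) := by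
    have : (↿G) = fun q : (ℝ × ℝ) × ℝ => k (q.1, -q.2) := rfl
    rw [this]
    exact hk.comp (by fun_prop)
  have hU : (fun p => ∫ y, k (p, y) • f y)
      = fun p => (fun q : (ℝ × ℝ) × ℝ => (f ⋆[L, volume] G q.1) q.2) (p, 0) := by
    ext p
    simp [convolution, hG, hL]
  have hGd : ∀ p y v, fderiv ℝ (↿G) (p, -y) (v, 0) = fderiv ℝ k (p, y) (v, 0) := by
    intro p y v
    have h1 : HasFDerivAt (fun q : (ℝ × ℝ) × ℝ => (q.1, -q.2))
        ((ContinuousLinearMap.fst ℝ (ℝ × ℝ) ℝ).prod (-ContinuousLinearMap.snd ℝ (ℝ × ℝ) ℝ))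
        (p, -y) := hasFDerivAt_fst.prodMk hasFDerivAt_snd.neg
    have h2 : HasFDerivAt k (fderiv ℝ k (p, y)) (p, - -y) := by
      rw [neg_neg]; exact (hk.differentiable (by simp) _).hasFDerivAt
    have h3 := h2.comp (p, -y) h1
    rw [HasFDerivAt.fderiv (f := ↿G) h3]
    simp
  have main : ∀ p₀ : ℝ × ℝ, ContDiffAt ℝ ∞ (fun p => ∫ y, k (p, y) • f y) p₀ ∧
      ∀ v, fderiv ℝ (fun p => ∫ y, k (p, y) • f y) p₀ v
        = ∫ y, (fderiv ℝ k (p₀, y) (v, 0)) • f y := by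
    intro p₀
    obtain ⟨s, K, hs, hp₀, hK, hz⟩ := hks p₀
    have hK' : IsCompact (-K) := hK.neg
    have hz' : ∀ p x, p ∈ s → x ∉ -K → G p x = 0 := fun p x hp hx => hz p (-x) hp hx
    have hi : ContDiff ℝ ∞ fun p : ℝ × ℝ => (p, (0 : ℝ)) := by fun_prop
    constructor
    · rw [hU]
      have h1 := contDiffOn_convolution_right_with_param (n := ⊤) L hs hK' hz' hf hGc.contDiffOn
      have h2 := (h1 (p₀, 0) ⟨hp₀, mem_univ _⟩).contDiffAt
        ((hs.prod isOpen_univ).mem_nhds ⟨hp₀, mem_univ _⟩)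
      exact ContDiffAt.comp (g := fun q : (ℝ × ℝ) × ℝ => (f ⋆[L, volume] G q.1) q.2)
        (f := fun p => (p, 0)) p₀ h2 hi.contDiffAt
    · intro v
      have h1 := hasFDerivAt_convolution_right_with_param L hs hK' hz' hf
        (hGc.of_le (by simp)).contDiffOn (p₀, 0) hp₀
      have h2 : HasFDerivAt (fun p : ℝ × ℝ => (p, (0 : ℝ)))
          (ContinuousLinearMap.inl ℝ (ℝ × ℝ) ℝ) p₀ := hasFDerivAt_prodMk_left p₀ 0
      have h3 := h1.comp p₀ h2
      rw [hU]
      rw [HasFDerivAt.fderiv (f := fun p => (fun q : (ℝ × ℝ) × ℝ => (f ⋆[L, volume] G q.1) q.2)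
        (p, 0)) h3]
      have hcs : HasCompactSupport fun x => fderiv ℝ (↿G) (p₀, x) :=
        HasCompactSupport.intro hK' fun x hx =>
          HasCompactSupportParam.fderiv_eq_zero hs hK' hz' hp₀ hx
      have hint := hcs.convolutionExists_right (ContinuousLinearMap.precompR ((ℝ × ℝ) × ℝ) L) hf
        ((hGc.continuous_fderiv (by simp)).comp (by fun_prop)) 0
      have e : ((f ⋆[ContinuousLinearMap.precompR ((ℝ × ℝ) × ℝ) L, volume]
          fun x => fderiv ℝ (↿G) (p₀, x)) 0) (v, 0)
          = ∫ t, (fderiv ℝ (↿G) (p₀, -t) (v, 0)) • f t := by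
        unfold convolution
        rw [ContinuousLinearMap.integral_apply hint]
        simp [hL]
      rw [ContinuousLinearMap.comp_apply, ContinuousLinearMap.inl_apply, e]
      simp only [hGd]
  exact ⟨contDiff_iff_contDiffAt.2 fun p => (main p).1, fun p v => (main p).2 v⟩

end ParamIntegral

end AnisoTrace

/-! ### The averaging kernel at scale √(x² + ε²) -/

namespace AnisoTrace

/-- A smooth substitute for `|x|`. -/
noncomputable def smoothAbs (ε x : ℝ) : ℝ := √(x ^ 2 + ε ^ 2)

theorem smoothAbs_pos {ε : ℝ} (hε : 0 < ε) (x : ℝ) : 0 < smoothAbs ε x :=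
  Real.sqrt_pos.2 (by positivity)

theorem smoothAbs_sq (ε x : ℝ) : smoothAbs ε x ^ 2 = x ^ 2 + ε ^ 2 :=
  Real.sq_sqrt (by positivity)

theorem contDiff_smoothAbs {ε : ℝ} (hε : 0 < ε) : ContDiff ℝ ∞ (smoothAbs ε) :=
  ContDiff.sqrt (by fun_prop) fun x => by positivity

theorem abs_le_smoothAbs (ε x : ℝ) : |x| ≤ smoothAbs ε x := by
  rw [smoothAbs]
  refine Real.le_sqrt_of_sq_le ?_
  rw [sq_abs]; nlinarith [sq_nonneg ε]

theorem smoothAbs_le_one {ε x : ℝ} (hε : |ε| ≤ 1 / 2) (hx : |x| ≤ 1 / 2) : smoothAbs ε x ≤ 1 := by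
  rw [smoothAbs, Real.sqrt_le_iff]
  refine ⟨zero_le_one, ?_⟩
  have h1 := sq_abs x
  have h2 := sq_abs ε
  nlinarith [abs_nonneg x, abs_nonneg ε]

theorem hasDerivAt_smoothAbs {ε : ℝ} (hε : 0 < ε) (x : ℝ) :
    HasDerivAt (smoothAbs ε) (x / smoothAbs ε x) x := by
  have h1 : HasDerivAt (fun x => x ^ 2 + ε ^ 2) (2 * x) x := by
    simpa using (hasDerivAt_pow 2 x).add_const (ε ^ 2)
  have h2 := h1.sqrt (by positivity)
  have e : x / smoothAbs ε x = 2 * x / (2 * √(x ^ 2 + ε ^ 2)) := by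
    rw [smoothAbs, mul_div_mul_left _ _ two_ne_zero]
  rw [e]
  exact h2

/-- The averaging kernel at scale `smoothAbs ε x`. -/
noncomputable def avgKernel (η : ℝ → ℝ) (α β ε : ℝ) (q : (ℝ × ℝ) × ℝ) : ℝ :=
  (smoothAbs ε q.1.1)⁻¹ * η ((q.2 - q.1.2) * (smoothAbs ε q.1.1)⁻¹ - α - β * q.1.2)

section Kernel

variable {η : ℝ → ℝ} {α β ε ρ : ℝ}

theorem contDiff_avgKernel (hη : ContDiff ℝ ∞ η) (hε : 0 < ε) :
    ContDiff ℝ ∞ (avgKernel η α β ε) := by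
  have h1 : ContDiff ℝ ∞ fun q : (ℝ × ℝ) × ℝ => (smoothAbs ε q.1.1)⁻¹ :=
    ((contDiff_smoothAbs hε).comp (by fun_prop)).inv fun q => (smoothAbs_pos hε _).ne'
  exact h1.mul (hη.comp (by fun_prop))

theorem hasCompactSupportParam_avgKernel (hηs : ∀ t, ρ < |t| → η t = 0) (hε : 0 < ε) :
    HasCompactSupportParam (avgKernel η α β ε) := by
  intro p₀
  set R : ℝ := ‖p₀‖ + 1
  -- On the support, y = X (t + α + β z) + z with |t| ≤ ρ; for parameters of norm at most R the
  -- scale X is at most R + ε.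
  set S : ℝ := (R + ε) * (|ρ| + |α| + |β| * R) + R with hS
  refine ⟨Metric.ball p₀ 1, Icc (-S) S, Metric.isOpen_ball, Metric.mem_ball_self one_pos,
    isCompact_Icc, fun p y hp hy => ?_⟩
  have hpR : ‖p‖ ≤ R := by
    rw [mem_ball_iff_norm] at hp
    have := norm_le_norm_add_norm_sub' p p₀
    simp only [R]; linarith
  have hp1 : |p.1| ≤ R := (norm_fst_le p).trans hpR
  have hp2 : |p.2| ≤ R := (norm_snd_le p).trans hpR
  have hR0 : 0 ≤ R := (abs_nonneg _).trans hp1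
  have hX := smoothAbs_pos hε p.1
  have hXle : smoothAbs ε p.1 ≤ R + ε := by
    rw [smoothAbs]
    refine Real.sqrt_le_iff.2 ⟨by positivity, ?_⟩
    have h1 : p.1 ^ 2 ≤ R ^ 2 := by rw [← sq_abs]; gcongr
    nlinarith
  rw [avgKernel, hηs _ _, mul_zero]
  by_contra hle
  rw [not_lt] at hle
  apply hy
  rw [mem_Icc, ← abs_le]
  set t := (y - p.2) * (smoothAbs ε p.1)⁻¹ - α - β * p.2 with ht
  have e : y = smoothAbs ε p.1 * (t + α + β * p.2) + p.2 := by
    rw [ht]; field_simp; ring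
  have hb : |t + α + β * p.2| ≤ |ρ| + |α| + |β| * R := by
    refine (abs_add_le _ _).trans (add_le_add ((abs_add_le _ _).trans (add_le_add ?_ le_rfl)) ?_)
    · exact hle.trans (le_abs_self ρ)
    · rw [abs_mul]; gcongr
  rw [e]
  refine (abs_add_le _ _).trans (add_le_add ?_ hp2)
  rw [abs_mul, abs_of_pos hX]
  gcongr

/-- In the variable t = (y - z) / X - α - β z the kernel becomes η(t) dt: it averages over the
points z + X (α + β z + t). -/
theorem integral_avgKernel (hη1 : ∫ t, η t = 1) (hε : 0 < ε) (p : ℝ × ℝ) :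
    ∫ y, avgKernel η α β ε (p, y) = 1 := by
  have hX := smoothAbs_pos hε p.1
  have e : ∀ y, avgKernel η α β ε (p, y) = (smoothAbs ε p.1)⁻¹ •
      (fun s => η (s - (p.2 * (smoothAbs ε p.1)⁻¹ + α + β * p.2))) ((smoothAbs ε p.1)⁻¹ * y) := by
    intro y
    simp only [avgKernel, smul_eq_mul]
    congr 2
    ring
  simp only [e]
  rw [integral_smul, Measure.integral_comp_mul_left
    (fun s => η (s - (p.2 * (smoothAbs ε p.1)⁻¹ + α + β * p.2))), integral_sub_right_eq_self η,
    hη1, inv_inv, abs_of_pos hX]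
  simp [hX.ne']

theorem fderiv_avgKernel_snd (hη : ContDiff ℝ ∞ η) (hε : 0 < ε) (p : ℝ × ℝ) (y : ℝ) :
    fderiv ℝ (avgKernel η α β ε) (p, y) ((0, 1), 0)
      = (smoothAbs ε p.1)⁻¹ * (deriv η ((y - p.2) * (smoothAbs ε p.1)⁻¹ - α - β * p.2)
        * (-(smoothAbs ε p.1)⁻¹ - β)) := by
  have h1 : HasDerivAt (fun τ : ℝ => ((p.1, τ), y)) ((0, 1), 0) p.2 :=
    ((hasDerivAt_const _ _).prodMk (hasDerivAt_id _)).prodMk (hasDerivAt_const _ _)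
  have h2 := (((contDiff_avgKernel (α := α) (β := β) hη hε).differentiable (by simp)
    (p, y)).hasFDerivAt).comp_hasDerivAt p.2 h1
  have h3 : HasDerivAt (fun τ : ℝ => (y - τ) * (smoothAbs ε p.1)⁻¹ - α - β * τ)
      (-1 * (smoothAbs ε p.1)⁻¹ - β * 1) p.2 :=
    ((((hasDerivAt_id p.2).const_sub y).mul_const _).sub_const α).sub
      ((hasDerivAt_id p.2).const_mul β)
  have h4 := ((hη.differentiable (by simp) _).hasDerivAt.comp p.2 h3).const_mul
    (smoothAbs ε p.1)⁻¹
  rw [h2.unique h4]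
  ring

theorem fderiv_avgKernel_fst (hη : ContDiff ℝ ∞ η) (hε : 0 < ε) (p : ℝ × ℝ) (y : ℝ) :
    fderiv ℝ (avgKernel η α β ε) (p, y) ((1, 0), 0)
      = -(p.1 / smoothAbs ε p.1) / smoothAbs ε p.1 ^ 2
          * η ((y - p.2) * (smoothAbs ε p.1)⁻¹ - α - β * p.2)
        + (smoothAbs ε p.1)⁻¹ * (deriv η ((y - p.2) * (smoothAbs ε p.1)⁻¹ - α - β * p.2)
          * ((y - p.2) * (-(p.1 / smoothAbs ε p.1) / smoothAbs ε p.1 ^ 2))) := by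
  have h1 : HasDerivAt (fun τ : ℝ => ((τ, p.2), y)) ((1, 0), 0) p.1 :=
    ((hasDerivAt_id _).prodMk (hasDerivAt_const _ _)).prodMk (hasDerivAt_const _ _)
  have h2 := (((contDiff_avgKernel (α := α) (β := β) hη hε).differentiable (by simp)
    (p, y)).hasFDerivAt).comp_hasDerivAt p.1 h1
  have hi := (hasDerivAt_smoothAbs hε p.1).fun_inv (smoothAbs_pos hε p.1).ne'
  have h3 : HasDerivAt (fun τ : ℝ => (y - p.2) * (smoothAbs ε τ)⁻¹ - α - β * p.2)
      ((y - p.2) * (-(p.1 / smoothAbs ε p.1) / smoothAbs ε p.1 ^ 2)) p.1 :=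
    ((hi.const_mul _).sub_const α).sub_const _
  have h4 := hi.mul ((hη.differentiable (by simp) _).hasDerivAt.comp p.1 h3)
  rw [h2.unique h4]
  rfl

/-- The bounds on the averaging kernel and its derivatives. -/
theorem exists_avgKernel_bound {J : Set ℝ} {M : ℝ} (hη : ContDiff ℝ ∞ η)
    (hηs : ∀ t, ρ < |t| → η t = 0) (hρ : 0 < ρ) (hM : 0 ≤ M) (hα : ∀ z ∈ J, |α + β * z| ≤ M)
    (hJ : ∀ z ∈ J, ∀ X ∈ Icc (0 : ℝ) 1, ∀ t, |t| ≤ ρ → z + X * (α + β * z + t) ∈ J) :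
    ∃ c C : ℝ, 0 < c ∧ 0 ≤ C ∧ ∀ ε, 0 < ε → ∀ p : ℝ × ℝ, p.2 ∈ J → smoothAbs ε p.1 ≤ 1 → ∀ y,
      (y ∈ J ∧ |y - p.2| ≤ c * smoothAbs ε p.1 ∧
        |avgKernel η α β ε (p, y)| ≤ C * (smoothAbs ε p.1)⁻¹ ∧
        |fderiv ℝ (avgKernel η α β ε) (p, y) ((1, 0), 0)| ≤ C * (smoothAbs ε p.1)⁻¹ ^ 2 ∧
        |fderiv ℝ (avgKernel η α β ε) (p, y) ((0, 1), 0)| ≤ C * (smoothAbs ε p.1)⁻¹ ^ 2) ∨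
      (avgKernel η α β ε (p, y) = 0 ∧
        fderiv ℝ (avgKernel η α β ε) (p, y) ((1, 0), 0) = 0 ∧
        fderiv ℝ (avgKernel η α β ε) (p, y) ((0, 1), 0) = 0) := by
  have hcs : HasCompactSupport η :=
    HasCompactSupport.intro (isCompact_Icc (a := -ρ) (b := ρ)) fun t ht => hηs t (by
      by_contra hn
      exact ht (abs_le.1 (not_lt.1 hn)))
  obtain ⟨B, hB⟩ := hcs.exists_bound_of_continuous hη.continuous
  obtain ⟨B', hB'⟩ := hcs.deriv.exists_bound_of_continuous (hη.continuous_deriv (by simp))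
  have hB0 : 0 ≤ B := (norm_nonneg _).trans (hB 0)
  have hB'0 : 0 ≤ B' := (norm_nonneg _).trans (hB' 0)
  have hds : ∀ t, ρ < |t| → deriv η t = 0 := by
    intro t ht
    have : η =ᶠ[𝓝 t] fun _ => 0 := by
      filter_upwards [(isOpen_lt continuous_const continuous_abs).mem_nhds
        (show t ∈ {t | ρ < |t|} from ht)] with s hs
      exact hηs s hs
    rw [this.deriv_eq]; simp
  -- On the support |y - z| = X |α + β z + t| ≤ (M + ρ) X. Each derivative costs one factor X⁻¹,
  -- since |∂ₓ X| ≤ 1; the term β of the z-derivative is absorbed by X ≤ 1, which also keeps y in J.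
  refine ⟨M + ρ, B + B' * (1 + |β| + (M + ρ)), by positivity, by positivity,
    fun ε hε p hp hX1 y => ?_⟩
  have hX := smoothAbs_pos hε p.1
  set X := smoothAbs ε p.1 with hXdef
  rw [fderiv_avgKernel_fst hη hε, fderiv_avgKernel_snd hη hε, avgKernel]
  simp only [← hXdef]
  set t := (y - p.2) * X⁻¹ - α - β * p.2 with ht
  by_cases hle : |t| ≤ ρ
  · left
    have e : y = p.2 + X * (α + β * p.2 + t) := by rw [ht]; field_simp; ring
    have hy1 : |y - p.2| ≤ (M + ρ) * X := by
      rw [e, add_sub_cancel_left, abs_mul, abs_of_pos hX, mul_comm]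
      gcongr
      exact (abs_add_le _ _).trans (add_le_add (hα _ hp) hle)
    have hηt : |η t| ≤ B := hB t
    have hηt' : |deriv η t| ≤ B' := hB' t
    have hXi : 1 ≤ X⁻¹ := (one_le_inv₀ hX).2 hX1
    have hXi0 : 0 ≤ X⁻¹ := by positivity
    have hd : |p.1 / X| ≤ 1 := by
      rw [abs_div, abs_of_pos hX, div_le_one hX]
      exact abs_le_smoothAbs ε p.1
    have hd2 : |-(p.1 / X) / X ^ 2| ≤ X⁻¹ ^ 2 := by
      rw [abs_div, abs_neg, abs_of_pos (by positivity : 0 < X ^ 2), inv_pow, div_eq_mul_inv]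
      exact mul_le_of_le_one_left (by positivity) hd
    refine ⟨e ▸ hJ _ hp X ⟨hX.le, hX1⟩ t hle, hy1, ?_, ?_, ?_⟩
    · rw [abs_mul, abs_of_pos (by positivity), mul_comm]
      gcongr
      have : 0 ≤ B' * (1 + |β| + (M + ρ)) := by positivity
      linarith
    · refine (abs_add_le _ _).trans ?_
      rw [abs_mul, abs_mul, abs_mul, abs_mul, abs_of_nonneg hXi0]
      have s1 : |-(p.1 / X) / X ^ 2| * |η t| ≤ X⁻¹ ^ 2 * B := by gcongr
      have s2 : X⁻¹ * (|deriv η t| * (|y - p.2| * |-(p.1 / X) / X ^ 2|))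
          ≤ X⁻¹ * (B' * ((M + ρ) * X * X⁻¹ ^ 2)) := by gcongr
      have s3 : X⁻¹ * (B' * ((M + ρ) * X * X⁻¹ ^ 2)) = B' * (M + ρ) * X⁻¹ ^ 2 := by
        field_simp
      have s4 : 0 ≤ B' * (1 + |β|) * X⁻¹ ^ 2 := by positivity
      rw [s3] at s2
      linarith
    · rw [abs_mul, abs_mul, abs_of_nonneg hXi0]
      have s1 : |-X⁻¹ - β| ≤ (1 + |β|) * X⁻¹ := by
        have := abs_sub (-X⁻¹) β
        rw [abs_neg, abs_of_nonneg hXi0] at this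
        have h5 : |β| * 1 ≤ |β| * X⁻¹ := by gcongr
        linarith
      have s2 : X⁻¹ * (|deriv η t| * |-X⁻¹ - β|) ≤ X⁻¹ * (B' * ((1 + |β|) * X⁻¹)) := by gcongr
      have s4 : 0 ≤ (B + B' * (M + ρ)) * X⁻¹ ^ 2 := by positivity
      nlinarith
  · right
    rw [hηs t (not_le.1 hle), hds t (not_le.1 hle)]
    simp

end Kernel

end AnisoTrace

/-! ### Bounds for the averages in terms of difference quotients -/

namespace AnisoTrace

/-- A kernel of size `A` supported at distance at most `r` of `z`, applied to `g - g z`. -/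
theorem enorm_integral_kernel_sq_le {J : Set ℝ} {g : ℝ → ℂ} (hg : Measurable g) {k : ℝ → ℝ}
    {z A r : ℝ} (hJ : MeasurableSet J)
    (hk : ∀ y, (y ∈ J ∧ |y - z| ≤ r ∧ |k y| ≤ A) ∨ k y = 0) :
    ‖∫ y, k y • (g y - g z)‖ₑ ^ 2 ≤ ENNReal.ofReal A ^ 2 * (ENNReal.ofReal (2 * r) *
      ∫⁻ y in J ∩ Metric.closedBall z r, ‖g y - g z‖ₑ ^ 2) := by
  set S := J ∩ Metric.closedBall z r with hS
  have hSm : MeasurableSet S := hJ.inter measurableSet_closedBall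
  have h1 : ‖∫ y, k y • (g y - g z)‖ₑ ≤ ENNReal.ofReal A * ∫⁻ y in S, ‖g y - g z‖ₑ := by
    refine (enorm_integral_le_lintegral_enorm _).trans ?_
    rw [← lintegral_const_mul _ (by fun_prop), ← lintegral_indicator hSm]
    refine lintegral_mono fun y => ?_
    rcases hk y with ⟨h1, h2, h3⟩ | h
    · rw [indicator_of_mem (show y ∈ S from ⟨h1, by rwa [Metric.mem_closedBall, Real.dist_eq]⟩),
        enorm_smul]
      gcongr
      rw [← ofReal_norm]
      exact ENNReal.ofReal_le_ofReal h3
    · simp [h]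
  calc ‖∫ y, k y • (g y - g z)‖ₑ ^ 2 ≤ (ENNReal.ofReal A * ∫⁻ y in S, ‖g y - g z‖ₑ) ^ 2 := by
        gcongr
    _ ≤ _ := by
        rw [mul_pow]
        gcongr
        refine (lintegral_sq_le (by fun_prop)).trans ?_
        gcongr
        rw [Measure.restrict_apply_univ]
        refine (measure_mono inter_subset_right).trans ?_
        rw [Real.volume_closedBall]

/-- The square of the difference quotient. -/
noncomputable def quotSq (g : ℝ → ℂ) (p : ℝ × ℝ) : ℝ≥0∞ :=
  ‖(g p.1 - g p.2) / ((p.1 - p.2 : ℝ) : ℂ)‖ₑ ^ 2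

theorem measurable_quotSq {g : ℝ → ℂ} (hg : Measurable g) : Measurable (quotSq g) := by
  unfold quotSq; fun_prop

theorem measurable_quotSq_left {g : ℝ → ℂ} (hg : Measurable g) (z : ℝ) :
    Measurable fun y => quotSq g (y, z) :=
  (measurable_quotSq hg).comp (by fun_prop)

theorem enorm_sub_sq_eq_quotSq (g : ℝ → ℂ) (y z : ℝ) :
    ‖g y - g z‖ₑ ^ 2 = ENNReal.ofReal |y - z| ^ 2 * quotSq g (y, z) := by
  rcases eq_or_ne y z with rfl | h
  · simp
  · have h2 : ((y - z : ℝ) : ℂ) ≠ 0 := by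
      rw [Complex.ofReal_ne_zero]; exact sub_ne_zero.2 h
    have h3 : ‖((y - z : ℝ) : ℂ)‖ₑ = ENNReal.ofReal |y - z| := by
      rw [← ofReal_norm, Complex.norm_real, Real.norm_eq_abs]
    rw [quotSq, ← h3, ← mul_pow, ← enorm_mul, mul_div_cancel₀ _ h2]

/-- A Poisson kernel, whose integral over the line does not depend on h > 0. Integrating the
gradient bound in x therefore leaves the plain squared difference quotient, with no weight in |y -
z|. -/
theorem lintegral_poisson_le {h c : ℝ} (hh : 0 ≤ h) (hc : 0 < c) :
    ∫⁻ x : ℝ, ENNReal.ofReal (h / (x ^ 2 + (h / c) ^ 2)) ≤ ENNReal.ofReal (Real.pi * c) := by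
  rcases hh.eq_or_lt with rfl | hh
  · simp
  have ha : c / h ≠ 0 := by positivity
  have e : ∀ x : ℝ, h / (x ^ 2 + (h / c) ^ 2) = c * (c / h) * (1 + (c / h * x) ^ 2)⁻¹ := by
    intro x
    have : x ^ 2 + (h / c) ^ 2 ≠ 0 := by positivity
    have : 1 + (c / h * x) ^ 2 ≠ 0 := by positivity
    field_simp
    ring
  have hi : Integrable fun x : ℝ => (1 + (c / h * x) ^ 2)⁻¹ :=
    integrable_inv_one_add_sq.comp_mul_left' ha
  rw [← ofReal_integral_eq_lintegral_ofReal]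
  · refine le_of_eq ?_
    simp only [e]
    rw [integral_const_mul, Measure.integral_comp_mul_left (fun x : ℝ => (1 + x ^ 2)⁻¹),
      integral_univ_inv_one_add_sq, abs_of_pos (by positivity)]
    congr 1
    simp only [smul_eq_mul]
    field_simp
  · simp only [e]
    exact hi.const_mul _
  · exact ae_of_all _ fun x => by positivity

section Average

variable {J : Set ℝ} {g : ℝ → ℂ} {η : ℝ → ℝ} {α β ε ρ : ℝ}

/-- The regularization of `g` at scale `smoothAbs ε x`. -/
noncomputable def average (η : ℝ → ℝ) (α β ε : ℝ) (g : ℝ → ℂ) (p : ℝ × ℝ) : ℂ :=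
  ∫ y, avgKernel η α β ε (p, y) • g y

theorem contDiff_average (hη : ContDiff ℝ ∞ η) (hηs : ∀ t, ρ < |t| → η t = 0) (hε : 0 < ε)
    (hgl : LocallyIntegrable g) : ContDiff ℝ ∞ (average η α β ε g) :=
  (integral_param (contDiff_avgKernel hη hε) (hasCompactSupportParam_avgKernel hηs hε) hgl).1

theorem HasCompactSupportParam.slice {k : (ℝ × ℝ) × ℝ → ℝ} (hk : HasCompactSupportParam k)
    (p : ℝ × ℝ) : HasCompactSupport fun y => k (p, y) := by
  obtain ⟨s, K, -, hp, hK, hz⟩ := hk p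
  exact HasCompactSupport.intro hK fun y hy => hz p y hp hy

theorem HasCompactSupportParam.fderiv_slice {k : (ℝ × ℝ) × ℝ → ℝ} (hk : HasCompactSupportParam k)
    (p v : ℝ × ℝ) : HasCompactSupport fun y => fderiv ℝ k (p, y) (v, 0) := by
  obtain ⟨s, K, hs, hp, hK, hz⟩ := hk p
  exact HasCompactSupport.intro hK fun y hy => by
    rw [HasCompactSupportParam.fderiv_eq_zero hs hK hz hp hy]; rfl

theorem integral_smul_sub {k : ℝ → ℝ} (hk : Continuous k) (hks : HasCompactSupport k)
    (hgl : LocallyIntegrable g) (w : ℂ) :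
    ∫ y, k y • (g y - w) = (∫ y, k y • g y) - (∫ y, k y) • w := by
  have h1 : Integrable fun y => k y • g y := hgl.integrable_smul_left_of_hasCompactSupport hk hks
  have h2 : Integrable k := hk.integrable_of_hasCompactSupport hks
  simp only [smul_sub]
  rw [integral_sub h1 (h2.smul_const w), integral_smul_const]

theorem average_sub (hη : ContDiff ℝ ∞ η) (hηs : ∀ t, ρ < |t| → η t = 0) (hη1 : ∫ t, η t = 1)
    (hε : 0 < ε) (hgl : LocallyIntegrable g) (p : ℝ × ℝ) :
    average η α β ε g p - g p.2 = ∫ y, avgKernel η α β ε (p, y) • (g y - g p.2) := by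
  have hc : Continuous fun y => avgKernel η α β ε (p, y) :=
    (contDiff_avgKernel hη hε).continuous.comp (by fun_prop)
  rw [integral_smul_sub hc
    ((hasCompactSupportParam_avgKernel hηs hε).slice p) hgl, integral_avgKernel hη1 hε, one_smul]
  rfl

/-- The kernel has total mass 1 for every parameter, so its derivatives have mean zero and g(z) can
be subtracted. This is what makes difference quotients of g appear. -/
theorem fderiv_average (hη : ContDiff ℝ ∞ η) (hηs : ∀ t, ρ < |t| → η t = 0) (hη1 : ∫ t, η t = 1)
    (hε : 0 < ε) (hgl : LocallyIntegrable g) (p v : ℝ × ℝ) :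
    fderiv ℝ (average η α β ε g) p v
      = ∫ y, fderiv ℝ (avgKernel η α β ε) (p, y) (v, 0) • (g y - g p.2) := by
  have hk := contDiff_avgKernel (α := α) (β := β) hη hε
  have hks := hasCompactSupportParam_avgKernel (α := α) (β := β) hηs hε
  have hz : ∫ y, fderiv ℝ (avgKernel η α β ε) (p, y) (v, 0) = 0 := by
    have h1 := (integral_param hk hks (locallyIntegrable_const (1 : ℂ))).2 p v
    have h2 : (fun p : ℝ × ℝ => ∫ y, avgKernel η α β ε (p, y) • (1 : ℂ)) = fun _ => 1 := by
      ext p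
      rw [integral_smul_const, integral_avgKernel hη1 hε, one_smul]
    rw [h2, integral_smul_const] at h1
    simpa using h1.symm
  have hc : Continuous fun y => fderiv ℝ (avgKernel η α β ε) (p, y) (v, 0) :=
    ((hk.continuous_fderiv (by simp)).comp (by fun_prop)).clm_apply continuous_const
  rw [integral_smul_sub hc (hks.fderiv_slice p v) hgl, hz, zero_smul, sub_zero]
  exact (integral_param hk hks hgl).2 p v

/-- Pointwise bounds for the regularization. -/
theorem exists_average_bound (hJo : IsOpen J) (hJc : J.OrdConnected) (hne : J.Nonempty) :
    ∃ (η : ℝ → ℝ) (α β ρ c A B : ℝ), ContDiff ℝ ∞ η ∧ (∀ t, ρ < |t| → η t = 0) ∧ 0 < c ∧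
      ∀ g : ℝ → ℂ, Measurable g → LocallyIntegrable g → ∀ ε, 0 < ε → ∀ p : ℝ × ℝ, p.2 ∈ J →
      smoothAbs ε p.1 ≤ 1 →
      ‖average η α β ε g p - g p.2‖ₑ ^ 2
        ≤ ENNReal.ofReal (A * smoothAbs ε p.1) * ∫⁻ y in J, quotSq g (y, p.2) ∧
      ∀ i, ‖fderiv ℝ (average η α β ε g) p (![((1 : ℝ), (0 : ℝ)), (0, 1)] i)‖ₑ ^ 2
        ≤ ∫⁻ y in J, ENNReal.ofReal (B * (|y - p.2| / (p.1 ^ 2 + (|y - p.2| / c) ^ 2)))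
          * quotSq g (y, p.2) := by
  obtain ⟨α, β, M, ρ, hρ, hM, hα, hsh⟩ := exists_affine_shift hJo hJc hne
  let b : ContDiffBump (0 : ℝ) := ⟨ρ / 2, ρ, by positivity, by linarith⟩
  have hη : ContDiff ℝ ∞ (b.normed volume) := b.contDiff_normed
  have hηs : ∀ t, ρ < |t| → b.normed volume t = 0 := fun t ht => by
    have : t ∉ Function.support (b.normed volume) := by
      rw [b.support_normed_eq, Metric.mem_ball, dist_zero_right, Real.norm_eq_abs]
      exact not_lt.2 ht.le
    simpa using this
  obtain ⟨c, C, hc, hC, hb⟩ := exists_avgKernel_bound hη hηs hρ hM hα hsh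
  have hη1 : ∫ t, b.normed volume t = 1 := b.integral_normed
  -- The first constant comes from (C/X)² · 2cX · (cX)²: size of the kernel, length of its support,
  -- largest |y - z|. The second comes from (C/X²)² · 2cX · |y - z|², with X eliminated below.
  refine ⟨b.normed volume, α, β, ρ, c, C ^ 2 * (2 * c) * c ^ 2, 4 * C ^ 2 * c ^ 2, hη, hηs, hc,
    fun g hg hgl ε hε p hp hX1 => ⟨?_, fun i => ?_⟩⟩
  · have hX := smoothAbs_pos hε p.1
    set X := smoothAbs ε p.1 with hXdef
    rw [average_sub hη hηs hη1 hε hgl]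
    refine (enorm_integral_kernel_sq_le hg (r := c * X) (A := C * X⁻¹) hJo.measurableSet
      fun y => ?_).trans ?_
    · rcases hb ε hε p hp hX1 y with ⟨h1, h2, h3, -⟩ | h
      · exact Or.inl ⟨h1, h2, h3⟩
      · exact Or.inr h.1
    · have h1 : ∫⁻ y in J ∩ Metric.closedBall p.2 (c * X), ‖g y - g p.2‖ₑ ^ 2
          ≤ ENNReal.ofReal (c * X) ^ 2 * ∫⁻ y in J, quotSq g (y, p.2) := by
        rw [← lintegral_const_mul _ (measurable_quotSq_left hg _)]
        refine (setLIntegral_mono' (hJo.measurableSet.inter measurableSet_closedBall)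
          fun y hy => ?_).trans (lintegral_mono_set inter_subset_left)
        rw [enorm_sub_sq_eq_quotSq]
        gcongr
        simpa [Real.dist_eq] using hy.2
      refine (mul_le_mul_right (mul_le_mul_right h1 _) _).trans (le_of_eq ?_)
      rw [← mul_assoc, ← mul_assoc, ← ENNReal.ofReal_pow (by positivity),
        ← ENNReal.ofReal_pow (by positivity), ← ENNReal.ofReal_mul (by positivity),
        ← ENNReal.ofReal_mul (by positivity)]
      congr 2
      field_simp
  · have hX := smoothAbs_pos hε p.1
    have hXsq := smoothAbs_sq ε p.1
    set X := smoothAbs ε p.1 with hXdef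
    rw [fderiv_average hη hηs hη1 hε hgl]
    refine (enorm_integral_kernel_sq_le hg (r := c * X) (A := C * X⁻¹ ^ 2) hJo.measurableSet
      fun y => ?_).trans ?_
    · rcases hb ε hε p hp hX1 y with ⟨h1, h2, -, h3, h4⟩ | h
      · refine Or.inl ⟨h1, h2, ?_⟩
        fin_cases i
        exacts [h3, h4]
      · refine Or.inr ?_
        fin_cases i
        exacts [h.2.1, h.2.2]
    · rw [← mul_assoc, ← ENNReal.ofReal_pow (by positivity), ← ENNReal.ofReal_mul (by positivity),
        ← lintegral_const_mul _ (by fun_prop)]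
      refine (setLIntegral_mono' (hJo.measurableSet.inter measurableSet_closedBall)
        fun y hy => ?_).trans (lintegral_mono_set inter_subset_left)
      have hy2 : |y - p.2| ≤ c * X := by simpa [Real.dist_eq] using hy.2
      rw [enorm_sub_sq_eq_quotSq, ← mul_assoc, ← ENNReal.ofReal_pow (by positivity),
        ← ENNReal.ofReal_mul (by positivity)]
      refine mul_le_mul_left (ENNReal.ofReal_le_ofReal ?_) _
      set h := |y - p.2| with hh
      have hh0 : 0 ≤ h := abs_nonneg _
      rcases hh0.eq_or_lt with h0 | h0
      · rw [← h0]; simp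
      have hD : 0 < p.1 ^ 2 + (h / c) ^ 2 := by positivity
      -- On the support both |x| and h / c are at most X. This replaces the scale, which depends on
      -- ε, by a Poisson kernel that does not, so the bound is uniform in ε.
      have hDX : p.1 ^ 2 + (h / c) ^ 2 ≤ 2 * X ^ 2 := by
        have : (h / c) ^ 2 ≤ X ^ 2 := by
          gcongr
          rw [div_le_iff₀ hc]; linarith
        nlinarith [sq_nonneg ε]
      have e : (C * X⁻¹ ^ 2) ^ 2 * (2 * (c * X)) * h ^ 2
          = 2 * C ^ 2 * c * h * (h * X⁻¹) * (X⁻¹ ^ 2) := by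
        field_simp
      rw [e]
      have h1 : h * X⁻¹ ≤ c := by
        rw [← div_eq_mul_inv, div_le_iff₀ hX]; exact hy2
      have h2 : X⁻¹ ^ 2 ≤ 2 * (p.1 ^ 2 + (h / c) ^ 2)⁻¹ := by
        rw [inv_pow, ← div_eq_mul_inv, inv_le_comm₀ (by positivity) (by positivity), inv_div,
          div_le_iff₀ two_pos]
        linarith
      calc 2 * C ^ 2 * c * h * (h * X⁻¹) * (X⁻¹ ^ 2)
          ≤ 2 * C ^ 2 * c * h * c * (2 * (p.1 ^ 2 + (h / c) ^ 2)⁻¹) := by gcongr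
        _ = _ := by ring

end Average

end AnisoTrace

/-! ### Surjectivity of the classical trace -/

namespace AnisoTrace

theorem exists_cutoff_line : ∃ (χ : ℝ → ℝ) (B : ℝ), ContDiff ℝ ∞ χ ∧ χ 0 = 1 ∧
    (∀ x, |χ x| ≤ B) ∧ (∀ x, |deriv χ x| ≤ B) ∧
    ∀ x, 1 / 2 < |x| → χ x = 0 ∧ deriv χ x = 0 := by
  let b : ContDiffBump (0 : ℝ) := ⟨1 / 4, 1 / 2, by norm_num, by norm_num⟩
  have hb : ContDiff ℝ ∞ b := b.contDiff
  obtain ⟨B₁, hB₁⟩ := b.hasCompactSupport.exists_bound_of_continuous b.continuous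
  obtain ⟨B₂, hB₂⟩ := b.hasCompactSupport.deriv.exists_bound_of_continuous
    (hb.continuous_deriv (by simp))
  have hz : ∀ x : ℝ, 1 / 2 < |x| → b x = 0 := fun x hx => by
    have : x ∉ Function.support b := by
      rw [b.support_eq, Metric.mem_ball, dist_zero_right, Real.norm_eq_abs]
      exact not_lt.2 hx.le
    simpa using this
  refine ⟨b, max B₁ B₂, hb, b.one_of_mem_closedBall (by simp [b]), fun x => (hB₁ x).trans (le_max_left _ _),
    fun x => (hB₂ x).trans (le_max_right _ _), fun x hx => ⟨hz x hx, ?_⟩⟩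
  have : b =ᶠ[𝓝 x] fun _ => (0 : ℝ) := by
    filter_upwards [(isOpen_lt continuous_const continuous_abs).mem_nhds
      (show x ∈ {t : ℝ | 1 / 2 < |t|} from hx)] with s hs
    exact hz s hs
  rw [this.deriv_eq]; simp

/-- Regularizations of `g ∈ H^{1/2}(J)`, cut off in `x`, are bounded in `H¹`, and their
restrictions to `x = 0` tend to `g`. -/
theorem exists_regularization {Ix J : Set ℝ} (hIx : MeasurableSet Ix) (hJo : IsOpen J)
    (hJc : J.OrdConnected) (hne : J.Nonempty) {g : ℝ → ℂ} (hg : Measurable g)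
    (hgl : LocallyIntegrable g) (hN : slobodeckijSq J g < ⊤) :
    ∃ K : ℝ≥0∞, K ≠ ⊤ ∧ ∀ ε ∈ Ioc (0 : ℝ) (1 / 2), ∃ u : ℝ × ℝ → ℂ, ContDiff ℝ ∞ u ∧
      ∫⁻ p in Ix ×ˢ J, ‖u p‖ₑ ^ 2 ≤ K ∧
      (∀ i, ∫⁻ p in Ix ×ˢ J, ‖fderiv ℝ u p (![((1 : ℝ), (0 : ℝ)), (0, 1)] i)‖ₑ ^ 2 ≤ K) ∧
      ∫⁻ z in J, ‖u (0, z) - g z‖ₑ ^ 2 ≤ ENNReal.ofReal ε * K := by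
  obtain ⟨η, α, β, ρ, c, A, B, hη, hηs, hc, hbound⟩ := exists_average_bound hJo hJc hne
  obtain ⟨χ, D, hχ, hχ0, hχD, hχD', hχz⟩ := exists_cutoff_line
  have hD0 : 0 ≤ D := (abs_nonneg _).trans (hχD 0)
  set A' : ℝ≥0∞ := ENNReal.ofReal |A| with hA'
  set D' : ℝ≥0∞ := ENNReal.ofReal D ^ 2 with hD'
  set q : ℝ → ℝ≥0∞ := fun z => ∫⁻ y in J, quotSq g (y, z) with hq
  set P : ℝ → ℝ → ℝ → ℝ≥0∞ := fun x z y =>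
    ENNReal.ofReal (B * (|y - z| / (x ^ 2 + (|y - z| / c) ^ 2))) * quotSq g (y, z) with hP
  set N := slobodeckijSq J g with hNdef
  have hqm : Measurable q := (measurable_quotSq hg).lintegral_prod_left'
  have hqN : ∫⁻ z in J, q z ≤ N := by
    rw [hNdef, slobodeckijSq, hq, ← setLIntegral_prod_real_symm J J (measurable_quotSq hg)]
    exact le_add_self
  have hgN : ∫⁻ z in J, ‖g z‖ₑ ^ 2 ≤ N := le_self_add
  have hPm : Measurable fun r : (ℝ × ℝ) × ℝ => P r.1.1 r.1.2 r.2 := by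
    have h1 : Measurable fun r : (ℝ × ℝ) × ℝ => quotSq g (r.2, r.1.2) :=
      (measurable_quotSq hg).comp (by fun_prop)
    simp only [hP]
    fun_prop
  have hP2 : Measurable fun r : ℝ × ℝ => ∫⁻ y in J, P r.1 r.2 y := hPm.lintegral_prod_right'
  have hPint : ∀ z y, ∫⁻ x : ℝ, P x z y
      ≤ ENNReal.ofReal |B| * ENNReal.ofReal (Real.pi * c) * quotSq g (y, z) := by
    intro z y
    have hm : Measurable fun x : ℝ =>
      ENNReal.ofReal (|y - z| / (x ^ 2 + (|y - z| / c) ^ 2)) := by fun_prop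
    simp only [hP]
    rw [lintegral_mul_const _ (by fun_prop)]
    gcongr
    calc ∫⁻ x : ℝ, ENNReal.ofReal (B * (|y - z| / (x ^ 2 + (|y - z| / c) ^ 2)))
        ≤ ∫⁻ x : ℝ, ENNReal.ofReal |B| * ENNReal.ofReal (|y - z| / (x ^ 2 + (|y - z| / c) ^ 2)) := by
          refine lintegral_mono fun x => ?_
          rw [← ENNReal.ofReal_mul (abs_nonneg _)]
          refine ENNReal.ofReal_le_ofReal ?_
          gcongr
          exact le_abs_self B
      _ ≤ _ := by
          rw [lintegral_const_mul _ hm]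
          gcongr
          exact lintegral_poisson_le (abs_nonneg _) hc
  set c' : ℝ≥0∞ := ENNReal.ofReal |B| * ENNReal.ofReal (Real.pi * c) with hc'
  -- A majorant, free of ε, of |u|² and of the squares of both partial derivatives. The first
  -- summand integrates over an interval of length 1, the second by the Poisson integral.
  set E : ℝ × ℝ → ℝ≥0∞ := fun p => 4 * D' * ((Icc (-1 / 2 : ℝ) (1 / 2)).indicator
    (fun _ => ‖g p.2‖ₑ ^ 2 + A' * q p.2) p.1 + ∫⁻ y in J, P p.1 p.2 y) with hE
  set K : ℝ≥0∞ := 4 * D' * (N + A' * N + c' * N) + A' * N with hK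
  have hEint : ∫⁻ p in Ix ×ˢ J, E p ≤ K := by
    have hFm : Measurable fun p : ℝ × ℝ => (Icc (-1 / 2 : ℝ) (1 / 2)).indicator
        (fun _ => ‖g p.2‖ₑ ^ 2 + A' * q p.2) p.1 := by
      have : (fun p : ℝ × ℝ => (Icc (-1 / 2 : ℝ) (1 / 2)).indicator
          (fun _ => ‖g p.2‖ₑ ^ 2 + A' * q p.2) p.1)
          = (Icc (-1 / 2 : ℝ) (1 / 2) ×ˢ univ).indicator
            (fun p : ℝ × ℝ => ‖g p.2‖ₑ ^ 2 + A' * q p.2) := by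
        ext p
        by_cases hp : p.1 ∈ Icc (-1 / 2 : ℝ) (1 / 2)
        · rw [indicator_of_mem hp, indicator_of_mem (show p ∈ _ ×ˢ univ from ⟨hp, trivial⟩)]
        · rw [indicator_of_notMem hp, indicator_of_notMem fun h => hp h.1]
      rw [this]
      refine Measurable.indicator ?_ (measurableSet_Icc.prod .univ)
      exact Measurable.add (by fun_prop) ((hqm.comp measurable_snd).const_mul _)
    have hsum : Measurable fun p : ℝ × ℝ => (Icc (-1 / 2 : ℝ) (1 / 2)).indicator
        (fun _ => ‖g p.2‖ₑ ^ 2 + A' * q p.2) p.1 + ∫⁻ y in J, P p.1 p.2 y := hFm.add hP2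
    simp only [hE]
    rw [lintegral_const_mul _ hsum, lintegral_add_left hFm, hK]
    refine le_add_right ?_
    gcongr
    · rw [setLIntegral_prod_real_symm _ _ hFm]
      calc ∫⁻ z in J, ∫⁻ x in Ix, (Icc (-1 / 2 : ℝ) (1 / 2)).indicator
            (fun _ => ‖g z‖ₑ ^ 2 + A' * q z) x
          ≤ ∫⁻ z in J, (‖g z‖ₑ ^ 2 + A' * q z) := by
            refine lintegral_mono fun z => ?_
            refine (setLIntegral_le_lintegral _ _).trans ?_
            rw [lintegral_indicator measurableSet_Icc, setLIntegral_const, Real.volume_Icc]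
            norm_num
        _ ≤ _ := by
            rw [lintegral_add_left (by fun_prop), lintegral_const_mul _ hqm]
            gcongr
    · rw [setLIntegral_prod_real_symm _ _ hP2]
      calc ∫⁻ z in J, ∫⁻ x in Ix, ∫⁻ y in J, P x z y
          ≤ ∫⁻ z in J, c' * q z := by
            refine lintegral_mono fun z => ?_
            have hm : Measurable fun r : ℝ × ℝ => P r.1 z r.2 :=
              hPm.comp (f := fun r : ℝ × ℝ => ((r.1, z), r.2)) (by fun_prop)
            rw [lintegral_lintegral_swap (f := fun x y => P x z y) hm.aemeasurable, hq, ← lintegral_const_mul _ (measurable_quotSq_left hg _)]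
            exact lintegral_mono fun y => (setLIntegral_le_lintegral _ _).trans (hPint z y)
        _ ≤ _ := by
            rw [lintegral_const_mul _ hqm]
            gcongr
  have hKt : K ≠ ⊤ := by
    have := hN.ne
    simp only [hK, hA', hD', hc']
    finiteness
  refine ⟨K, hKt, fun ε ⟨hε, hε2⟩ => ?_⟩
  set U := average η α β ε g with hU
  have hUc : ContDiff ℝ ∞ U := contDiff_average hη hηs hε hgl
  have hX1 : ∀ x : ℝ, |x| ≤ 1 / 2 → smoothAbs ε x ≤ 1 := fun x hx =>
    smoothAbs_le_one (by rwa [abs_of_pos hε]) hx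
  have hUb : ∀ p : ℝ × ℝ, |p.1| ≤ 1 / 2 → p.2 ∈ J →
      ‖U p‖ₑ ^ 2 ≤ 2 * (‖g p.2‖ₑ ^ 2 + A' * q p.2) := by
    intro p h1 h2
    have e : U p = (U p - g p.2) + g p.2 := by ring
    rw [e, mul_add, add_comm (2 * _)]
    refine (enorm_add_sq_le _ _).trans ?_
    gcongr
    refine (hbound g hg hgl ε hε p h2 (hX1 _ h1)).1.trans ?_
    refine mul_le_mul_left (ENNReal.ofReal_le_ofReal ?_) _
    have := hX1 _ h1
    have := smoothAbs_pos hε p.1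
    nlinarith [le_abs_self A, abs_nonneg A]
  set u : ℝ × ℝ → ℂ := fun p => χ p.1 • U p with hu
  have hχ1 : ContDiff ℝ ∞ fun p : ℝ × ℝ => χ p.1 := hχ.comp contDiff_fst
  have huc : ContDiff ℝ ∞ u := hχ1.smul hUc
  have hsm : ∀ {a : ℝ} (_ : |a| ≤ D) (w : ℂ), ‖a • w‖ₑ ^ 2 ≤ D' * ‖w‖ₑ ^ 2 := by
    intro a ha w
    rw [enorm_smul, mul_pow, hD']
    gcongr
    rw [← ofReal_norm]
    exact ENNReal.ofReal_le_ofReal ha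
  have hmem : ∀ {x : ℝ}, |x| ≤ 1 / 2 → x ∈ Icc (-1 / 2 : ℝ) (1 / 2) := fun {x} hx => by
    rw [abs_le] at hx
    exact ⟨by linarith [hx.1], hx.2⟩
  have huE : ∀ p : ℝ × ℝ, p.2 ∈ J → ‖u p‖ₑ ^ 2 ≤ E p := by
    intro p hp
    by_cases hx : |p.1| ≤ 1 / 2
    · refine (hsm (hχD _) _).trans ?_
      simp only [hE]
      rw [indicator_of_mem (hmem hx)]
      refine (mul_le_mul_right (hUb p hx hp) _).trans ?_
      rw [← mul_assoc, mul_comm D']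
      exact mul_le_mul' (mul_le_mul' (by norm_num) le_rfl) le_self_add
    · rw [hu]; simp [(hχz _ (not_le.1 hx)).1]
  have hd : ∀ p v : ℝ × ℝ,
      fderiv ℝ u p v = χ p.1 • fderiv ℝ U p v + (deriv χ p.1 * v.1) • U p := by
    intro p v
    have h1 : HasFDerivAt (fun p : ℝ × ℝ => χ p.1)
        (deriv χ p.1 • ContinuousLinearMap.fst ℝ ℝ ℝ) p :=
      ((hχ.differentiable (by simp) p.1).hasDerivAt).comp_hasFDerivAt p hasFDerivAt_fst
    have h2 := h1.smul (hUc.differentiable (by simp) p).hasFDerivAt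
    rw [HasFDerivAt.fderiv (f := u) h2]
    simp
  have hv : ∀ i, |((![((1 : ℝ), (0 : ℝ)), (0, 1)] : Fin 2 → ℝ × ℝ) i).1| ≤ 1 := by
    intro i; fin_cases i <;> simp
  have hduE : ∀ i, ∀ p : ℝ × ℝ, p.2 ∈ J →
      ‖fderiv ℝ u p (![((1 : ℝ), (0 : ℝ)), (0, 1)] i)‖ₑ ^ 2 ≤ E p := by
    intro i p hp
    rw [hd]
    by_cases hx : |p.1| ≤ 1 / 2
    · refine (enorm_add_sq_le _ _).trans ?_
      have h1 := (hsm (hχD p.1) (fderiv ℝ U p (![((1 : ℝ), (0 : ℝ)), (0, 1)] i))).trans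
        (mul_le_mul_right ((hbound g hg hgl ε hε p hp (hX1 _ hx)).2 i) _)
      have h2 := (hsm (a := deriv χ p.1 * (![((1 : ℝ), (0 : ℝ)), (0, 1)] i).1) (by
        rw [abs_mul]
        exact (mul_le_of_le_one_right (abs_nonneg _) (hv i)).trans (hχD' _)) (U p)).trans
        (mul_le_mul_right (hUb p hx hp) _)
      simp only [hE]
      rw [indicator_of_mem (hmem hx)]
      refine (add_le_add (mul_le_mul_right h1 _) (mul_le_mul_right h2 _)).trans ?_
      refine (le_of_eq (add_comm _ _)).trans ?_
      rw [mul_add (4 * D')]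
      refine add_le_add (le_of_eq (by ring)) ?_
      rw [← mul_assoc]
      exact mul_le_mul' (mul_le_mul' (by norm_num) le_rfl) le_rfl
    · simp [(hχz _ (not_le.1 hx)).1, (hχz _ (not_le.1 hx)).2]
  have hmJ : MeasurableSet (Ix ×ˢ J) := hIx.prod hJo.measurableSet
  refine ⟨u, huc, ?_, fun i => ?_, ?_⟩
  · exact (setLIntegral_mono' hmJ fun p hp => huE p hp.2).trans hEint
  · exact (setLIntegral_mono' hmJ fun p hp => hduE i p hp.2).trans hEint
  -- At x = 0 the averaging scale is ε, so the boundary error is O(ε).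
  · have h0 : smoothAbs ε 0 = ε := by
      rw [smoothAbs]; simp [Real.sqrt_sq hε.le]
    calc ∫⁻ z in J, ‖u (0, z) - g z‖ₑ ^ 2
        ≤ ∫⁻ z in J, ENNReal.ofReal ε * A' * q z := by
          refine setLIntegral_mono' hJo.measurableSet fun z hz => ?_
          have h1 := (hbound g hg hgl ε hε (0, z) hz (hX1 0 (by simp))).1
          simp only [hu, hχ0, one_smul]
          refine h1.trans (mul_le_mul_left ?_ _)
          rw [hA', ← ENNReal.ofReal_mul hε.le, h0]
          refine ENNReal.ofReal_le_ofReal ?_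
          nlinarith [le_abs_self A]
      _ ≤ _ := by
          rw [lintegral_const_mul _ hqm, mul_assoc]
          gcongr
          refine (mul_le_mul_right hqN _).trans ?_
          rw [hK]
          exact le_add_self

/-- The regularizations of g are bounded in H¹ and their traces tend to g in L², so g is a trace by
`exists_of_tendsto_of_bounded`. -/
theorem traceOp_surjective {Ix J : Set ℝ} (h : IsStrip Ix J) :
    Function.Surjective (traceOp h) := by
  intro G
  -- Extension by zero makes g locally integrable on ℝ; only its values in J enter the H^{1/2} norm.
  set g : ℝ → ℂ := J.indicator (G.1.fst : ℝ → ℂ) with hgdef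
  have hJm := h.isOpen_right.measurableSet
  have hg : Measurable g := (Lp.stronglyMeasurable G.1.fst).measurable.indicator hJm
  have hgG : g =ᵐ[volume.restrict J] (G.1.fst : ℝ → ℂ) := by
    filter_upwards [ae_restrict_mem hJm] with z hz
    exact indicator_of_mem hz _
  have hg2 : MemLp g 2 volume := by
    rw [hgdef, memLp_indicator_iff_restrict hJm]
    exact Lp.memLp _
  have hgl : LocallyIntegrable g := hg2.locallyIntegrable (by norm_num)
  have hN : slobodeckijSq J g < ⊤ := by
    have e : slobodeckijSq J g = ‖G‖ₑ ^ 2 := by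
      rw [enorm_H12_sq, slobodeckijSq]
      congr 1
      · exact lintegral_congr_ae (by filter_upwards [hgG] with z hz; rw [hz])
      · refine lintegral_congr_ae ?_
        have hG := G.2
        change G.1.snd =ᵐ[_] _ at hG
        filter_upwards [hG, ae_restrict_mem (hJm.prod hJm)] with p h1 h2
        rw [h1, hgdef, indicator_of_mem h2.1, indicator_of_mem h2.2]
    rw [e]; finiteness
  obtain ⟨K, hK, hreg⟩ := exists_regularization h.isOpen_left.measurableSet h.isOpen_right
    h.ordConnected_right h.nonempty_right hg hgl hN
  have hεn : ∀ n : ℕ, (1 / ((n : ℝ) + 2)) ∈ Ioc (0 : ℝ) (1 / 2) := fun n =>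
    ⟨by positivity, one_div_le_one_div_of_le two_pos (by linarith [n.cast_nonneg (α := ℝ)])⟩
  choose u huc hu0 hu1 hut using fun n => hreg _ (hεn n)
  have m0 : ∀ n, MemLp (u n) 2 (volume.restrict (Ix ×ˢ J)) := fun n =>
    memLp_two_of_lintegral (huc n).continuous.aestronglyMeasurable ((hu0 n).trans_lt hK.lt_top)
  have m1 : ∀ n i, MemLp (fun p => fderiv ℝ (u n) p (![((1 : ℝ), (0 : ℝ)), (0, 1)] i)) 2
      (volume.restrict (Ix ×ˢ J)) := fun n i =>
    memLp_two_of_lintegral (continuous_fderiv_apply (huc n) _).aestronglyMeasurable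
      ((hu1 n i).trans_lt hK.lt_top)
  set W : ℕ → H1 (Ix ×ˢ J) := fun n =>
    smoothSobolev h.isOpen_prod _ ((huc n).of_le (by simp)).contDiffOn (m0 n) (m1 n) with hW
  -- The trace is regarded with values in L², where convergence of the traces is known. `H12_ext`
  -- returns to H^{1/2} at the end.
  let T : H1 (Ix ×ˢ J) →L[ℂ] L2 J :=
    ⟨{ toFun := fun w => (traceOp h w).1.fst
       map_add' := fun a b => by rw [map_add]; rfl
       map_smul' := fun a b => by rw [map_smul]; rfl },
     (continuous_H12_fst J).comp (traceOp h).continuous⟩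
  have hWb : ∀ n, ‖W n‖ ≤ √(3 * K).toReal := by
    intro n
    have h1 : ‖W n‖ₑ ^ 2 ≤ 3 * K := by
      have e : (3 : ℝ≥0∞) * K = K + K + K := by ring
      rw [enorm_dirSobolev_sq, e]
      refine add_le_add (add_le_add ?_ ?_) ?_
      · refine (lintegral_congr_ae ?_).le.trans (hu0 n)
        filter_upwards [smoothSobolev_coe h.isOpen_prod ![((1 : ℝ), (0 : ℝ)), (0, 1)]
          ((huc n).of_le (by simp)).contDiffOn (m0 n) (m1 n)] with p hp
        rw [← hp]
      · refine (lintegral_congr_ae ?_).le.trans (hu1 n 0)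
        filter_upwards [smoothSobolev_coe_succ h.isOpen_prod ![((1 : ℝ), (0 : ℝ)), (0, 1)]
          ((huc n).of_le (by simp)).contDiffOn (m0 n) (m1 n) 0] with p hp
        rw [← hp]; rfl
      · refine (lintegral_congr_ae ?_).le.trans (hu1 n 1)
        filter_upwards [smoothSobolev_coe_succ h.isOpen_prod ![((1 : ℝ), (0 : ℝ)), (0, 1)]
          ((huc n).of_le (by simp)).contDiffOn (m0 n) (m1 n) 1] with p hp
        rw [← hp]; rfl
    refine Real.le_sqrt_of_sq_le ?_
    have h2 := ENNReal.toReal_mono (by finiteness) h1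
    rwa [ENNReal.toReal_pow, toReal_enorm] at h2
  have hlim : Tendsto (fun n => T (W n)) atTop (𝓝 G.1.fst) := by
    refine tendsto_of_tendsto_enorm_sub_sq ?_
    have h1 : Tendsto (fun n : ℕ => ENNReal.ofReal (1 / ((n : ℝ) + 2)) * K) atTop (𝓝 0) := by
      have h2 : Tendsto (fun n : ℕ => 1 / ((n : ℝ) + 2)) atTop (𝓝 0) := by
        simp only [one_div]
        exact tendsto_inv_atTop_zero.comp
          (tendsto_atTop_add_const_right _ _ tendsto_natCast_atTop_atTop)
      have h3 := ENNReal.Tendsto.mul_const (b := K) (ENNReal.tendsto_ofReal h2) (Or.inr hK)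
      simpa using h3
    refine tendsto_of_tendsto_of_tendsto_of_le_of_le tendsto_const_nhds h1
      (fun _ => zero_le) fun n => ?_
    dsimp only
    rw [← lintegral_coeFn_sub_sq]
    refine (lintegral_congr_ae ?_).le.trans (hut n)
    filter_upwards [traceOp_smooth h (huc n) (m0 n) (m1 n), hgG] with z h4 h5
    rw [h5, ← h4]; rfl
  obtain ⟨v, hv⟩ := exists_of_tendsto_of_bounded T hWb hlim
  exact ⟨v, H12_ext hv⟩

/-- A surjective operator between Hilbert spaces has a bounded right inverse. -/
theorem exists_rightInverse {H G : Type*} [NormedAddCommGroup H] [InnerProductSpace ℂ H]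
    [CompleteSpace H] [NormedAddCommGroup G] [NormedSpace ℂ G] [CompleteSpace G]
    (T : H →L[ℂ] G) (hT : Function.Surjective T) : ∃ R : G →L[ℂ] H, ∀ g, T (R g) = g := by
  set N := LinearMap.ker T.toLinearMap with hN
  have hNc : IsClosed (N : Set H) := T.isClosed_ker
  have : CompleteSpace N := hNc.completeSpace_coe
  -- On the orthogonal complement of its kernel the operator is bijective, and the open mapping
  -- theorem bounds the inverse.
  set S : Nᗮ →L[ℂ] G := T.comp Nᗮ.subtypeL with hS
  have hk : LinearMap.ker S.toLinearMap = ⊥ := by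
    rw [LinearMap.ker_eq_bot']
    intro x hx
    have h1 : (x : H) ∈ N := hx
    have h2 : (x : H) ∈ N ⊓ Nᗮ := ⟨h1, x.2⟩
    rw [Submodule.inf_orthogonal_eq_bot] at h2
    exact Subtype.ext h2
  have hr : LinearMap.range S.toLinearMap = ⊤ := by
    rw [LinearMap.range_eq_top]
    intro g
    obtain ⟨x, hx⟩ := hT g
    obtain ⟨a, ha, b, hb, rfl⟩ := N.exists_add_mem_mem_orthogonal x
    refine ⟨⟨b, hb⟩, ?_⟩
    have ha' : T a = 0 := ha
    rw [map_add, ha', zero_add] at hx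
    exact hx
  let e := ContinuousLinearEquiv.ofBijective S hk hr
  exact ⟨Nᗮ.subtypeL.comp (e.symm : G →L[ℂ] Nᗮ), fun g => e.apply_symm_apply g⟩

end AnisoTrace

/-! ### The shear as a measure-preserving map -/

namespace AnisoTrace

/-- The intervals (0, 1] and (t, t + 1] are both fundamental domains for the integer translations,
so a periodic set has the same measure in each. -/
theorem map_fract_add (t : ℝ) : unitMeas.map (fun s => Int.fract (t + s)) = unitMeas := by
  have hm : Measurable fun s : ℝ => Int.fract (t + s) := by fun_prop
  refine Measure.ext fun A hA => ?_
  have hB : MeasurableSet {τ : ℝ | Int.fract τ ∈ A} := measurable_fract hA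
  have hinv : ∀ g : AddSubgroup.zmultiples (1 : ℝ),
      (fun x => g +ᵥ x) ⁻¹' {τ : ℝ | Int.fract τ ∈ A} = {τ : ℝ | Int.fract τ ∈ A} := by
    rintro ⟨g, n, rfl⟩
    ext x
    simp only [zsmul_eq_mul, mul_one, mem_preimage, mem_ofPred_eq]
    have : (⟨(n : ℝ), n, by simp⟩ : AddSubgroup.zmultiples (1 : ℝ)) +ᵥ x = x + n := by
      rw [AddSubgroup.vadd_def, vadd_eq_add, add_comm]
    rw [this, Int.fract_add_intCast]
  have h1 := (isAddFundamentalDomain_Ioc one_pos t).measure_set_eq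
    (isAddFundamentalDomain_Ioc one_pos 0) hB hinv
  rw [Measure.map_apply hm hA, unitMeas, Measure.restrict_congr_set Ioo_ae_eq_Ioc,
    Measure.restrict_apply (hm hA), Measure.restrict_apply hA]
  have h2 : (fun s => Int.fract (t + s)) ⁻¹' A ∩ Ioc 0 1
      = (fun s => t + s) ⁻¹' ({τ : ℝ | Int.fract τ ∈ A} ∩ Ioc t (t + 1)) := by
    ext s
    simp
  have h3 : volume ({τ : ℝ | Int.fract τ ∈ A} ∩ Ioc 0 (0 + 1)) = volume (A ∩ Ioc 0 1) := by
    rw [zero_add]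
    have h4 : ∀ S : Set ℝ, volume (S ∩ Ioc 0 1) = volume (S ∩ Ioo 0 1) := fun S =>
      measure_congr ((ae_eq_refl _).inter Ioo_ae_eq_Ioc.symm)
    rw [h4, h4]
    congr 1
    ext s
    simp only [mem_inter_iff, mem_ofPred_eq, and_congr_left_iff]
    intro hs
    rw [Int.fract_eq_self.2 ⟨hs.1.le, hs.2⟩]
  rw [h2, measure_preimage_add, h1, h3]

/-- The skew shift on a product with the unit interval, over a map `f` of the base. -/
theorem measurePreserving_skew_fract {β β' : Type*} [MeasurableSpace β] [MeasurableSpace β']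
    {μ : Measure β} {μ' : Measure β'} [SFinite μ] {f : β → β'} (hf : MeasurePreserving f μ μ')
    {a : β → ℝ} (ha : Measurable a) :
    MeasurePreserving (fun q : ℝ × β => (f q.2, Int.fract (a q.2 + q.1)))
      (unitMeas.prod μ) (μ'.prod unitMeas) := by
  have h1 : MeasurePreserving (fun p : β × ℝ => (f p.1, Int.fract (a p.1 + p.2)))
      (μ.prod unitMeas) (μ'.prod unitMeas) := by
    refine hf.skew_product (g := fun b s => Int.fract (a b + s)) ?_
      (ae_of_all _ fun b => map_fract_add (a b))
    simp only [Function.uncurry_def]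
    fun_prop
  exact h1.comp Measure.measurePreserving_swap

/-- The Jacobian of the shear. -/
noncomputable def Cut.jac (c : Cut) : ℝ≥0∞ := ENNReal.ofReal |c.θ₁⁻¹|

theorem Cut.jac_ne_zero (c : Cut) : c.jac ≠ 0 := by
  simp [Cut.jac, c.ne]

theorem Cut.jac_ne_top (c : Cut) : c.jac ≠ ⊤ := ENNReal.ofReal_ne_top

theorem measurePreserving_edge (c : Cut) {I₁ : Set ℝ} (h : MeasurableSet I₁) :
    MeasurePreserving (fun z => c.θ₁ * z) (volume.restrict (edge c I₁))
      (c.jac • volume.restrict I₁) := by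
  have h1 : MeasurePreserving (fun z => c.θ₁ * z) volume (c.jac • (volume : Measure ℝ)) :=
    ⟨measurable_const_mul _, Real.map_volume_mul_left c.ne⟩
  have := h1.restrict_preimage h
  rwa [Measure.restrict_smul] at this

/-- A skew product: z ↦ θ₁ z scales the base by the Jacobian, and for fixed z the map s ↦ fract (θ₂
z + s) is a rotation of the circle. -/
theorem measurePreserving_shearPtSigma (c : Cut) {I₁ : Set ℝ} (h : MeasurableSet I₁) :
    MeasurePreserving (shearPtSigma c) (unitMeas.prod (volume.restrict (edge c I₁)))
      (c.jac • volume.restrict (SigmaPer I₁)) := by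
  have h1 := measurePreserving_skew_fract (measurePreserving_edge c h)
    (a := fun z => c.θ₂ * z) (by fun_prop)
  have h2 : (c.jac • volume.restrict I₁).prod unitMeas
      = c.jac • volume.restrict (SigmaPer I₁) := by
    rw [Measure.prod_smul_left, Measure.prod_restrict]; rfl
  rwa [h2] at h1

theorem restrict_prod_real (s t : Set ℝ) : (volume.restrict (s ×ˢ t) : Measure (ℝ × ℝ))
    = (volume.restrict s).prod (volume.restrict t) := by
  rw [Measure.prod_restrict]; rfl

theorem measurePreserving_shearPt (c : Cut) {Ix I₁ : Set ℝ} (h : MeasurableSet I₁) :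
    MeasurePreserving (shearPt c) (unitMeas.prod (volume.restrict (Q c Ix I₁)))
      (c.jac • volume.restrict (OmegaPer Ix I₁)) := by
  have h0 := (MeasurePreserving.id (volume.restrict Ix)).prod (measurePreserving_edge c h)
  have h1 := measurePreserving_skew_fract h0 (a := fun x : ℝ × ℝ => c.θ₂ * x.2) (by fun_prop)
  have h2 := (measurePreserving_prodAssoc (volume.restrict Ix) (c.jac • volume.restrict I₁)
    unitMeas).comp h1
  have h3 : (volume.restrict Ix).prod ((c.jac • volume.restrict I₁).prod unitMeas)
      = c.jac • volume.restrict (OmegaPer Ix I₁) := by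
    rw [Measure.prod_smul_left, Measure.prod_smul_right, Measure.prod_restrict,
      Measure.prod_restrict]; rfl
  rw [h3] at h2
  rw [Q, restrict_prod_real]
  exact h2

/-- The inverse of the shear. -/
noncomputable def unshearPt (c : Cut) (p : ℝ × ℝ × ℝ) : ℝ × ℝ × ℝ :=
  (Int.fract (p.2.2 - c.θ₂ * (p.2.1 / c.θ₁)), p.1, p.2.1 / c.θ₁)

noncomputable def unshearPtSigma (c : Cut) (p : ℝ × ℝ) : ℝ × ℝ :=
  (Int.fract (p.2 - c.θ₂ * (p.1 / c.θ₁)), p.1 / c.θ₁)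

theorem fract_fract_sub (a s : ℝ) (hs : s ∈ Ioo (0 : ℝ) 1) :
    Int.fract (Int.fract (a + s) - a) = s := by
  have : Int.fract (a + s) - a = s - (⌊a + s⌋ : ℤ) := by rw [Int.fract]; ring
  rw [this, Int.fract_sub_intCast, Int.fract_eq_self.2 ⟨hs.1.le, hs.2⟩]

theorem unshearPt_shearPt (c : Cut) {q : ℝ × ℝ × ℝ} (hq : q.1 ∈ Ioo (0 : ℝ) 1) :
    unshearPt c (shearPt c q) = q := by
  simp only [unshearPt, shearPt, mul_div_cancel_left₀ _ c.ne]
  rw [fract_fract_sub _ _ hq]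

theorem unshearPtSigma_shearPtSigma (c : Cut) {q : ℝ × ℝ} (hq : q.1 ∈ Ioo (0 : ℝ) 1) :
    unshearPtSigma c (shearPtSigma c q) = q := by
  simp only [unshearPtSigma, shearPtSigma, mul_div_cancel_left₀ _ c.ne]
  rw [fract_fract_sub _ _ hq]

/-! ### Elements of L²(μ; L²(ν)) as functions of two variables -/

section Uncurry

variable {α β : Type*} [MeasurableSpace α] [MeasurableSpace β] {μ : Measure α} {ν : Measure β}
  [SFinite μ] [SFinite ν]

theorem enorm_eq_of_uncurry {F : Lp (Lp ℂ 2 ν) 2 μ} {f : Lp ℂ 2 (μ.prod ν)}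
    (h : ∀ᵐ s ∂μ, ∀ᵐ x ∂ν, f (s, x) = F s x) : ‖f‖ₑ ^ 2 = ‖F‖ₑ ^ 2 := by
  have hf : Measurable fun q => ‖f q‖ₑ ^ 2 := (Lp.stronglyMeasurable f).measurable.enorm.pow_const 2
  rw [enorm_Lp_sq, enorm_Lp_sq, lintegral_prod _ hf.aemeasurable]
  refine lintegral_congr_ae ?_
  filter_upwards [h] with s hs
  rw [enorm_Lp_sq]
  refine lintegral_congr_ae ?_
  filter_upwards [hs] with x hx
  rw [hx]

theorem uncurry_sub {F G : Lp (Lp ℂ 2 ν) 2 μ} {f g : Lp ℂ 2 (μ.prod ν)}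
    (hf : ∀ᵐ s ∂μ, ∀ᵐ x ∂ν, f (s, x) = F s x) (hg : ∀ᵐ s ∂μ, ∀ᵐ x ∂ν, g (s, x) = G s x) :
    ∀ᵐ s ∂μ, ∀ᵐ x ∂ν, (f - g) (s, x) = (F - G) s x := by
  filter_upwards [hf, hg, Lp.coeFn_sub F G, Measure.ae_ae_of_ae_prod (Lp.coeFn_sub f g)]
    with s h1 h2 h3 h4
  filter_upwards [h1, h2, h4, Lp.coeFn_sub (F s) (G s)] with x h5 h6 h7 h8
  rw [h7, h3, Pi.sub_apply, Pi.sub_apply, h8, Pi.sub_apply, h5, h6]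

theorem uncurry_add {F G : Lp (Lp ℂ 2 ν) 2 μ} {f g : Lp ℂ 2 (μ.prod ν)}
    (hf : ∀ᵐ s ∂μ, ∀ᵐ x ∂ν, f (s, x) = F s x) (hg : ∀ᵐ s ∂μ, ∀ᵐ x ∂ν, g (s, x) = G s x) :
    ∀ᵐ s ∂μ, ∀ᵐ x ∂ν, (f + g) (s, x) = (F + G) s x := by
  filter_upwards [hf, hg, Lp.coeFn_add F G, Measure.ae_ae_of_ae_prod (Lp.coeFn_add f g)]
    with s h1 h2 h3 h4
  filter_upwards [h1, h2, h4, Lp.coeFn_add (F s) (G s)] with x h5 h6 h7 h8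
  rw [h7, h3, Pi.add_apply, Pi.add_apply, h8, Pi.add_apply, h5, h6]

/-- Passing to a joint function preserves norms, so the joint functions of a convergent sequence
form a Cauchy sequence; its limit must be matched with the Bochner limit on almost every slice. -/
theorem isClosed_uncurry : IsClosed {F : Lp (Lp ℂ 2 ν) 2 μ |
    ∃ f : Lp ℂ 2 (μ.prod ν), ∀ᵐ s ∂μ, ∀ᵐ x ∂ν, f (s, x) = F s x} := by
  refine IsSeqClosed.isClosed fun F G hF hFG => ?_
  choose f hf using hF
  have hd : ∀ m n, ‖f m - f n‖ = ‖F m - F n‖ := fun m n => by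
    have h1 := enorm_eq_of_uncurry (uncurry_sub (hf m) (hf n))
    rw [← ofReal_norm, ← ofReal_norm, ← ENNReal.ofReal_pow (norm_nonneg _),
      ← ENNReal.ofReal_pow (norm_nonneg _),
      ENNReal.ofReal_eq_ofReal_iff (by positivity) (by positivity)] at h1
    exact (pow_left_inj₀ (norm_nonneg _) (norm_nonneg _) two_ne_zero).1 h1
  have hc : CauchySeq f := by
    have h1 := hFG.cauchySeq
    rw [Metric.cauchySeq_iff] at h1 ⊢
    intro ε hε
    obtain ⟨N, hN⟩ := h1 ε hε
    refine ⟨N, fun m hm n hn => ?_⟩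
    rw [dist_eq_norm, hd, ← dist_eq_norm]
    exact hN m hm n hn
  obtain ⟨g, hg⟩ := cauchySeq_tendsto_of_complete hc
  refine ⟨g, ?_⟩
  have hfm : ∀ n, Measurable fun q => ‖f n q - g q‖ₑ ^ 2 := fun n =>
    (((Lp.stronglyMeasurable (f n)).measurable.sub
      (Lp.stronglyMeasurable g).measurable).enorm.pow_const 2)
  -- For every n this dominates the squared distance between the slices of the two limits. Its
  -- integral tends to 0, so the infimum over n vanishes for almost every s, without extracting a
  -- subsequence.
  set h : ℕ → α → ℝ≥0∞ := fun n s =>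
    2 * (∫⁻ x, ‖f n (s, x) - g (s, x)‖ₑ ^ 2 ∂ν) + 2 * ‖(F n - G) s‖ₑ ^ 2 with hh
  have m1 : ∀ n, Measurable fun s => ∫⁻ x, ‖f n (s, x) - g (s, x)‖ₑ ^ 2 ∂ν := fun n =>
    (hfm n).lintegral_prod_right'
  have m2 : ∀ n, Measurable fun s => ‖(F n - G) s‖ₑ ^ 2 := fun n =>
    (Lp.stronglyMeasurable (F n - G)).enorm.pow_const 2
  have hhm : ∀ n, Measurable (h n) := fun n => ((m1 n).const_mul 2).add ((m2 n).const_mul 2)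
  have hint : ∀ n, ∫⁻ s, h n s ∂μ = 2 * ‖f n - g‖ₑ ^ 2 + 2 * ‖F n - G‖ₑ ^ 2 := fun n => by
    simp only [hh]
    rw [lintegral_add_left ((m1 n).const_mul 2), lintegral_const_mul _ (m1 n),
      lintegral_const_mul _ (m2 n), ← lintegral_prod _ (hfm n).aemeasurable,
      lintegral_coeFn_sub_sq, ← enorm_Lp_sq]
  have hlim : Tendsto (fun n => ∫⁻ s, h n s ∂μ) atTop (𝓝 0) := by
    simp only [hint]
    have l1 := ENNReal.Tendsto.const_mul (a := 2) (tendsto_enorm_sub_sq hg) (Or.inr (by simp))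
    have l2 := ENNReal.Tendsto.const_mul (a := 2) (tendsto_enorm_sub_sq hFG) (Or.inr (by simp))
    simpa using l1.add l2
  have hzero : ∫⁻ s, ⨅ n, h n s ∂μ = 0 := by
    refine le_antisymm (ge_of_tendsto' hlim fun n => ?_) zero_le
    exact lintegral_mono fun s => iInf_le _ n
  rw [lintegral_eq_zero_iff (Measurable.iInf hhm)] at hzero
  filter_upwards [hzero, ae_all_iff.2 hf, ae_all_iff.2 fun n => Lp.coeFn_sub (F n) G]
    with s h1 h2 h3
  have hgs : AEMeasurable (fun x => ‖g (s, x) - G s x‖ₑ ^ 2) ν :=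
    (((Lp.stronglyMeasurable g).measurable.comp measurable_prodMk_left).sub
      (Lp.stronglyMeasurable (G s)).measurable).enorm.pow_const 2 |>.aemeasurable
  have hle : ∫⁻ x, ‖g (s, x) - G s x‖ₑ ^ 2 ∂ν ≤ ⨅ n, h n s := by
    refine le_iInf fun n => ?_
    simp only [hh]
    have k1 : Measurable fun x => ‖f n (s, x) - g (s, x)‖ₑ ^ 2 :=
      (hfm n).comp measurable_prodMk_left
    have k2 : Measurable fun x => ‖F n s x - G s x‖ₑ ^ 2 :=
      ((Lp.stronglyMeasurable (F n s)).measurable.sub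
        (Lp.stronglyMeasurable (G s)).measurable).enorm.pow_const 2
    rw [h3 n, Pi.sub_apply, ← lintegral_coeFn_sub_sq, ← lintegral_const_mul _ k1,
      ← lintegral_const_mul _ k2, ← lintegral_add_left (k1.const_mul 2)]
    refine lintegral_mono_ae ?_
    filter_upwards [h2 n] with x hx
    have e : g (s, x) - G s x = -(f n (s, x) - g (s, x)) + (F n s x - G s x) := by
      rw [hx]; ring
    rw [e]
    refine (enorm_add_sq_le _ _).trans (le_of_eq ?_)
    rw [enorm_neg]
  have h0 : ∫⁻ x, ‖g (s, x) - G s x‖ₑ ^ 2 ∂ν = 0 := by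
    refine le_antisymm (hle.trans (le_of_eq ?_)) zero_le
    exact h1
  rw [lintegral_eq_zero_iff' hgs] at h0
  filter_upwards [h0] with x hx
  simpa [sub_eq_zero] using hx

/-- Elements of the Bochner space `L²(μ; L²(ν))` are functions of two variables. -/
theorem exists_uncurry (F : Lp (Lp ℂ 2 ν) 2 μ) :
    ∃ f : Lp ℂ 2 (μ.prod ν), ∀ᵐ s ∂μ, ∀ᵐ x ∂ν, f (s, x) = F s x := by
  refine Lp.induction (by norm_num) (fun F : Lp (Lp ℂ 2 ν) 2 μ => ∃ f : Lp ℂ 2 (μ.prod ν),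
    ∀ᵐ s ∂μ, ∀ᵐ x ∂ν, f (s, x) = F s x) ?_ ?_ isClosed_uncurry F
  · intro c A hA hμA
    set f : α × β → ℂ := fun q => A.indicator (fun _ => c q.2) q.1 with hf
    have hfm : Measurable f := by
      have : f = (A ×ˢ univ).indicator fun q : α × β => c q.2 := by
        ext q
        by_cases hq : q.1 ∈ A
        · rw [hf, indicator_of_mem (show q ∈ A ×ˢ univ from ⟨hq, trivial⟩)]
          exact indicator_of_mem hq _
        · rw [hf, indicator_of_notMem fun h => hq h.1]
          exact indicator_of_notMem hq _
      rw [this]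
      exact ((Lp.stronglyMeasurable c).measurable.comp measurable_snd).indicator (hA.prod .univ)
    have hf2 : MemLp f 2 (μ.prod ν) := by
      refine memLp_two_of_lintegral hfm.aestronglyMeasurable ?_
      rw [lintegral_prod _ (hfm.enorm.pow_const 2).aemeasurable]
      have e : ∀ s, ∫⁻ x, ‖f (s, x)‖ₑ ^ 2 ∂ν = A.indicator (fun _ => ‖c‖ₑ ^ 2) s := by
        intro s
        by_cases hs : s ∈ A
        · simp only [hf, indicator_of_mem hs]
          rw [enorm_Lp_sq]
        · simp [hf, indicator_of_notMem hs]
      simp only [e]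
      rw [lintegral_indicator hA, setLIntegral_const]
      exact ENNReal.mul_lt_top (by finiteness) hμA
    refine ⟨hf2.toLp f, ?_⟩
    have h1 := Lp.simpleFunc.coe_indicatorConst (p := 2) hA hμA.ne c
    filter_upwards [indicatorConstLp_coeFn (p := 2) (hs := hA) (hμs := hμA.ne) (c := c),
      Measure.ae_ae_of_ae_prod hf2.coeFn_toLp] with s h2 h3
    rw [h1, h2]
    filter_upwards [h3, Lp.coeFn_zero ℂ 2 ν] with x hx hx0
    rw [hx]
    by_cases hs : s ∈ A
    · simp only [hf, indicator_of_mem hs]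
    · simp only [hf, indicator_of_notMem hs]
      exact hx0.symm
  · rintro f g hf hg - ⟨f', hf'⟩ ⟨g', hg'⟩
    exact ⟨f' + g', uncurry_add hf' hg'⟩

end Uncurry

end AnisoTrace

namespace AnisoTrace

/-! ### Transport between L²(0, 1; L²(B)) and L²(O) -/

section Shear

variable {β γ : Type*} [MeasureSpace β] [MeasureSpace γ] [SFinite (volume : Measure β)]
  {B : Set β} {O : Set γ} {S : ℝ × β → γ} {R : γ → ℝ × β} {κ : ℝ≥0∞}

theorem enorm_sq_of_shear
    (hS : MeasurePreserving S (unitMeas.prod (volume.restrict B)) (κ • volume.restrict O))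
    {F : Lp (L2 B) 2 unitMeas} {V : L2 O}
    (h : ∀ᵐ s ∂unitMeas, ∀ᵐ x ∂volume.restrict B, F s x = V (S (s, x))) :
    ‖F‖ₑ ^ 2 = κ * ‖V‖ₑ ^ 2 := by
  have hm : Measurable fun p => ‖V p‖ₑ ^ 2 :=
    (Lp.stronglyMeasurable V).measurable.enorm.pow_const 2
  have h1 := hS.lintegral_comp hm
  rw [lintegral_smul_measure, smul_eq_mul, ← enorm_Lp_sq,
    lintegral_prod (fun q => ‖V (S q)‖ₑ ^ 2) (hm.comp hS.measurable).aemeasurable] at h1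
  rw [← h1, enorm_Lp_sq]
  refine lintegral_congr_ae ?_
  filter_upwards [h] with s hs
  rw [enorm_Lp_sq]
  refine lintegral_congr_ae ?_
  filter_upwards [hs] with x hx
  rw [hx]

theorem ae_of_shear (hκ : κ ≠ 0)
    (hS : MeasurePreserving S (unitMeas.prod (volume.restrict B)) (κ • volume.restrict O))
    {p : γ → Prop} (h : ∀ᵐ x ∂volume.restrict O, p x) :
    ∀ᵐ s ∂unitMeas, ∀ᵐ x ∂volume.restrict B, p (S (s, x)) := by
  refine Measure.ae_ae_of_ae_prod (p := fun q => p (S q)) ?_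
  refine hS.quasiMeasurePreserving.ae ?_
  rwa [Measure.ae_ennreal_smul_measure_iff hκ]

/-- The difference V - W has shear 0, and the norm identity with κ ≠ 0 makes it vanish. -/
theorem shear_unique (hκ : κ ≠ 0)
    (hS : MeasurePreserving S (unitMeas.prod (volume.restrict B)) (κ • volume.restrict O))
    {F : Lp (L2 B) 2 unitMeas} {V W : L2 O}
    (hV : ∀ᵐ s ∂unitMeas, ∀ᵐ x ∂volume.restrict B, F s x = V (S (s, x)))
    (hW : ∀ᵐ s ∂unitMeas, ∀ᵐ x ∂volume.restrict B, F s x = W (S (s, x))) : V = W := by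
  have h1 : ∀ᵐ s ∂unitMeas, ∀ᵐ x ∂volume.restrict B,
      (0 : Lp (L2 B) 2 unitMeas) s x = (V - W) (S (s, x)) := by
    filter_upwards [hV, hW, ae_of_shear hκ hS (Lp.coeFn_sub V W),
      Lp.coeFn_zero (L2 B) 2 unitMeas] with s a1 a2 a3 a4
    rw [a4]
    filter_upwards [a1, a2, a3, Lp.coeFn_zero ℂ 2 (volume.restrict B)] with x b1 b2 b3 b4
    rw [b3, Pi.sub_apply, ← b1, ← b2, sub_self]
    exact b4
  have h2 := enorm_sq_of_shear hS h1
  rw [enorm_zero, zero_pow two_ne_zero] at h2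
  have h3 : ‖V - W‖ₑ = 0 := by
    have := mul_eq_zero.1 h2.symm
    simpa [hκ] using this
  rwa [enorm_eq_zero, sub_eq_zero] at h3

/-- A joint representative of F is composed with the left inverse R. Measure preservation puts the
result in L²(O) and makes it agree with F after composition with S, so surjectivity of S need not be
discussed. -/
theorem exists_unshear (hκ : κ ≠ 0) (hκt : κ ≠ ⊤)
    (hS : MeasurePreserving S (unitMeas.prod (volume.restrict B)) (κ • volume.restrict O))
    (hR : Measurable R) (hRS : ∀ q : ℝ × β, q.1 ∈ Ioo (0 : ℝ) 1 → R (S q) = q)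
    (F : Lp (L2 B) 2 unitMeas) :
    ∃ V : L2 O, ∀ᵐ s ∂unitMeas, ∀ᵐ x ∂volume.restrict B, F s x = V (S (s, x)) := by
  obtain ⟨f, hf⟩ := exists_uncurry F
  have hfm : StronglyMeasurable fun p => f (R p) := (Lp.stronglyMeasurable f).comp_measurable hR
  have hq : ∀ᵐ q ∂unitMeas.prod (volume.restrict B), q.1 ∈ Ioo (0 : ℝ) 1 :=
    Measure.quasiMeasurePreserving_fst.ae (ae_restrict_mem measurableSet_Ioo)
  have h1 : MemLp (fun p => f (R p)) 2 (κ • volume.restrict O) := by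
    refine memLp_two_of_lintegral hfm.aestronglyMeasurable ?_
    rw [← hS.lintegral_comp (hfm.measurable.enorm.pow_const 2)]
    calc ∫⁻ q, ‖f (R (S q))‖ₑ ^ 2 ∂unitMeas.prod (volume.restrict B)
        = ∫⁻ q, ‖f q‖ₑ ^ 2 ∂unitMeas.prod (volume.restrict B) := by
          refine lintegral_congr_ae ?_
          filter_upwards [hq] with q h
          rw [hRS q h]
      _ < ⊤ := by
          rw [← enorm_Lp_sq]; finiteness
  have h2 : MemLp (fun p => f (R p)) 2 (volume.restrict O) := by
    have := h1.smul_measure (ENNReal.inv_ne_top.2 hκ)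
    rwa [smul_smul, ENNReal.inv_mul_cancel hκ hκt, one_smul] at this
  refine ⟨h2.toLp _, ?_⟩
  filter_upwards [hf, ae_of_shear hκ hS h2.coeFn_toLp, ae_restrict_mem measurableSet_Ioo]
    with s a1 a2 a3
  filter_upwards [a1, a2] with x b1 b2
  rw [b2, hRS (s, x) a3, b1]

theorem integral_shear
    (hS : MeasurePreserving S (unitMeas.prod (volume.restrict B)) (κ • volume.restrict O))
    (hκt : κ ≠ ⊤) {f : γ → ℂ} (hf : Integrable f (volume.restrict O)) :
    κ.toReal • ∫ p in O, f p = ∫ s, (∫ x in B, f (S (s, x))) ∂unitMeas := by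
  have h1 : Integrable f (κ • volume.restrict O) := hf.smul_measure hκt
  rw [← integral_smul_measure, ← hS.map_eq, integral_map hS.measurable.aemeasurable
    (by rw [hS.map_eq]; exact h1.aestronglyMeasurable)]
  exact integral_prod _ (hS.integrable_comp_of_integrable h1)

end Shear

/-- A linear relation that is one to one is a linear isomorphism. -/
theorem exists_linearEquiv_of_rel {A B : Type*} [AddCommGroup A] [Module ℂ A] [AddCommGroup B]
    [Module ℂ B] {P : Submodule ℂ A} {r : A → B → Prop} (hP : ∀ a, a ∈ P ↔ ∃ b, r a b)
    (hadd : ∀ {a a' b b'}, r a b → r a' b' → r (a + a') (b + b'))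
    (hsmul : ∀ (k : ℂ) {a b}, r a b → r (k • a) (k • b))
    (h1 : ∀ {a b b'}, r a b → r a b' → b = b') (h2 : ∀ {a a' b}, r a b → r a' b → a = a')
    (h3 : ∀ b, ∃ a, r a b) : ∃ Λ : P ≃ₗ[ℂ] B, ∀ a : P, r a (Λ a) := by
  choose f hf using fun a : P => (hP a).1 a.2
  let L : P →ₗ[ℂ] B :=
    { toFun := f
      map_add' := fun a b => h1 (hf (a + b)) (hadd (hf a) (hf b))
      map_smul' := fun k a => h1 (hf (k • a)) (hsmul k (hf a)) }
  refine ⟨LinearEquiv.ofBijective L ⟨fun a b hab => ?_, fun b => ?_⟩, hf⟩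
  · have hab' : f a = f b := hab
    exact Subtype.ext (h2 (hf a) (hab' ▸ hf b))
  · obtain ⟨a, ha⟩ := h3 b
    exact ⟨⟨a, (hP a).2 ⟨b, ha⟩⟩, h1 (hf _) ha⟩

/-- The components of an element of `dirSobolev O v`. -/
noncomputable def sobolevProj {E : Type*} [NormedAddCommGroup E] [NormedSpace ℝ E] [MeasureSpace E]
    [BorelSpace E] [IsFiniteMeasureOnCompacts (volume : Measure E)] (O : Set E) (v : Fin 2 → E)
    (i : Fin 3) : dirSobolev O v →L[ℂ] L2 O :=
  ⟨{ toFun := fun U => U.1 i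
     map_add' := fun _ _ => rfl
     map_smul' := fun _ _ => rfl },
   (PiLp.continuous_apply 2 _ i).comp continuous_subtype_val⟩

/-- The inclusion of `H^{1/2}(J)` in `L²(J)`. -/
noncomputable def H12Fst (J : Set ℝ) : H12 J →L[ℂ] L2 J :=
  ⟨{ toFun := fun U => U.1.fst
     map_add' := fun _ _ => rfl
     map_smul' := fun _ _ => rfl }, continuous_H12_fst J⟩

/-! ### The shear isomorphisms -/

section Strip

variable (c : Cut) (Ix I₁ : Set ℝ)

/-- Reads the condition on the component 0 of F as an element of L²(0, 1; L²(Q_θ)), the form to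
which the general transport lemmas apply. -/
theorem isShear_iff {c : Cut} {Ix I₁ : Set ℝ} {V : L2 (OmegaPer Ix I₁)}
    {F : Lp (H1 (Q c Ix I₁)) 2 unitMeas} : IsShear c Ix I₁ V F ↔
    ∀ᵐ s ∂unitMeas, ∀ᵐ x ∂volume.restrict (Q c Ix I₁),
      (sobolevProj _ _ 0).compLp F s x = V (shearPt c (s, x)) := by
  refine eventually_congr ?_
  filter_upwards [(sobolevProj _ _ 0).coeFn_compLp F] with s hs
  rw [hs]; rfl

theorem isShearSigma_iff {c : Cut} {I₁ : Set ℝ} {V : L2 (SigmaPer I₁)}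
    {F : Lp (H12 (edge c I₁)) 2 unitMeas} : IsShearSigma c I₁ V F ↔
    ∀ᵐ s ∂unitMeas, ∀ᵐ x ∂volume.restrict (edge c I₁),
      (H12Fst _).compLp F s x = V (shearPtSigma c (s, x)) := by
  refine eventually_congr ?_
  filter_upwards [(H12Fst _).coeFn_compLp F] with s hs
  rw [hs]; rfl

theorem IsShear.add {c : Cut} {Ix I₁ : Set ℝ} {V W : L2 (OmegaPer Ix I₁)}
    {F G : Lp (H1 (Q c Ix I₁)) 2 unitMeas} (hF : IsShear c Ix I₁ V F) (hG : IsShear c Ix I₁ W G) :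
    IsShear c Ix I₁ (V + W) (F + G) := by
  filter_upwards [Lp.coeFn_add F G, ae_shear c Ix I₁ (Lp.coeFn_add V W), hF, hG]
    with s h1 h2 h3 h4
  rw [h1]
  filter_upwards [h2, Lp.coeFn_add ((F s).1 0) ((G s).1 0), h3, h4] with x a b d e
  refine (b.trans ?_).trans a.symm
  simp only [Pi.add_apply]
  rw [d, e]; rfl

theorem IsShear.smul {c : Cut} {Ix I₁ : Set ℝ} (k : ℂ) {V : L2 (OmegaPer Ix I₁)}
    {F : Lp (H1 (Q c Ix I₁)) 2 unitMeas} (hF : IsShear c Ix I₁ V F) :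
    IsShear c Ix I₁ (k • V) (k • F) := by
  filter_upwards [Lp.coeFn_smul k F, ae_shear c Ix I₁ (Lp.coeFn_smul k V), hF] with s h1 h2 h3
  rw [h1]
  filter_upwards [h2, Lp.coeFn_smul k ((F s).1 0), h3] with x a b d
  refine (b.trans ?_).trans a.symm
  simp only [Pi.smul_apply]
  rw [d]; rfl

theorem IsShearSigma.add {c : Cut} {I₁ : Set ℝ} {V W : L2 (SigmaPer I₁)}
    {F G : Lp (H12 (edge c I₁)) 2 unitMeas} (hF : IsShearSigma c I₁ V F)
    (hG : IsShearSigma c I₁ W G) : IsShearSigma c I₁ (V + W) (F + G) := by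
  filter_upwards [Lp.coeFn_add F G, ae_shearSigma c I₁ (Lp.coeFn_add V W), hF, hG]
    with s h1 h2 h3 h4
  rw [h1]
  filter_upwards [h2, Lp.coeFn_add (F s).1.fst (G s).1.fst, h3, h4] with x a b d e
  refine (b.trans ?_).trans a.symm
  simp only [Pi.add_apply]
  rw [d, e]; rfl

theorem IsShearSigma.smul {c : Cut} {I₁ : Set ℝ} (k : ℂ) {V : L2 (SigmaPer I₁)}
    {F : Lp (H12 (edge c I₁)) 2 unitMeas} (hF : IsShearSigma c I₁ V F) :
    IsShearSigma c I₁ (k • V) (k • F) := by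
  filter_upwards [Lp.coeFn_smul k F, ae_shearSigma c I₁ (Lp.coeFn_smul k V), hF] with s h1 h2 h3
  rw [h1]
  filter_upwards [h2, Lp.coeFn_smul k (F s).1.fst, h3] with x a b d
  refine (b.trans ?_).trans a.symm
  simp only [Pi.smul_apply]
  rw [d]; rfl

theorem isOpen_edge {I₁ : Set ℝ} (hI₁ : IsOpen I₁) : IsOpen (edge c I₁) :=
  hI₁.preimage (continuous_const_mul c.θ₁)

theorem isStrip_edge {Ix I₁ : Set ℝ} (hIx : IsOpen Ix) (hIx' : Ix.OrdConnected)
    (h0 : (0 : ℝ) ∈ closure Ix) (hI₁ : IsOpen I₁) (hI₁' : I₁.OrdConnected) (hne : I₁.Nonempty) :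
    IsStrip Ix (edge c I₁) where
  isOpen_left := hIx
  ordConnected_left := hIx'
  zero_mem := h0
  isOpen_right := isOpen_edge c hI₁
  ordConnected_right := by
    have h : Convex ℝ (edge c I₁) :=
      hI₁'.convex.is_linear_preimage (IsLinearMap.isLinearMap_smul c.θ₁)
    exact h.ordConnected
  nonempty_right := by
    obtain ⟨y, hy⟩ := hne
    refine ⟨y / c.θ₁, ?_⟩
    change c.θ₁ * (y / c.θ₁) ∈ I₁
    rwa [mul_div_cancel₀ _ c.ne]

theorem measurable_unshearPt : Measurable (unshearPt c) := by
  unfold unshearPt; fun_prop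

theorem measurable_unshearPtSigma : Measurable (unshearPtSigma c) := by
  unfold unshearPtSigma; fun_prop

theorem exists_unshearPt {I₁ : Set ℝ} (hI₁ : MeasurableSet I₁)
    (F : Lp (L2 (Q c Ix I₁)) 2 unitMeas) :
    ∃ V : L2 (OmegaPer Ix I₁), ∀ᵐ s ∂unitMeas, ∀ᵐ x ∂volume.restrict (Q c Ix I₁),
      F s x = V (shearPt c (s, x)) :=
  exists_unshear c.jac_ne_zero c.jac_ne_top (measurePreserving_shearPt c hI₁)
    (measurable_unshearPt c) (fun _ => unshearPt_shearPt c) F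

/-- The shear as an isomorphism. -/
theorem exists_shearEquiv {Ix I₁ : Set ℝ} (hIx : IsOpen Ix) (hI₁ : IsOpen I₁) :
    ∃ Λ : H1Cper c Ix I₁ ≃ₗ[ℂ] Lp (H1 (Q c Ix I₁)) 2 unitMeas,
      ∀ V : H1Cper c Ix I₁, IsShear c Ix I₁ V (Λ V) := by
  refine exists_linearEquiv_of_rel (P := H1Cper c Ix I₁) (r := IsShear c Ix I₁)
    (fun _ => Iff.rfl) IsShear.add IsShear.smul ?_ ?_ ?_
  · intro V F G hF hG
    refine Lp.ext ?_
    filter_upwards [hF, hG] with s h1 h2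
    exact dirSobolev_ext (hIx.prod (isOpen_edge c hI₁)) (Lp.ext (h1.trans h2.symm))
  · intro V W F hV hW
    exact shear_unique c.jac_ne_zero (measurePreserving_shearPt c hI₁.measurableSet)
      (isShear_iff.1 hV) (isShear_iff.1 hW)
  · intro F
    obtain ⟨V, hV⟩ := exists_unshearPt c Ix hI₁.measurableSet ((sobolevProj _ _ 0).compLp F)
    exact ⟨V, isShear_iff.2 hV⟩

theorem IsShearSigma.unique {I₁ : Set ℝ} {V : L2 (SigmaPer I₁)}
    {F G : Lp (H12 (edge c I₁)) 2 unitMeas} (hF : IsShearSigma c I₁ V F)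
    (hG : IsShearSigma c I₁ V G) : F = G := by
  refine Lp.ext ?_
  filter_upwards [hF, hG] with s h1 h2
  exact H12_ext (Lp.ext (h1.trans h2.symm))

theorem exists_shearSigmaEquiv {I₁ : Set ℝ} (hI₁ : MeasurableSet I₁) :
    ∃ Λ : H12Cper c I₁ ≃ₗ[ℂ] Lp (H12 (edge c I₁)) 2 unitMeas,
      ∀ V : H12Cper c I₁, IsShearSigma c I₁ V (Λ V) := by
  refine exists_linearEquiv_of_rel (P := H12Cper c I₁) (r := IsShearSigma c I₁)
    (fun _ => Iff.rfl) IsShearSigma.add IsShearSigma.smul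
    (IsShearSigma.unique c) ?_ ?_
  · intro V W F hV hW
    exact shear_unique c.jac_ne_zero (measurePreserving_shearPtSigma c hI₁)
      (isShearSigma_iff.1 hV) (isShearSigma_iff.1 hW)
  · intro F
    obtain ⟨V, hV⟩ := exists_unshear c.jac_ne_zero c.jac_ne_top
      (measurePreserving_shearPtSigma c hI₁) (measurable_unshearPtSigma c)
      (fun _ => unshearPtSigma_shearPtSigma c) ((H12Fst _).compLp F)
    exact ⟨V, isShearSigma_iff.2 hV⟩

end Strip

end AnisoTrace

namespace AnisoTrace

/-! ### Fractional parts and smoothness -/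

section Periodize

variable {G F : Type*} [NormedAddCommGroup G] [NormedSpace ℝ G]

/-- The fractional part, along `e`, with respect to the coordinate `ℓ`. -/
noncomputable def fractPt (ℓ : G →L[ℝ] ℝ) (e : G) (p : G) : G := p - (⌊ℓ p⌋ : ℝ) • e

/-- Where ℓ p₀ is not an integer, the floor is locally constant. Where it is, both sides vanish near
p₀, because K is closed and avoids 0 and 1. -/
theorem eventuallyEq_fractPt [Zero F] {ψ : G → F} {ℓ : G →L[ℝ] ℝ} {e : G} (he : ℓ e = 1)
    {K : Set ℝ} (hK : IsClosed K) (hK1 : K ⊆ Ioo 0 1) (hψ : ∀ p, ℓ p ∉ K → ψ p = 0) (p₀ : G) :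
    (fun p => ψ (fractPt ℓ e p)) =ᶠ[𝓝 p₀] fun p => ψ (p - (⌊ℓ p₀⌋ : ℝ) • e) := by
  have hfl : ∀ (p : G) (n : ℤ), ℓ (p - (n : ℝ) • e) = ℓ p - n := fun p n => by
    rw [map_sub, map_smul, he, smul_eq_mul, mul_one]
  set n := ⌊ℓ p₀⌋ with hn
  have hle : (n : ℝ) ≤ ℓ p₀ := Int.floor_le (ℓ p₀)
  have hlt : ℓ p₀ < n + 1 := Int.lt_floor_add_one (ℓ p₀)
  rcases hle.eq_or_lt with h0 | h0
  · have k0 : (0 : ℝ) ∉ K := fun h => (hK1 h).1.false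
    have k1 : (1 : ℝ) ∉ K := fun h => (hK1 h).2.false
    have c1 : Tendsto (fun p => ℓ p - n) (𝓝 p₀) (𝓝 0) := by
      have : ContinuousAt (fun p => ℓ p - n) p₀ := by fun_prop
      have h2 := this.tendsto
      rwa [← h0, sub_self] at h2
    have c2 : Tendsto (fun p => ℓ p - n + 1) (𝓝 p₀) (𝓝 1) := by
      simpa using c1.add_const 1
    filter_upwards [c1 (hK.isOpen_compl.mem_nhds k0), c2 (hK.isOpen_compl.mem_nhds k1),
      c1 (Ioo_mem_nhds neg_one_lt_zero one_pos)] with p h1 h2 h3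
    have h1' : ℓ p - n ∉ K := h1
    have h2' : ℓ p - n + 1 ∉ K := h2
    have h3' : ℓ p - n ∈ Ioo (-1 : ℝ) 1 := h3
    rw [hψ (p - (n : ℝ) • e) (by rwa [hfl])]
    refine hψ _ ?_
    rw [fractPt, hfl]
    rcases le_or_gt 0 (ℓ p - n) with h4 | h4
    · have : ⌊ℓ p⌋ = n := Int.floor_eq_iff.2 ⟨by linarith, by linarith [h3'.2]⟩
      rwa [this]
    · have : ⌊ℓ p⌋ = n - 1 := Int.floor_eq_iff.2 ⟨by push_cast; linarith [h3'.1], by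
        push_cast; linarith⟩
      have e : ℓ p - ((n - 1 : ℤ) : ℝ) = ℓ p - n + 1 := by push_cast; ring
      rwa [this, e]
  · filter_upwards [ℓ.continuous.continuousAt (Ioo_mem_nhds h0 hlt)] with p hp
    have : ⌊ℓ p⌋ = n := Int.floor_eq_iff.2 ⟨hp.1.le, hp.2⟩
    rw [fractPt, this]

variable [NormedAddCommGroup F] [NormedSpace ℝ F]

theorem contDiff_fractPt {ψ : G → F} {ℓ : G →L[ℝ] ℝ} {e : G} (he : ℓ e = 1)
    {K : Set ℝ} (hK : IsClosed K) (hK1 : K ⊆ Ioo 0 1) (hψ : ∀ p, ℓ p ∉ K → ψ p = 0)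
    (h : ContDiff ℝ ∞ ψ) : ContDiff ℝ ∞ fun p => ψ (fractPt ℓ e p) := by
  rw [contDiff_iff_contDiffAt]
  intro p₀
  refine ContDiffAt.congr_of_eventuallyEq ?_ (eventuallyEq_fractPt he hK hK1 hψ p₀)
  exact (h.comp (by fun_prop)).contDiffAt

theorem fderiv_fractPt {ψ : G → F} {ℓ : G →L[ℝ] ℝ} {e : G} (he : ℓ e = 1)
    {K : Set ℝ} (hK : IsClosed K) (hK1 : K ⊆ Ioo 0 1) (hψ : ∀ p, ℓ p ∉ K → ψ p = 0) (p₀ : G) :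
    fderiv ℝ (fun p => ψ (fractPt ℓ e p)) p₀ = fderiv ℝ ψ (fractPt ℓ e p₀) := by
  rw [(eventuallyEq_fractPt he hK hK1 hψ p₀).fderiv_eq, fderiv_comp_sub]
  rfl

end Periodize

/-- The third coordinate. -/
noncomputable def coord₃ : ℝ × ℝ × ℝ →L[ℝ] ℝ :=
  (ContinuousLinearMap.snd ℝ ℝ ℝ).comp (ContinuousLinearMap.snd ℝ ℝ (ℝ × ℝ))

theorem fractPt_coord₃ (p : ℝ × ℝ × ℝ) :
    fractPt coord₃ (0, 0, 1) p = (p.1, p.2.1, Int.fract p.2.2) := by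
  ext <;> simp [fractPt, coord₃, Int.self_sub_floor]

/-- The oblique lines along which the shear map restricts functions. -/
noncomputable def obliquePt (c : Cut) (s : ℝ) (x : ℝ × ℝ) : ℝ × ℝ × ℝ :=
  (x.1, c.θ₁ * x.2, c.θ₂ * x.2 + s)

theorem fractPt_obliquePt (c : Cut) (s : ℝ) (x : ℝ × ℝ) :
    fractPt coord₃ (0, 0, 1) (obliquePt c s x) = shearPt c (s, x) := by
  rw [fractPt_coord₃]; rfl

theorem hasFDerivAt_obliquePt (c : Cut) (s : ℝ) (x : ℝ × ℝ) :
    HasFDerivAt (obliquePt c s) ((ContinuousLinearMap.fst ℝ ℝ ℝ).prod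
      ((c.θ₁ • ContinuousLinearMap.snd ℝ ℝ ℝ).prod (c.θ₂ • ContinuousLinearMap.snd ℝ ℝ ℝ))) x :=
  hasFDerivAt_fst.prodMk ((hasFDerivAt_snd.const_mul c.θ₁).prodMk
    ((hasFDerivAt_snd.const_mul c.θ₂).add_const s))

theorem contDiff_obliquePt (c : Cut) (s : ℝ) : ContDiff ℝ ∞ (obliquePt c s) := by
  unfold obliquePt; fun_prop

theorem fderiv_comp_obliquePt {F : Type*} [NormedAddCommGroup F] [NormedSpace ℝ F] (c : Cut)
    (s : ℝ) (x : ℝ × ℝ) {f : ℝ × ℝ × ℝ → F} (hf : DifferentiableAt ℝ f (obliquePt c s x))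
    (i : Fin 2) : fderiv ℝ (fun x => f (obliquePt c s x)) x (![((1 : ℝ), (0 : ℝ)), (0, 1)] i)
      = fderiv ℝ f (obliquePt c s x) (c.col i) := by
  have h := hf.hasFDerivAt.comp x (hasFDerivAt_obliquePt c s x)
  rw [HasFDerivAt.fderiv (f := fun x => f (obliquePt c s x)) h]
  fin_cases i <;> simp [Cut.col]

/-! ### Weak derivatives along the slices and the norm of H¹_{C,per} -/

section WeakDeriv

variable {c : Cut} {Ix I₁ : Set ℝ}

/-- Test functions on `Ω_per` restrict to test functions on the oblique lines. -/
theorem exists_test_shear {φ : ℝ × ℝ × ℝ → ℝ} (h1 : ContDiff ℝ ∞ φ) (h2 : HasCompactSupport φ)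
    (h3 : tsupport φ ⊆ OmegaPer Ix I₁) (s : ℝ) :
    ContDiff ℝ ∞ (fun x => φ (shearPt c (s, x))) ∧
    HasCompactSupport (fun x => φ (shearPt c (s, x))) ∧
    tsupport (fun x => φ (shearPt c (s, x))) ⊆ Q c Ix I₁ ∧
    ∀ x i, fderiv ℝ (fun x => φ (shearPt c (s, x))) x (![((1 : ℝ), (0 : ℝ)), (0, 1)] i)
      = fderiv ℝ φ (shearPt c (s, x)) (c.col i) := by
  have he : coord₃ (0, 0, 1) = 1 := by simp [coord₃]
  set K : Set ℝ := coord₃ '' tsupport φ with hK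
  have hKc : IsCompact K := h2.isCompact.image coord₃.continuous
  have hK1 : K ⊆ Ioo 0 1 := by
    rintro t ⟨p, hp, rfl⟩
    exact (h3 hp).2.2
  have hφ : ∀ p, coord₃ p ∉ K → φ p = 0 := fun p hp =>
    image_eq_zero_of_notMem_tsupport fun h => hp ⟨p, h, rfl⟩
  have e : (fun x => φ (shearPt c (s, x)))
      = fun x => (fun p => φ (fractPt coord₃ (0, 0, 1) p)) (obliquePt c s x) := by
    ext x
    dsimp only
    rw [fractPt_obliquePt]
  have hs := contDiff_fractPt he hKc.isClosed hK1 hφ h1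
  -- The first two coordinates of the sheared point do not involve s, so the supports of all slices
  -- lie in this one compact subset of Q_θ.
  set K' : Set (ℝ × ℝ) := (fun p : ℝ × ℝ × ℝ => (p.1, p.2.1 / c.θ₁)) '' tsupport φ with hK'
  have hK'c : IsCompact K' := h2.isCompact.image (by fun_prop)
  have hK'Q : K' ⊆ Q c Ix I₁ := by
    rintro x ⟨p, hp, rfl⟩
    refine ⟨(h3 hp).1, ?_⟩
    change c.θ₁ * (p.2.1 / c.θ₁) ∈ I₁
    rw [mul_div_cancel₀ _ c.ne]
    exact (h3 hp).2.1
  have hz : ∀ x, x ∉ K' → φ (shearPt c (s, x)) = 0 := fun x hx =>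
    image_eq_zero_of_notMem_tsupport fun h => hx ⟨_, h, by
      simp only [shearPt, mul_div_cancel_left₀ _ c.ne]⟩
  refine ⟨?_, HasCompactSupport.intro hK'c hz, ?_, fun x i => ?_⟩
  · rw [e]; exact hs.comp (contDiff_obliquePt c s)
  · refine (closure_minimal (fun x hx => ?_) hK'c.isClosed).trans hK'Q
    by_contra hn
    exact hx (hz x hn)
  · rw [e, fderiv_comp_obliquePt c s x (hs.differentiable (by simp) _),
      fderiv_fractPt he hKc.isClosed hK1 hφ, fractPt_obliquePt]

/-- A test function on Ω_per restricts to a test function on each slice, with partial derivatives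
equal to its derivatives along the columns of C. The identities on the slices, integrated over s,
give the identity on Ω_per. -/
theorem isWeakDeriv_of_shear (hI₁ : MeasurableSet I₁) {V W : L2 (OmegaPer Ix I₁)} {i : Fin 2}
    {F : Lp (H1 (Q c Ix I₁)) 2 unitMeas} (hV : IsShear c Ix I₁ V F)
    (hW : ∀ᵐ s ∂unitMeas, ∀ᵐ x ∂volume.restrict (Q c Ix I₁),
      (sobolevProj _ _ i.succ).compLp F s x = W (shearPt c (s, x))) :
    IsWeakDeriv (OmegaPer Ix I₁) (c.col i) V W := by
  intro φ h1 h2 h3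
  have hmp := measurePreserving_shearPt (Ix := Ix) c hI₁
  have hκ : c.jac.toReal ≠ 0 := ENNReal.toReal_ne_zero.2 ⟨c.jac_ne_zero, c.jac_ne_top⟩
  refine smul_right_injective ℂ hκ ?_
  dsimp only
  rw [smul_neg, integral_shear hmp c.jac_ne_top (integrable_smul_L2 (continuous_dir h1 _)
      (compact_dir h2 _) V), integral_shear hmp c.jac_ne_top
      (integrable_smul_L2 h1.continuous h2 W), ← integral_neg]
  refine integral_congr_ae ?_
  filter_upwards [hV, hW, (sobolevProj _ _ i.succ).coeFn_compLp F] with s a1 a2 a3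
  obtain ⟨t1, t2, t3, t4⟩ := exists_test_shear (c := c) h1 h2 h3 s
  have key := (F s).2 i _ t1 t2 t3
  simp only [t4] at key
  have e1 : ∫ x in Q c Ix I₁, fderiv ℝ φ (shearPt c (s, x)) (c.col i) • V (shearPt c (s, x))
      = ∫ x in Q c Ix I₁, fderiv ℝ φ (shearPt c (s, x)) (c.col i) • (F s).1 0 x := by
    refine integral_congr_ae ?_
    filter_upwards [a1] with x hx
    rw [hx]; rfl
  have e2 : ∫ x in Q c Ix I₁, φ (shearPt c (s, x)) • W (shearPt c (s, x))
      = ∫ x in Q c Ix I₁, φ (shearPt c (s, x)) • (F s).1 i.succ x := by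
    refine integral_congr_ae ?_
    filter_upwards [a2] with x hx
    rw [← hx, a3]; rfl
  rw [e1, e2, key]

/-- Elements of `H¹_{C,per}` have weak derivatives, and their norm is that of the shear. -/
theorem IsShear.exists_H1C (hI₁ : MeasurableSet I₁) {V : L2 (OmegaPer Ix I₁)}
    {F : Lp (H1 (Q c Ix I₁)) 2 unitMeas} (hV : IsShear c Ix I₁ V F) :
    ∃ U : H1C c (OmegaPer Ix I₁), U.1 0 = V ∧ ‖F‖ₑ ^ 2 = c.jac * ‖U‖ₑ ^ 2 := by
  -- The derivatives of V are obtained by unshearing the slice derivatives.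
  choose W hW using fun i : Fin 2 => exists_unshearPt c Ix hI₁ ((sobolevProj _ _ i.succ).compLp F)
  have hmp := measurePreserving_shearPt (Ix := Ix) c hI₁
  refine ⟨⟨WithLp.toLp 2 (Fin.cons V W), fun i => isWeakDeriv_of_shear hI₁ hV (hW i)⟩, rfl, ?_⟩
  rw [enorm_dirSobolev_sq, ← enorm_Lp_sq, ← enorm_Lp_sq, ← enorm_Lp_sq, mul_add, mul_add]
  have h0 := enorm_sq_of_shear hmp (isShear_iff.1 hV)
  have h1 := enorm_sq_of_shear hmp (hW 0)
  have h2 := enorm_sq_of_shear hmp (hW 1)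
  change _ = c.jac * ‖V‖ₑ ^ 2 + c.jac * ‖W 0‖ₑ ^ 2 + c.jac * ‖W 1‖ₑ ^ 2
  rw [← h0, ← h1, ← h2, enorm_Lp_sq, enorm_Lp_sq, enorm_Lp_sq, enorm_Lp_sq]
  have hm : ∀ i, Measurable fun s => ‖(sobolevProj (Q c Ix I₁) ![((1 : ℝ), (0 : ℝ)), (0, 1)]
      i).compLp F s‖ₑ ^ 2 := fun i => (Lp.stronglyMeasurable _).enorm.pow_const 2
  rw [← lintegral_add_left (hm _), ← lintegral_add_right _ (hm _)]
  refine lintegral_congr_ae ?_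
  filter_upwards [(sobolevProj _ _ 0).coeFn_compLp F, (sobolevProj _ _ (0 : Fin 2).succ).coeFn_compLp F,
    (sobolevProj _ _ (1 : Fin 2).succ).coeFn_compLp F] with s a0 a1 a2
  rw [enorm_dirSobolev_sq, ← enorm_Lp_sq, ← enorm_Lp_sq, ← enorm_Lp_sq, a0, a1, a2]
  rfl

theorem HasNormH1C.unique (hIx : IsOpen Ix) (hI₁ : IsOpen I₁) {V : L2 (OmegaPer Ix I₁)} {r t : ℝ}
    (hr : HasNormH1C c Ix I₁ V r) (ht : HasNormH1C c Ix I₁ V t) : r = t := by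
  obtain ⟨U, rfl, rfl⟩ := hr
  obtain ⟨W, h, rfl⟩ := ht
  rw [dirSobolev_ext (hIx.prod (hI₁.prod isOpen_Ioo)) h]

end WeakDeriv

end AnisoTrace

namespace AnisoTrace

/-! ### The shear of smooth periodic functions -/

section Shear

variable {c : Cut} {Ix I₁ : Set ℝ}

/-- The projection along the oblique lines of the support of `f`. -/
def obliqueSupport (c : Cut) (f : ℝ × ℝ × ℝ → ℂ) : Set (ℝ × ℝ) :=
  (fun p : ℝ × ℝ × ℝ => (p.1, p.2.1 / c.θ₁)) '' tsupport f

theorem isCompact_obliqueSupport (c : Cut) {f : ℝ × ℝ × ℝ → ℂ} (hf : HasCompactSupport f) :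
    IsCompact (obliqueSupport c f) := hf.isCompact.image (by fun_prop)

theorem shearPt_eq_zero {f : ℝ × ℝ × ℝ → ℂ} {s : ℝ} {x : ℝ × ℝ} (hx : x ∉ obliqueSupport c f) :
    f (shearPt c (s, x)) = 0 :=
  image_eq_zero_of_notMem_tsupport fun h => hx ⟨_, h, by
    simp only [shearPt, mul_div_cancel_left₀ _ c.ne]⟩

theorem measurable_shearPt (c : Cut) : Measurable (shearPt c) := by
  unfold shearPt; fun_prop

theorem obliquePt_mem {s : ℝ} {x : ℝ × ℝ} (hx : x ∈ Q c Ix I₁) : obliquePt c s x ∈ Omega Ix I₁ :=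
  ⟨hx.1, hx.2, trivial⟩

theorem isOpen_Omega (hIx : IsOpen Ix) (hI₁ : IsOpen I₁) : IsOpen (Omega Ix I₁) :=
  hIx.prod (hI₁.prod isOpen_univ)

theorem isOpen_Q (c : Cut) (hIx : IsOpen Ix) (hI₁ : IsOpen I₁) : IsOpen (Q c Ix I₁) :=
  hIx.prod (isOpen_edge c hI₁)

theorem memLp_shear {f : ℝ × ℝ × ℝ → ℂ} (hf : Continuous f) (hs : HasCompactSupport f) (s : ℝ)
    (O : Set (ℝ × ℝ)) : MemLp (fun x => f (shearPt c (s, x))) 2 (volume.restrict O) := by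
  obtain ⟨M, hM⟩ := hs.exists_bound_of_continuous hf
  have hm : Measurable fun x => f (shearPt c (s, x)) :=
    hf.measurable.comp ((measurable_shearPt c).comp measurable_prodMk_left)
  have hK := isCompact_obliqueSupport c hs
  refine MemLp.restrict _ (memLp_two_of_lintegral hm.aestronglyMeasurable ?_)
  calc ∫⁻ x, ‖f (shearPt c (s, x))‖ₑ ^ 2
      ≤ ∫⁻ x, (obliqueSupport c f).indicator (fun _ => ENNReal.ofReal M ^ 2) x := by
        refine lintegral_mono fun x => ?_
        by_cases hx : x ∈ obliqueSupport c f
        · rw [indicator_of_mem hx, ← ofReal_norm]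
          exact pow_le_pow_left₀ zero_le (ENNReal.ofReal_le_ofReal (hM _)) 2
        · rw [shearPt_eq_zero hx]; simp
    _ < ⊤ := by
        rw [lintegral_indicator hK.measurableSet, setLIntegral_const]
        exact ENNReal.mul_lt_top (by finiteness) hK.measure_lt_top

/-- Continuity in `s`, in the mean, of the restrictions to oblique lines. -/
theorem tendsto_lintegral_oblique (hIx : IsOpen Ix) (hI₁ : IsOpen I₁) {f h : ℝ × ℝ × ℝ → ℂ}
    (hf : Continuous f) (hs : HasCompactSupport f) (hh : ContinuousOn h (Omega Ix I₁))
    (hfh : ∀ p ∈ Omega Ix I₁, h p = f (fractPt coord₃ (0, 0, 1) p)) (s₀ : ℝ) :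
    Tendsto (fun s => ∫⁻ x in Q c Ix I₁, ‖f (shearPt c (s, x)) - f (shearPt c (s₀, x))‖ₑ ^ 2)
      (𝓝 s₀) (𝓝 0) := by
  obtain ⟨M, hM⟩ := hs.exists_bound_of_continuous hf
  have hK := isCompact_obliqueSupport c hs
  have hQ := (isOpen_Q c hIx hI₁).measurableSet
  have hm : ∀ s, Measurable fun x => f (shearPt c (s, x)) := fun s =>
    hf.measurable.comp ((measurable_shearPt c).comp measurable_prodMk_left)
  have key := tendsto_lintegral_filter_of_dominated_convergence (μ := volume.restrict (Q c Ix I₁))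
    (l := 𝓝 s₀) (F := fun s x => ‖f (shearPt c (s, x)) - f (shearPt c (s₀, x))‖ₑ ^ 2)
    (f := fun _ => 0)
    ((obliqueSupport c f).indicator fun _ => ENNReal.ofReal (M + M) ^ 2)
    (Eventually.of_forall fun s => ((hm s).sub (hm s₀)).enorm.pow_const 2)
    (Eventually.of_forall fun s => ae_of_all _ fun x => ?_) ?_ ?_
  · simpa using key
  · by_cases hx : x ∈ obliqueSupport c f
    · rw [indicator_of_mem hx, ← ofReal_norm]
      refine pow_le_pow_left₀ zero_le (ENNReal.ofReal_le_ofReal ?_) 2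
      exact (norm_sub_le _ _).trans (add_le_add (hM _) (hM _))
    · rw [shearPt_eq_zero hx, shearPt_eq_zero hx]; simp
  · refine ((setLIntegral_le_lintegral _ _).trans_lt ?_).ne
    rw [lintegral_indicator hK.measurableSet, setLIntegral_const]
    exact ENNReal.mul_lt_top (by finiteness) hK.measure_lt_top
  · filter_upwards [ae_restrict_mem hQ] with x hx
    -- The fractional part jumps, but along oblique lines f coincides with the continuous periodic
    -- function h, so there is pointwise convergence in s.
    have e : ∀ s, f (shearPt c (s, x)) = h (obliquePt c s x) := fun s => by
      rw [hfh _ (obliquePt_mem hx), fractPt_obliquePt]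
    simp only [e]
    have hc : Continuous fun s => h (obliquePt c s x) :=
      hh.comp_continuous (by unfold obliquePt; fun_prop) fun s => obliquePt_mem hx
    exact tendsto_enorm_sub_sq (hc.tendsto s₀)

theorem mem_closure_OmegaPer {p : ℝ × ℝ × ℝ} (hp : p ∈ Omega Ix I₁) :
    fractPt coord₃ (0, 0, 1) p ∈ closure (OmegaPer Ix I₁) := by
  rw [fractPt_coord₃, OmegaPer, closure_prod_eq, closure_prod_eq, closure_Ioo zero_ne_one]
  exact ⟨subset_closure hp.1, subset_closure hp.2.1, Int.fract_nonneg _, (Int.fract_lt_one _).le⟩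

theorem extPer_eq {v w : ℝ × ℝ × ℝ → ℂ} (hvw : EqOn v w (closure (OmegaPer Ix I₁)))
    {p : ℝ × ℝ × ℝ} (hp : p ∈ Omega Ix I₁) :
    extPer v p = w (fractPt coord₃ (0, 0, 1) p) := by
  rw [← hvw (mem_closure_OmegaPer hp), fractPt_coord₃]
  rfl

/-- The derivative of the periodic extension. -/
theorem fderiv_extPer (hIx : IsOpen Ix) (hI₁ : IsOpen I₁) {v w : ℝ × ℝ × ℝ → ℂ}
    (hw : ContDiff ℝ ∞ w) (hvw : EqOn v w (closure (OmegaPer Ix I₁)))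
    (hv : ContDiffOn ℝ ∞ (extPer v) (Omega Ix I₁)) {p : ℝ × ℝ × ℝ} (hp : p ∈ Omega Ix I₁) :
    fderiv ℝ (extPer v) p = fderiv ℝ w (fractPt coord₃ (0, 0, 1) p) := by
  have hO := isOpen_Omega hIx hI₁
  set n := ⌊p.2.2⌋ with hn
  set e : ℝ × ℝ × ℝ := (0, 0, 1) with he
  have hle : (n : ℝ) ≤ p.2.2 := Int.floor_le _
  have hlt : p.2.2 < n + 1 := Int.lt_floor_add_one _
  have hloc : ∀ q ∈ Omega Ix I₁, q.2.2 ∈ Ioo (n : ℝ) (n + 1) →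
      fderiv ℝ (extPer v) q = fderiv ℝ w (q - (n : ℝ) • e) := by
    intro q hq hqn
    have h1 : extPer v =ᶠ[𝓝 q] fun q => w (q - (n : ℝ) • e) := by
      have hc : ContinuousAt (fun q : ℝ × ℝ × ℝ => q.2.2) q := by fun_prop
      filter_upwards [hO.mem_nhds hq, hc (Ioo_mem_nhds hqn.1 hqn.2)] with y hy hyn
      have : ⌊coord₃ y⌋ = n := Int.floor_eq_iff.2 ⟨hyn.1.le, hyn.2⟩
      rw [extPer_eq hvw hy, fractPt, this]
    rw [h1.fderiv_eq, fderiv_comp_sub]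
  have hfp : fractPt coord₃ e p = p - (n : ℝ) • e := rfl
  have hcv : ContinuousOn (fderiv ℝ (extPer v)) (Omega Ix I₁) :=
    hv.continuousOn_fderiv_of_isOpen hO (by simp)
  -- When z₂ is an integer, the extension need not be a single translate of w near p. It is one just
  -- above p, where the floor is still n, and continuity of both derivatives gives the value at p.
  have hline : Tendsto (fun t : ℝ => p + t • e) (𝓝[>] 0) (𝓝 p) := by
    have : ContinuousAt (fun t : ℝ => p + t • e) 0 := by fun_prop
    have h2 := this.tendsto
    simp only [zero_smul, add_zero] at h2
    exact h2.mono_left nhdsWithin_le_nhds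
  have l1 := (hcv.continuousAt (hO.mem_nhds hp)).tendsto.comp hline
  have l2 : Tendsto (fun t : ℝ => fderiv ℝ w (p + t • e - (n : ℝ) • e)) (𝓝[>] 0)
      (𝓝 (fderiv ℝ w (p - (n : ℝ) • e))) :=
    ((hw.continuous_fderiv (by simp)).tendsto _).comp (hline.sub_const _)
  rw [hfp]
  refine tendsto_nhds_unique l1 (l2.congr' ?_)
  filter_upwards [Ioo_mem_nhdsGT (show (0 : ℝ) < n + 1 - p.2.2 by linarith)] with t ht
  refine (hloc _ ⟨?_, ?_, trivial⟩ ?_).symm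
  · simpa [he] using hp.1
  · simpa [he] using hp.2.1
  · simp only [he, Prod.smul_mk, smul_eq_mul, mul_one, Prod.snd_add]
    exact ⟨by linarith [ht.1], by linarith [ht.2]⟩

/-- The shear of a function in `C^∞_{0,per}` is an element of the Bochner space. -/
theorem exists_shear_smooth (hIx : IsOpen Ix) (hI₁ : IsOpen I₁) {v w : ℝ × ℝ × ℝ → ℂ}
    (hw : ContDiff ℝ ∞ w) (hws : HasCompactSupport w)
    (hvw : EqOn v w (closure (OmegaPer Ix I₁))) (hv : ContDiffOn ℝ ∞ (extPer v) (Omega Ix I₁)) :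
    ∃ F : Lp (H1 (Q c Ix I₁)) 2 unitMeas, ∀ᵐ s ∂unitMeas,
      ((F s).1 0 : ℝ × ℝ → ℂ) =ᵐ[volume.restrict (Q c Ix I₁)] fun x => w (shearPt c (s, x)) := by
  have hO := isOpen_Omega hIx hI₁
  have hQ := isOpen_Q c hIx hI₁
  have hd : ∀ i s x, x ∈ Q c Ix I₁ → fderiv ℝ (fun x => extPer v (obliquePt c s x)) x
      (![((1 : ℝ), (0 : ℝ)), (0, 1)] i) = fderiv ℝ w (shearPt c (s, x)) (c.col i) := by
    intro i s x hx
    rw [fderiv_comp_obliquePt c s x (((hv _ (obliquePt_mem hx)).contDiffAt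
      (hO.mem_nhds (obliquePt_mem hx))).differentiableAt (by simp)),
      fderiv_extPer hIx hI₁ hw hvw hv (obliquePt_mem hx), fractPt_obliquePt]
  have he : ∀ s x, x ∈ Q c Ix I₁ → extPer v (obliquePt c s x) = w (shearPt c (s, x)) := by
    intro s x hx
    rw [extPer_eq hvw (obliquePt_mem hx), fractPt_obliquePt]
  have hdc : ∀ i, Continuous fun p => fderiv ℝ w p (c.col i) := fun i =>
    continuous_fderiv_apply hw _
  have hds : ∀ i, HasCompactSupport fun p => fderiv ℝ w p (c.col i) := fun i =>
    (hws.fderiv (𝕜 := ℝ)).comp_left (g := fun L : ℝ × ℝ × ℝ →L[ℝ] ℂ => L (c.col i)) (by simp)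
  have k0 : ∀ s, (fun x => extPer v (obliquePt c s x)) =ᵐ[volume.restrict (Q c Ix I₁)]
      fun x => w (shearPt c (s, x)) := fun s => by
    filter_upwards [ae_restrict_mem hQ.measurableSet] with x hx
    exact he s x hx
  have k1 : ∀ i s, (fun x => fderiv ℝ (fun x => extPer v (obliquePt c s x)) x
      (![((1 : ℝ), (0 : ℝ)), (0, 1)] i)) =ᵐ[volume.restrict (Q c Ix I₁)]
      fun x => fderiv ℝ w (shearPt c (s, x)) (c.col i) := fun i s => by
    filter_upwards [ae_restrict_mem hQ.measurableSet] with x hx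
    exact hd i s x hx
  have hcd : ∀ s, ContDiffOn ℝ 1 (fun x => extPer v (obliquePt c s x)) (Q c Ix I₁) := fun s =>
    (hv.comp (contDiff_obliquePt c s).contDiffOn fun x hx => obliquePt_mem hx).of_le (by simp)
  have m0 := fun s => (memLp_congr_ae (k0 s)).2 (memLp_shear (c := c) hw.continuous hws s _)
  have m1 := fun s i => (memLp_congr_ae (k1 i s)).2 (memLp_shear (c := c) (hdc i) (hds i) s _)
  set f : ℝ → H1 (Q c Ix I₁) := fun s => smoothSobolev hQ _ (hcd s) (m0 s) (m1 s) with hf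
  have e0 : ∀ s, ((f s).1 0 : ℝ × ℝ → ℂ) =ᵐ[volume.restrict (Q c Ix I₁)]
      fun x => w (shearPt c (s, x)) := fun s =>
    (smoothSobolev_coe hQ _ (hcd s) (m0 s) (m1 s)).trans (k0 s)
  have e1 : ∀ s i, ((f s).1 (Fin.succ i) : ℝ × ℝ → ℂ) =ᵐ[volume.restrict (Q c Ix I₁)]
      fun x => fderiv ℝ w (shearPt c (s, x)) (c.col i) := fun s i =>
    (smoothSobolev_coe_succ hQ _ (hcd s) (m0 s) (m1 s) i).trans (k1 i s)
  -- Continuity in s provides both strong measurability with values in H¹ and, by compactness of [0,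
  -- 1], boundedness.
  have hcont : Continuous f := by
    rw [continuous_iff_continuousAt]
    intro s₀
    refine tendsto_of_tendsto_enorm_sub_sq ?_
    have l0 := tendsto_lintegral_oblique (c := c) hIx hI₁ hw.continuous hws hv.continuousOn
      (fun p hp => extPer_eq hvw hp) s₀
    have l1 := fun i => tendsto_lintegral_oblique (c := c) (h := fun p => fderiv ℝ (extPer v) p
      (c.col i)) hIx hI₁ (hdc i) (hds i)
      ((hv.continuousOn_fderiv_of_isOpen hO (by simp)).clm_apply continuousOn_const)
      (fun p hp => by rw [fderiv_extPer hIx hI₁ hw hvw hv hp]) s₀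
    have l2 := (l0.add (l1 0)).add (l1 1)
    simp only [add_zero] at l2
    refine l2.congr fun s => ?_
    rw [enorm_sub_dirSobolev_sq (f s) (f s₀) (e0 s) (e1 s)]
    congr 1
    · congr 1
      · refine lintegral_congr_ae ?_
        filter_upwards [e0 s₀] with x hx
        rw [hx]
      · refine lintegral_congr_ae ?_
        filter_upwards [e1 s₀ 0] with x hx
        rw [← hx]; rfl
    · refine lintegral_congr_ae ?_
      filter_upwards [e1 s₀ 1] with x hx
      rw [← hx]; rfl
  obtain ⟨B, hB⟩ := (isCompact_Icc (a := (0 : ℝ)) (b := 1)).exists_bound_of_continuousOn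
    hcont.continuousOn
  have hf2 : MemLp f 2 unitMeas := by
    have : SecondCountableTopologyEither ℝ (H1 (Q c Ix I₁)) :=
      secondCountableTopologyEither_of_left _ _
    refine MemLp.of_bound hcont.aestronglyMeasurable B ?_
    filter_upwards [ae_restrict_mem measurableSet_Ioo] with s hs
    exact hB s ⟨hs.1.le, hs.2.le⟩
  refine ⟨hf2.toLp f, ?_⟩
  filter_upwards [hf2.coeFn_toLp] with s hs
  rw [hs]
  exact e0 s

end Shear

end AnisoTrace

/-! ### Totality of products in the Bochner space -/

namespace AnisoTrace

theorem norm_eq_of_enorm_sq {A B : Type*} [NormedAddCommGroup A] [NormedAddCommGroup B] {a : A}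
    {b : B} {κ : ℝ≥0∞} (h : ‖a‖ₑ ^ 2 = κ * ‖b‖ₑ ^ 2) : ‖a‖ = √κ.toReal * ‖b‖ := by
  have h1 := congrArg ENNReal.toReal h
  rw [ENNReal.toReal_mul, ENNReal.toReal_pow, ENNReal.toReal_pow, toReal_enorm, toReal_enorm] at h1
  rw [← Real.sqrt_sq (norm_nonneg a), h1, Real.sqrt_mul ENNReal.toReal_nonneg,
    Real.sqrt_sq (norm_nonneg b)]

/-- An operator on `L²(0, 1; X)` that vanishes on the products `a(s) w` vanishes. -/
theorem eq_zero_of_eq_zero_on_products {X Y D : Type*} [NormedAddCommGroup X] [NormedSpace ℂ X]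
    [NormedAddCommGroup Y] [InnerProductSpace ℂ Y] [CompleteSpace Y]
    {e : D → X} (he : DenseRange e) (A : Lp X 2 unitMeas →L[ℂ] Y)
    (hA : ∀ a : ℝ → ℝ, ContDiff ℝ ∞ a → HasCompactSupport a → tsupport a ⊆ Ioo 0 1 → ∀ d,
      ∀ F : Lp X 2 unitMeas, (∀ᵐ s ∂unitMeas, F s = (a s : ℂ) • e d) → A F = 0) : A = 0 := by
  -- For fixed d, the operator b ↦ A (b e(d)) vanishes on C^∞_c(0, 1). Each value of its adjoint is
  -- thus orthogonal to all test functions, hence zero.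
  have hB : ∀ d, ∀ b : Lp ℂ 2 unitMeas,
      A ((ContinuousLinearMap.toSpanSingleton ℂ (e d)).compLp b) = 0 := by
    intro d b
    set B : Lp ℂ 2 unitMeas →L[ℂ] Y :=
      A.comp ((ContinuousLinearMap.toSpanSingleton ℂ (e d)).compLpL 2 unitMeas) with hBdef
    suffices hz : ContinuousLinearMap.adjoint B = 0 by
      have : B = 0 := by
        rw [← ContinuousLinearMap.adjoint_adjoint B, hz, map_zero]
      exact DFunLike.congr_fun this b
    ext1 y
    set f : Lp ℂ 2 unitMeas := ContinuousLinearMap.adjoint B y with hf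
    have hloc : LocallyIntegrableOn (fun s => (starRingEnd ℂ) (f s)) (Ioo 0 1) unitMeas := by
      have h1 : Integrable f unitMeas := (Lp.memLp f).integrable (by norm_num)
      exact (Complex.conjCLE.toContinuousLinearMap.integrable_comp h1).locallyIntegrable.locallyIntegrableOn _
    have hae := isOpen_Ioo.ae_eq_zero_of_integral_contDiff_smul_eq_zero hloc ?_
    · change f = 0
      refine Lp.ext ?_
      filter_upwards [hae, ae_restrict_mem measurableSet_Ioo, Lp.coeFn_zero ℂ 2 unitMeas]
        with s h1 h2 h3
      rw [h3]
      simpa using h1 h2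
    · intro a h1 h2 h3
      have ha : MemLp (fun s => (a s : ℂ)) 2 unitMeas :=
        ((Complex.continuous_ofReal.comp h1.continuous).memLp_of_hasCompactSupport
          (μ := volume) (h2.comp_left (g := fun t : ℝ => (t : ℂ)) rfl)).restrict _
      have hz : B (ha.toLp _) = 0 := by
        refine hA a h1 h2 h3 d _ ?_
        filter_upwards [(ContinuousLinearMap.toSpanSingleton ℂ (e d)).coeFn_compLp (ha.toLp _),
          ha.coeFn_toLp] with s k1 k2
        change (ContinuousLinearMap.toSpanSingleton ℂ (e d)).compLp (ha.toLp _) s = _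
        rw [k1, k2, ContinuousLinearMap.toSpanSingleton_apply]
      have h4 : inner ℂ f (ha.toLp _) = 0 := by
        rw [hf, ContinuousLinearMap.adjoint_inner_left, hz, inner_zero_right]
      rw [L2.inner_def] at h4
      rw [← h4]
      refine integral_congr_ae ?_
      filter_upwards [ha.coeFn_toLp] with s hs
      rw [hs, RCLike.inner_apply, Complex.real_smul]
  -- Taking b to be an indicator function settles the case x = e(d); density of the range of e and
  -- continuity in x settle the others.
  have hI : ∀ {s : Set ℝ} (hs : MeasurableSet s) (hμ : unitMeas s ≠ ⊤) (x : X),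
      A (indicatorConstLp 2 hs hμ x) = 0 := by
    intro s hs hμ x
    have hc : Continuous fun x : X => A (indicatorConstLp 2 hs hμ x) := by
      refine A.continuous.comp ?_
      refine LipschitzWith.continuous (K := (unitMeas.real s ^ (1 / (2 : ℝ))).toNNReal)
        (LipschitzWith.of_dist_le_mul fun x y => ?_)
      rw [dist_eq_norm, dist_eq_norm, indicatorConstLp_sub,
        norm_indicatorConstLp (by norm_num) (by norm_num),
        Real.coe_toNNReal _ (by positivity), mul_comm]
      simp
    refine he.induction_on (p := fun x => A (indicatorConstLp 2 hs hμ x) = 0) x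
      (isClosed_eq hc continuous_const) fun d => ?_
    rw [← hB d (indicatorConstLp 2 hs hμ 1)]
    congr 1
    refine Lp.ext ?_
    filter_upwards [(ContinuousLinearMap.toSpanSingleton ℂ (e d)).coeFn_compLp
      (indicatorConstLp 2 hs hμ 1), indicatorConstLp_coeFn (p := 2) (hs := hs) (hμs := hμ)
      (c := e d), indicatorConstLp_coeFn (p := 2) (hs := hs) (hμs := hμ) (c := (1 : ℂ))]
      with t k1 k2 k3
    rw [k1, k2, k3, ContinuousLinearMap.toSpanSingleton_apply]
    by_cases ht : t ∈ s
    · simp [ht]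
    · simp [ht]
  ext1 F
  refine Lp.induction (by norm_num) (fun F : Lp X 2 unitMeas => A F = 0) ?_ ?_ ?_ F
  · intro x s hs hμ
    rw [Lp.simpleFunc.coe_indicatorConst]
    exact hI hs hμ.ne x
  · intro f g hf hg _ h1 h2
    rw [map_add, h1, h2, add_zero]
  · exact isClosed_eq A.continuous continuous_const

/-! ### Products as shears of smooth periodic functions -/

section Products

variable (c : Cut) (a : ℝ → ℝ) (w : ℝ × ℝ → ℂ)

/-- The function whose shear is `a(s) w(x)`. -/
noncomputable def productPer (p : ℝ × ℝ × ℝ) : ℂ :=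
  (a (Int.fract (p.2.2 - c.θ₂ * (p.2.1 / c.θ₁))) : ℂ) * w (p.1, p.2.1 / c.θ₁)

theorem productPer_shearPt {s : ℝ} (hs : s ∈ Ioo (0 : ℝ) 1) (x : ℝ × ℝ) :
    productPer c a w (shearPt c (s, x)) = a s * w x := by
  simp only [productPer, shearPt, mul_div_cancel_left₀ _ c.ne]
  rw [fract_fract_sub _ _ hs]

/-- The support of a stays away from 0 and 1, so its periodic extension is smooth. -/
theorem contDiff_productPer {a : ℝ → ℝ} {w : ℝ × ℝ → ℂ} (h1 : ContDiff ℝ ∞ a)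
    (h2 : HasCompactSupport a) (h3 : tsupport a ⊆ Ioo 0 1) (hw : ContDiff ℝ ∞ w) :
    ContDiff ℝ ∞ (productPer c a w) := by
  have ha := contDiff_fractPt (ψ := a) (ℓ := ContinuousLinearMap.id ℝ ℝ) (e := (1 : ℝ)) rfl
    h2.isCompact.isClosed h3 (fun t ht => image_eq_zero_of_notMem_tsupport ht) h1
  have e : (fun t => a (fractPt (ContinuousLinearMap.id ℝ ℝ) (1 : ℝ) t))
      = fun t => a (Int.fract t) := by
    ext t
    congr 1
    simp [fractPt]
  rw [e] at ha
  have ha2 : ContDiff ℝ ∞ fun p : ℝ × ℝ × ℝ =>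
      a (Int.fract (p.2.2 - c.θ₂ * (p.2.1 / c.θ₁))) :=
    ha.comp (g := fun t => a (Int.fract t))
      (f := fun p : ℝ × ℝ × ℝ => p.2.2 - c.θ₂ * (p.2.1 / c.θ₁)) (by fun_prop)
  have hw2 : ContDiff ℝ ∞ fun p : ℝ × ℝ × ℝ => w (p.1, p.2.1 / c.θ₁) := hw.comp (by fun_prop)
  exact (Complex.ofRealCLM.contDiff.comp ha2).mul hw2

theorem isSmoothPer_productPer (Ix I₁ : Set ℝ) {a : ℝ → ℝ} {w : ℝ × ℝ → ℂ} (h1 : ContDiff ℝ ∞ a)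
    (h2 : HasCompactSupport a) (h3 : tsupport a ⊆ Ioo 0 1) (hw : ContDiff ℝ ∞ w)
    (hws : HasCompactSupport w) : IsSmoothPer Ix I₁ (productPer c a w) := by
  have hc := contDiff_productPer c h1 h2 h3 hw
  -- The product is periodic in z₂, hence in general not compactly supported. This bump equals 1 on
  -- [-1, 1], which contains the closed period, so multiplying by it gives the required C^∞_c
  -- representative.
  let b : ContDiffBump (0 : ℝ) := ⟨1, 2, by norm_num, by norm_num⟩
  refine ⟨⟨fun p => b p.2.2 • productPer c a w p, ?_, ?_, ?_⟩, ?_⟩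
  · exact (b.contDiff.comp (by fun_prop)).smul hc
  · set K : Set (ℝ × ℝ × ℝ) := (fun q : (ℝ × ℝ) × ℝ => (q.1.1, c.θ₁ * q.1.2, q.2)) ''
      (tsupport w ×ˢ Icc (-2) 2) with hK
    have hKc : IsCompact K := (hws.isCompact.prod isCompact_Icc).image (by fun_prop)
    refine HasCompactSupport.intro hKc fun p hp => ?_
    by_contra hne
    refine hp ⟨((p.1, p.2.1 / c.θ₁), p.2.2), ⟨?_, ?_⟩, ?_⟩
    · refine subset_tsupport _ fun h0 => hne ?_
      simp only [productPer, h0, mul_zero, smul_zero]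
    · by_contra h0
      apply hne
      have : p.2.2 ∉ Function.support b := by
        rw [b.support_eq, Metric.mem_ball, dist_zero_right, Real.norm_eq_abs, abs_lt]
        exact fun h => h0 ⟨h.1.le, h.2.le⟩
      rw [Function.notMem_support.1 this, zero_smul]
    · simp only [mul_div_cancel₀ _ c.ne]
  · intro p hp
    rw [OmegaPer, closure_prod_eq, closure_prod_eq, closure_Ioo zero_ne_one] at hp
    have : b p.2.2 = 1 := by
      refine b.one_of_mem_closedBall ?_
      rw [mem_closedBall_zero_iff, Real.norm_eq_abs, abs_le]
      exact ⟨by linarith [hp.2.2.1], hp.2.2.2⟩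
    simp only [this, one_smul]
  · have e : extPer (productPer c a w) = productPer c a w := by
      ext p
      simp only [extPer, productPer]
      have : Int.fract p.2.2 - c.θ₂ * (p.2.1 / c.θ₁)
          = p.2.2 - c.θ₂ * (p.2.1 / c.θ₁) - (⌊p.2.2⌋ : ℤ) := by
        rw [Int.fract]; ring
      rw [this, Int.fract_sub_intCast]
    rw [e]
    exact hc.contDiffOn

end Products

/-! ### Traces of smooth periodic functions -/

section Trace

variable {c : Cut} {Ix I₁ : Set ℝ}

theorem IsShear.unique (hIx : IsOpen Ix) (hI₁ : IsOpen I₁) {V : L2 (OmegaPer Ix I₁)}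
    {F G : Lp (H1 (Q c Ix I₁)) 2 unitMeas} (hF : IsShear c Ix I₁ V F) (hG : IsShear c Ix I₁ V G) :
    F = G := by
  refine Lp.ext ?_
  filter_upwards [hF, hG] with s h1 h2
  exact dirSobolev_ext (isOpen_Q c hIx hI₁) (Lp.ext (h1.trans h2.symm))

/-- The trace operator on `Q_θ`. -/
noncomputable def edgeTrace (h : IsStrip Ix (edge c I₁)) :
    H1 (Q c Ix I₁) →L[ℂ] H12 (edge c I₁) := traceOp h

theorem edgeTrace_surjective (h : IsStrip Ix (edge c I₁)) : Function.Surjective (edgeTrace h) :=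
  traceOp_surjective h

theorem hasTrace_edgeTrace (h : IsStrip Ix (edge c I₁)) (u : H1 (Q c Ix I₁)) :
    HasTrace (Ix := Ix) (J := edge c I₁) u (edgeTrace h u).1.fst := hasTrace_traceOp h u

theorem denseRange_testToSobolev_Q (h : IsStrip Ix (edge c I₁)) (hQ : IsOpen (Q c Ix I₁)) :
    DenseRange (testToSobolev hQ ![((1 : ℝ), (0 : ℝ)), (0, 1)]) :=
  denseRange_testToSobolev hQ h.convex_prod h.nonempty_prod _

/-- The trace of the shear of a smooth function is the shear of its restriction. -/
theorem exists_trace_smooth (hIx : IsOpen Ix) (hI₁ : IsOpen I₁) (h : IsStrip Ix (edge c I₁))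
    {v : ℝ × ℝ × ℝ → ℂ} (hv : IsSmoothPer Ix I₁ v) :
    ∃ (V : L2 (OmegaPer Ix I₁)) (Φ : L2 (SigmaPer I₁)) (F : Lp (H1 (Q c Ix I₁)) 2 unitMeas),
      V =ᵐ[volume.restrict (OmegaPer Ix I₁)] v ∧
      Φ =ᵐ[volume.restrict (SigmaPer I₁)] (fun p => v (0, p.1, p.2)) ∧
      IsShear c Ix I₁ V F ∧ IsShearSigma c I₁ Φ ((edgeTrace h).compLp F) := by
  obtain ⟨⟨w, hw, hws, hvw⟩, hve⟩ := hv
  obtain ⟨F, hF⟩ := exists_shear_smooth (c := c) hIx hI₁ hw hws hvw hve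
  have hmO : MeasurableSet (OmegaPer Ix I₁) :=
    hIx.measurableSet.prod (hI₁.measurableSet.prod measurableSet_Ioo)
  have hmS : MeasurableSet (SigmaPer I₁) := hI₁.measurableSet.prod measurableSet_Ioo
  have hV : MemLp w 2 (volume.restrict (OmegaPer Ix I₁)) :=
    (hw.continuous.memLp_of_hasCompactSupport (μ := volume) hws).restrict _
  have hemb : IsClosedEmbedding fun p : ℝ × ℝ => ((0 : ℝ), p.1, p.2) :=
    (Isometry.of_dist_eq fun p q => by simp [Prod.dist_eq]).isClosedEmbedding
  have hΦ : MemLp (fun p : ℝ × ℝ => w (0, p.1, p.2)) 2 (volume.restrict (SigmaPer I₁)) :=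
    ((hw.continuous.comp hemb.continuous).memLp_of_hasCompactSupport (μ := volume)
      (hws.comp_isClosedEmbedding hemb)).restrict _
  refine ⟨hV.toLp w, hΦ.toLp _, F, ?_, ?_, ?_, ?_⟩
  · filter_upwards [hV.coeFn_toLp, ae_restrict_mem hmO] with p h1 h2
    rw [h1, hvw (subset_closure h2)]
  · filter_upwards [hΦ.coeFn_toLp, ae_restrict_mem hmS] with p h1 h2
    rw [h1, hvw]
    rw [OmegaPer, closure_prod_eq]
    exact ⟨h.zero_mem, subset_closure h2⟩
  · filter_upwards [hF, ae_shear c Ix I₁ hV.coeFn_toLp] with s h1 h2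
    filter_upwards [h1, h2] with x h3 h4
    exact h3.trans h4.symm
  -- The sheared points of (x, z) and (0, z) have the same fractional part and differ only in x, so
  -- the slices are uniformly Lipschitz in x across all jumps of the fractional part.
  · obtain ⟨L, hL⟩ := hw.lipschitzWith_of_hasCompactSupport hws (by simp)
    filter_upwards [hF, (edgeTrace h).coeFn_compLp F, ae_shearSigma c I₁ hΦ.coeFn_toLp]
      with s h1 h2 h3
    rw [h2]
    have hm : Measurable fun x => w (shearPt c (s, x)) :=
      hw.continuous.measurable.comp ((measurable_shearPt c).comp measurable_prodMk_left)
    have key := traceOp_eq_of_lipschitz h (F s) (f := fun x => w (shearPt c (s, x)))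
      (g := fun z => w (shearPt c (s, (0, z)))) h1 hm (hm.comp measurable_prodMk_left) (L := L) ?_
    · filter_upwards [key, h3] with z h4 h5
      exact h4.trans h5.symm
    · intro p _
      rw [← dist_eq_norm]
      refine (hL.dist_le_mul _ _).trans (le_of_eq ?_)
      simp [shearPt, Prod.dist_eq]

end Trace

end AnisoTrace
-- Uniqueness and the main theorem
namespace AnisoTrace

/-- The values of a continuous trace operator on the images of smooth functions determine it. -/
theorem IsTracePer.unique {c : Cut} {Ix I₁ : Set ℝ} (hIx : IsOpen Ix) (hI₁ : IsOpen I₁)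
    (h : IsStrip Ix (edge c I₁)) {T T' : H1Cper c Ix I₁ →ₗ[ℂ] L2 (SigmaPer I₁)}
    (hT : IsTracePer c Ix I₁ T) (hT' : IsTracePer c Ix I₁ T') : T = T' := by
  have hQ := isOpen_Q c hIx hI₁
  obtain ⟨Λ, hΛ⟩ := exists_shearEquiv c hIx hI₁
  -- Continuity is transported to the Bochner space; the norm there is √jac times the graph norm,
  -- whence the constant K / √jac.
  have bound : ∀ {S : H1Cper c Ix I₁ →ₗ[ℂ] L2 (SigmaPer I₁)}, IsTracePer c Ix I₁ S →
      ∃ K, ∀ F, ‖S (Λ.symm F)‖ ≤ K * ‖F‖ := by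
    rintro S ⟨⟨K, hK⟩, -⟩
    refine ⟨K / √c.jac.toReal, fun F => ?_⟩
    obtain ⟨r, hr, hle⟩ := hK (Λ.symm F)
    have hF := hΛ (Λ.symm F)
    rw [Λ.apply_symm_apply] at hF
    obtain ⟨U, hU, hn⟩ := hF.exists_H1C hI₁.measurableSet
    have hr' : r = ‖U‖ := hr.unique hIx hI₁ ⟨U, hU, rfl⟩
    have hj : √c.jac.toReal ≠ 0 :=
      (Real.sqrt_pos.2 (ENNReal.toReal_pos c.jac_ne_zero c.jac_ne_top)).ne'
    rw [norm_eq_of_enorm_sq hn, ← hr']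
    refine hle.trans (le_of_eq ?_)
    field_simp
  obtain ⟨K, hK⟩ := bound hT
  obtain ⟨K', hK'⟩ := bound hT'
  let L : Lp (H1 (Q c Ix I₁)) 2 unitMeas →ₗ[ℂ] L2 (SigmaPer I₁) :=
    (T - T') ∘ₗ Λ.symm.toLinearMap
  have hL : ∀ F, L F = T (Λ.symm F) - T' (Λ.symm F) := fun F => rfl
  have hLb : ∀ F, ‖L F‖ ≤ (K + K') * ‖F‖ := fun F => by
    rw [hL, add_mul]
    exact (norm_sub_le (T (Λ.symm F)) (T' (Λ.symm F))).trans (add_le_add (hK F) (hK' F))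
  let A : Lp (H1 (Q c Ix I₁)) 2 unitMeas →L[ℂ] L2 (SigmaPer I₁) :=
    ⟨L, AddMonoidHomClass.continuous_of_bound L (K + K') hLb⟩
  have hA : A = 0 := by
    refine eq_zero_of_eq_zero_on_products (denseRange_testToSobolev_Q h hQ) A ?_
    intro a h1 h2 h3 w F hF
    have hsm := isSmoothPer_productPer c Ix I₁ h1 h2 h3 w.2.1 w.2.2
    -- Each trace operator supplies its own element representing the smooth product. Both elements
    -- have shear F, so they coincide and the two operators are compared at the same point.
    have key : ∀ V : H1Cper c Ix I₁, ((V : L2 (OmegaPer Ix I₁)) : ℝ × ℝ × ℝ → ℂ)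
        =ᵐ[volume.restrict (OmegaPer Ix I₁)] productPer c a w → V = Λ.symm F := by
      intro V hV
      rw [LinearEquiv.eq_symm_apply]
      refine (hΛ V).unique hIx hI₁ ?_
      filter_upwards [hF, ae_shear c Ix I₁ hV, ae_restrict_mem measurableSet_Ioo] with s k1 k2 hs
      rw [k1]
      filter_upwards [k2, Lp.coeFn_smul (a s : ℂ) ((testToSobolev hQ
        ![((1 : ℝ), (0 : ℝ)), (0, 1)] w).1 0),
        testToSobolev_coe hQ ![((1 : ℝ), (0 : ℝ)), (0, 1)] w] with x k3 k4 k5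
      refine k4.trans (Eq.trans ?_ k3.symm)
      rw [productPer_shearPt c a w hs, Pi.smul_apply, k5, smul_eq_mul]
    obtain ⟨V, hV, hVt⟩ := hT.2 _ hsm
    obtain ⟨W, hW, hWt⟩ := hT'.2 _ hsm
    rw [key V hV] at hVt
    rw [key W hW] at hWt
    change L F = 0
    rw [hL, sub_eq_zero]
    exact Lp.ext (hVt.trans hWt.symm)
  ext1 V
  have h1 := DFunLike.congr_fun hA (Λ V)
  have h2 : L (Λ V) = 0 := h1
  rwa [hL, Λ.symm_apply_apply, sub_eq_zero] at h2

end AnisoTrace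

theorem mainTheorem9 (c : Cut) (Ix I₁ : Set ℝ)
    (hIx : IsOpen Ix) (hIx' : Ix.OrdConnected) (h0 : (0 : ℝ) ∈ closure Ix)
    (hI₁ : IsOpen I₁) (hI₁' : I₁.OrdConnected) (hne : I₁.Nonempty) :
    ∃ γ : H1Cper c Ix I₁ →ₗ[ℂ] H12Cper c I₁,
      -- `γ` is the unique continuous extension of the restriction of smooth functions
      (IsTracePer c Ix I₁ ((H12Cper c I₁).subtype ∘ₗ γ) ∧
        ∀ T, IsTracePer c Ix I₁ T → T = (H12Cper c I₁).subtype ∘ₗ γ) ∧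
      -- `γ` is continuous from `H¹_{C,per}` to `H^{1/2}_{C,per}`
      (∃ K : ℝ, ∀ V : H1Cper c Ix I₁, ∃ r t, HasNormH1C c Ix I₁ V r ∧
        HasNormH12C c I₁ (γ V) t ∧ t ≤ K * r) ∧
      -- `γ` is onto `H^{1/2}_{C,per}`
      Function.Surjective γ ∧
      -- `γ` commutes with the shear map
      ∀ (V : H1Cper c Ix I₁) (F : Lp (H1 (Q c Ix I₁)) 2 unitMeas)
        (G : Lp (H12 (edge c I₁)) 2 unitMeas),
        IsShear c Ix I₁ V F → IsShearSigma c I₁ (γ V) G →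
          ∀ᵐ s ∂unitMeas, HasTrace (F s) (G s).1.fst := by
  have h : IsStrip Ix (edge c I₁) := isStrip_edge c hIx hIx' h0 hI₁ hI₁' hne
  obtain ⟨Λ, hΛ⟩ := exists_shearEquiv c hIx hI₁
  obtain ⟨Λσ, hΛσ⟩ := exists_shearSigmaEquiv c hI₁.measurableSet
  -- The classical trace for each s, between the two shear isomorphisms.
  let γ : H1Cper c Ix I₁ →ₗ[ℂ] H12Cper c I₁ :=
    Λσ.symm.toLinearMap ∘ₗ (edgeTrace h).compLpₗ 2 unitMeas ∘ₗ Λ.toLinearMap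
  have hγ : ∀ V, Λσ (γ V) = (edgeTrace h).compLp (Λ V) := fun V => Λσ.apply_symm_apply _
  have hγs : ∀ V, IsShearSigma c I₁ (γ V) ((edgeTrace h).compLp (Λ V)) := fun V =>
    hγ V ▸ hΛσ (γ V)
  have hbound : ∀ V : H1Cper c Ix I₁, ∃ r, HasNormH1C c Ix I₁ V r ∧
      ‖(edgeTrace h).compLp (Λ V)‖ ≤ ‖edgeTrace h‖ * √c.jac.toReal * r := by
    intro V
    obtain ⟨U, hU, hn⟩ := (hΛ V).exists_H1C hI₁.measurableSet
    refine ⟨‖U‖, ⟨U, hU, rfl⟩, ?_⟩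
    rw [mul_assoc, ← norm_eq_of_enorm_sq hn]
    exact (edgeTrace h).norm_compLp_le (Λ V)
  have htr : IsTracePer c Ix I₁ ((H12Cper c I₁).subtype ∘ₗ γ) := by
    -- Shearing multiplies L² norms on the face by the same √jac as on the domain. The inverse
    -- factor unshears the trace.
    refine ⟨⟨(√c.jac.toReal)⁻¹ * (‖H12Fst (edge c I₁)‖ * (‖edgeTrace h‖ * √c.jac.toReal)),
      fun V => ?_⟩, fun v hv => ?_⟩
    · obtain ⟨r, hr, hle⟩ := hbound V
      refine ⟨r, hr, ?_⟩
      have h1 := norm_eq_of_enorm_sq (enorm_sq_of_shear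
        (measurePreserving_shearPtSigma c hI₁.measurableSet) (isShearSigma_iff.1 (hγs V)))
      have hj : 0 < √c.jac.toReal :=
        Real.sqrt_pos.2 (ENNReal.toReal_pos c.jac_ne_zero c.jac_ne_top)
      have h2 := (H12Fst (edge c I₁)).norm_compLp_le ((edgeTrace h).compLp (Λ V))
      have h3 := h2.trans (mul_le_mul_of_nonneg_left hle (H12Fst (edge c I₁)).opNorm_nonneg)
      rw [h1] at h3
      rw [mul_assoc, mul_assoc, le_inv_mul_iff₀ hj]
      exact h3
    · obtain ⟨V, Φ, F, hV, hΦ, hF, hG⟩ := exists_trace_smooth hIx hI₁ h hv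
      refine ⟨⟨V, F, hF⟩, hV, ?_⟩
      have e1 : Λ ⟨V, F, hF⟩ = F := (hΛ ⟨V, F, hF⟩).unique hIx hI₁ hF
      have e2 : γ ⟨V, F, hF⟩ = ⟨Φ, _, hG⟩ := by
        refine Λσ.injective ?_
        rw [hγ, e1]
        exact hG.unique c (hΛσ ⟨Φ, _, hG⟩)
      rw [LinearMap.comp_apply, e2]
      exact hΦ
  refine ⟨γ, ⟨htr, fun T hT => hT.unique hIx hI₁ h htr⟩,
    ⟨‖edgeTrace h‖ * √c.jac.toReal, fun V => ?_⟩, fun Φ => ?_, fun V F G hF hG => ?_⟩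
  · obtain ⟨r, hr, hle⟩ := hbound V
    exact ⟨r, _, hr, ⟨_, hγs V, rfl⟩, hle⟩
  -- Preimages must be chosen square integrably in s; applying one bounded linear right inverse for
  -- every s does so.
  · obtain ⟨R, hR⟩ := exists_rightInverse (edgeTrace h) (edgeTrace_surjective h)
    refine ⟨Λ.symm (R.compLp (Λσ Φ)), Λσ.injective ?_⟩
    rw [hγ, Λ.apply_symm_apply]
    refine Lp.ext ?_
    filter_upwards [(edgeTrace h).coeFn_compLp (R.compLp (Λσ Φ)), R.coeFn_compLp (Λσ Φ)]
      with s h1 h2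
    rw [h1, h2, hR]
  · have e1 := hF.unique hIx hI₁ (hΛ V)
    have e2 := hG.unique c (hγs V)
    subst e1 e2
    filter_upwards [(edgeTrace h).coeFn_compLp (Λ V)] with s hs
    rw [hs]
    exact hasTrace_edgeTrace h _
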